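/- **Conventions.** An element $f$ of the Brown–Thompson group $F_3$ is given by its unique reduced pair $(T_+,T_-)$ of finite rooted planar ternary trees with the same number of leaves; $T_+$ is drawn with its root at the top, $T_-$ upside down below it with its root at the bottom, and the $i$-th leaf of $T_+$ is identified with the $i$-th leaf of $T_-$. Vertices have addresses in $\{0,1,2\}^*$, read from the root ($0$ = left, $1$ = middle, $2$ = right). The pair is reduced if no three consecutive leaves are the children of one vertex both in $T_+$ and in $T_-$. If $\alpha$ is the address of a leaf of $T_+$, then $f\diamond_\alpha g$ is the element obtained by attaching the pair of trees of $g$ at the leaf $\alpha$ of $T_+$ and at the corresponding leaf of $T_-$; $f\diamond_0 g$ is $f\diamond_\alpha g$ for $\alpha=0^m$ the leftmost leaf. The link $\mathcal L(f)$ has the following diagram: at every vertex of $T_\pm$ the strand from the left to the right child passes over the strand from the parent edge to the middle child, and the two roots are joined by an arc on the left. The component through the roots is the central component $\mathcal K(f)$; it is oriented clockwise, i.e. downwards at the root of $T_+$. Links are considered up to isotopy (diagrams up to planar isotopy and Reidemeister moves). For $n\ge 1$ let $H^{n}\in F_3$ be defined as follows (trees are given by the addresses of their interior vertices). $H^1$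 has upper tree $\{\emptyset,1,11\}$ and lower tree $\{\emptyset,0,01\}$. $H^{n}$ ($n\ge2$) is obtained from $H^{n-1}$ by adding vertices at the leaves $11\,2^{n-2}0$ and $11\,2^{n-1}$ of the upper tree and attaching the tree $\{\emptyset,1\}$ at the leaf $0\,2^{n-1}$ of the lower tree. $H^{-1}$ has upper tree $\{\emptyset,1,12\}$ and lower tree $\{\emptyset,2,20\}$. $H^{-n}$ ($n\ge2$) is obtained from $H^{-(n-1)}$ by adding vertices at the leaves $2\,0^{n}$ and $2\,0^{n-1}2$ of the lower tree and attaching the tree $\{\emptyset,1\}$ at the leaf $11\,0^{n-2}$ of the upper tree. Put $$l_n(f,g)=(H^n\diamond_{12}f)\diamond_0 g,\qquad l_{-n}(f,g)=(H^{-n}\diamond_{10}f)\diamond_0 g .$$ In $\mathcal L(l_{n}(f,g))$ denote by $\mathcal K(f)$ and $\mathcal K(g)$ the components through the points where $f$ and $g$ are attached (the addresses $12$ and $0$), and likewise in $\mathcal L(l_{-n}(f,g))$ (the addresses $10$ and $0$); both are oriented downwards at these points, which agrees with the orientations of the central components of $\mathcal L(f)$ and $\mathcal L(g)$. **Proposition.**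 Let $f,g\in F_3$ and let $n\ge1$ be an integer. 1. In $\mathcal L(l_n(f,g))$ the components $\mathcal K(f)$ and $\mathcal K(g)$ are distinct, and $\operatorname{lk}(\mathcal K(f),\mathcal K(g))=n$. Moreover $\mathcal L(l_n(f,g))$ is isotopic, by an isotopy respecting these two oriented components, to the link with the following twisted diagram: two strands, one belonging to $\mathcal K(f)$ and one to $\mathcal K(g)$, are twisted around each other by $n$ full twists, i.e. by the two-strand braid with $2n$ crossings in each of which the strand from the upper right to the lower left lies over; the first strand is closed up by an arc on its left and the second one by an arc on its right; and the diagrams of $f$ and $g$ (cut open at the roots) are inserted in the first and in the second strand, so that both strands are directed downwards in the twists. 2. In $\mathcal L(l_{-n}(f,g))$ the components $\mathcal K(f)$ and $\mathcal K(g)$ are distinct, and $\operatorname{lk}(\mathcal K(f),\mathcal K(g))=-n$. Moreover $\mathcal L(l_{-n}(f,g))$ is isotopic, by an isotopy respecting these two oriented components, to the link with the analogous diagram, with the same twists, in which the diagram of $g$ is inserted in the closing arc on the right (directed downwards there), so that the two strands are directed oppositely in the twists. -/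

import Mathlib

namespace ThompsonLink

/-! ### Ternary trees and the Brown–Thompson group `F₃` -/

/-- Finite rooted planar ternary trees. -/
inductive TernaryTree : Type
  | leaf : TernaryTree
  | node (l m r : TernaryTree) : TernaryTree

namespace TernaryTree

/-- The number of leaves. Leaves are numbered from left to right, starting with `0`. -/
def numLeaves : TernaryTree → ℕ
  | leaf => 1
  | node l m r => l.numLeaves + m.numLeaves + r.numLeaves

/-- The tree with exactly one interior vertex. -/
def caret : TernaryTree := node leaf leaf leaf

/-- The leaves number `i`, `i + 1`, `i + 2` are the three children of one vertex. -/
def HasCaretAt : TernaryTree → ℕ → Prop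
  | leaf, _ => False
  | node l m r, i =>
      (l = leaf ∧ m = leaf ∧ r = leaf ∧ i = 0) ∨ l.HasCaretAt i ∨
        (∃ j, i = l.numLeaves + j ∧ m.HasCaretAt j) ∨
        (∃ j, i = l.numLeaves + m.numLeaves + j ∧ r.HasCaretAt j)

/-- Replace the leaf number `i` of a tree by the tree `S` (nothing happens if there is no such
leaf). -/
def graft : TernaryTree → ℕ → TernaryTree → TernaryTree
  | leaf, i, S => if i = 0 then S else leaf
  | node l m r, i, S =>
      if i < l.numLeaves then node (l.graft i S) m r
      else if i < l.numLeaves + m.numLeaves then node l (m.graft (i - l.numLeaves) S) r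
      else node l m (r.graft (i - (l.numLeaves + m.numLeaves)) S)

/-- Addresses of vertices: words in `0` (left), `1` (straight), `2` (right), read from the root. -/
abbrev Address : Type := List (Fin 3)

/-- The number of the leaf with address `α`; it is `none` if there is no leaf at `α`. -/
def leafIndex : TernaryTree → Address → Option ℕ
  | leaf, [] => some 0
  | leaf, _ :: _ => none
  | node _ _ _, [] => none
  | node l m r, d :: α =>
      match d with
      | 0 => l.leafIndex α
      | 1 => (m.leafIndex α).map (fun j => l.numLeaves + j)
      | 2 => (r.leafIndex α).map (fun j => l.numLeaves + m.numLeaves + j)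

/-- The address of the unique leaf of the form `d d ... d`. -/
def constLeaf (d : Fin 3) : TernaryTree → Address
  | leaf => []
  | node l m r =>
      match d with
      | 0 => d :: constLeaf d l
      | 1 => d :: constLeaf d m
      | 2 => d :: constLeaf d r

theorem numLeaves_pos (T : TernaryTree) : 0 < T.numLeaves := by
  induction T with
  | leaf => simp [numLeaves]
  | node l m r hl hm hr => simp only [numLeaves]; omega

theorem eq_leaf_of_numLeaves {T : TernaryTree} (h : T.numLeaves = 1) : T = leaf := by
  cases T with
  | leaf => rfl
  | node l m r =>
      have := numLeaves_pos l; have := numLeaves_pos m; have := numLeaves_pos r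
      simp only [numLeaves] at h; omega

theorem HasCaretAt.lt {T : TernaryTree} {i : ℕ} (h : T.HasCaretAt i) : i + 2 < T.numLeaves := by
  induction T generalizing i with
  | leaf => exact h.elim
  | node l m r hl hm hr =>
      have := numLeaves_pos l; have := numLeaves_pos m; have := numLeaves_pos r
      simp only [numLeaves]
      rcases h with ⟨-, -, -, rfl⟩ | h | ⟨j, rfl, h⟩ | ⟨j, rfl, h⟩
      · omega
      · have := hl h; omega
      · have := hm h; omega
      · have := hr h; omega

theorem numLeaves_graft (T : TernaryTree) (i : ℕ) (S : TernaryTree) :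
    (T.graft i S).numLeaves =
      if i < T.numLeaves then T.numLeaves + S.numLeaves - 1 else T.numLeaves := by
  induction T generalizing i with
  | leaf =>
      by_cases h : i = 0
      · simp [graft, numLeaves, h]
      · have : ¬ i < 1 := by omega
        simp [graft, numLeaves, h]
  | node l m r hl hm hr =>
      have := numLeaves_pos l; have := numLeaves_pos m; have := numLeaves_pos r
      have := numLeaves_pos S
      simp only [graft]
      split_ifs <;> simp only [numLeaves, hl, hm, hr] at * <;> split_ifs <;> omega

theorem graft_leaf (T : TernaryTree) (i : ℕ) : T.graft i leaf = T := by
  induction T generalizing i with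
  | leaf => simp [graft]
  | node l m r hl hm hr => simp [graft, hl, hm, hr]

theorem graft_of_not_lt (T S : TernaryTree) {i : ℕ} (h : ¬ i < T.numLeaves) : T.graft i S = T := by
  induction T generalizing i with
  | leaf =>
      have : i ≠ 0 := by simp only [numLeaves] at h; omega
      simp [graft, this]
  | node l m r hl hm hr =>
      simp only [numLeaves] at h
      have h1 : ¬ i < l.numLeaves := by omega
      have h2 : ¬ i < l.numLeaves + m.numLeaves := by omega
      simp only [graft, if_neg h1, if_neg h2]
      rw [hr (by omega)]

theorem graft_ne_leaf {T : TernaryTree} {i : ℕ} {S : TernaryTree} (hS : S ≠ leaf)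
    (hi : i < T.numLeaves) : T.graft i S ≠ leaf := by
  cases T with
  | leaf =>
      have : i = 0 := by simp only [numLeaves] at hi; omega
      simpa [graft, this] using hS
  | node l m r => simp only [graft]; split_ifs <;> simp

theorem hasCaretAt_graft {T : TernaryTree} {i j : ℕ} {S : TernaryTree} (hS : S ≠ leaf)
    (hi : i < T.numLeaves) (h : (T.graft i S).HasCaretAt j) :
    (j + 2 < i ∧ T.HasCaretAt j) ∨ (∃ k, j = i + k ∧ S.HasCaretAt k) ∨
      (∃ k, i < k ∧ j + 1 = k + S.numLeaves ∧ T.HasCaretAt k) := by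
  induction T generalizing i j with
  | leaf =>
      have : i = 0 := by simp only [numLeaves] at hi; omega
      subst this
      simp only [graft, if_true] at h
      exact Or.inr (Or.inl ⟨j, by omega, h⟩)
  | node l m r hl hm hr =>
      have := numLeaves_pos l; have := numLeaves_pos m; have := numLeaves_pos r
      have := numLeaves_pos S
      simp only [numLeaves] at hi
      simp only [graft] at h
      split_ifs at h with h1 h2
      · have hn := numLeaves_graft l i S
        rw [if_pos h1] at hn
        rcases h with ⟨e, -⟩ | h | ⟨k, rfl, h⟩ | ⟨k, rfl, h⟩
        · exact absurd e (graft_ne_leaf hS h1)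
        · rcases hl h1 h with ⟨a, b⟩ | ⟨k, a, b⟩ | ⟨k, a, b, c⟩
          · exact Or.inl ⟨a, Or.inr (Or.inl b)⟩
          · exact Or.inr (Or.inl ⟨k, a, b⟩)
          · exact Or.inr (Or.inr ⟨k, a, b, Or.inr (Or.inl c)⟩)
        · exact Or.inr (Or.inr ⟨l.numLeaves + k, by omega, by omega,
            Or.inr (Or.inr (Or.inl ⟨k, rfl, h⟩))⟩)
        · exact Or.inr (Or.inr ⟨l.numLeaves + m.numLeaves + k, by omega, by omega,
            Or.inr (Or.inr (Or.inr ⟨k, rfl, h⟩))⟩)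
      · have h3 : i - l.numLeaves < m.numLeaves := by omega
        have hn := numLeaves_graft m (i - l.numLeaves) S
        rw [if_pos h3] at hn
        rcases h with ⟨-, e, -⟩ | h | ⟨k, rfl, h⟩ | ⟨k, rfl, h⟩
        · exact absurd e (graft_ne_leaf hS h3)
        · have := h.lt
          exact Or.inl ⟨by omega, Or.inr (Or.inl h)⟩
        · rcases hm h3 h with ⟨a, b⟩ | ⟨k', a, b⟩ | ⟨k', a, b, c⟩
          · exact Or.inl ⟨by omega, Or.inr (Or.inr (Or.inl ⟨k, rfl, b⟩))⟩
          · exact Or.inr (Or.inl ⟨k', by omega, b⟩)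
          · exact Or.inr (Or.inr ⟨l.numLeaves + k', by omega, by omega,
              Or.inr (Or.inr (Or.inl ⟨k', rfl, c⟩))⟩)
        · exact Or.inr (Or.inr ⟨l.numLeaves + m.numLeaves + k, by omega, by omega,
            Or.inr (Or.inr (Or.inr ⟨k, rfl, h⟩))⟩)
      · have h3 : i - (l.numLeaves + m.numLeaves) < r.numLeaves := by omega
        rcases h with ⟨-, -, e, -⟩ | h | ⟨k, rfl, h⟩ | ⟨k, rfl, h⟩
        · exact absurd e (graft_ne_leaf hS h3)
        · have := h.lt
          exact Or.inl ⟨by omega, Or.inr (Or.inl h)⟩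
        · have := h.lt
          exact Or.inl ⟨by omega, Or.inr (Or.inr (Or.inl ⟨k, rfl, h⟩))⟩
        · rcases hr h3 h with ⟨a, b⟩ | ⟨k', a, b⟩ | ⟨k', a, b, c⟩
          · exact Or.inl ⟨by omega, Or.inr (Or.inr (Or.inr ⟨k, rfl, b⟩))⟩
          · exact Or.inr (Or.inl ⟨k', by omega, b⟩)
          · exact Or.inr (Or.inr ⟨l.numLeaves + m.numLeaves + k', by omega, by omega,
              Or.inr (Or.inr (Or.inr ⟨k', rfl, c⟩))⟩)

end TernaryTree

open TernaryTree

/-- The elements of the Brown–Thompson group `F₃`, each given by its reduced pair of ternary trees: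
the upper tree (domain) and the lower tree (range) have equally many leaves, and no caret of the
upper tree faces a caret of the lower tree. -/
structure F3 : Type where
  upper : TernaryTree
  lower : TernaryTree
  numLeaves_eq : upper.numLeaves = lower.numLeaves
  reduced : ∀ i, ¬ (upper.HasCaretAt i ∧ lower.HasCaretAt i)

namespace F3

/-- The identity element: both trees are trivial. -/
def one : F3 := ⟨leaf, leaf, rfl, fun _ h => h.1⟩

/-- Attach the pair of trees of `g` at the leaf number `i` of the pair of trees of `f`, i.e. the
upper tree of `g` at that leaf of the upper tree of `f` and the lower tree of `g` at that leaf of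
the lower tree of `f`. The result is again reduced. -/
def attach (f : F3) (i : ℕ) (g : F3) : F3 where
  upper := f.upper.graft i g.upper
  lower := f.lower.graft i g.lower
  numLeaves_eq := by
    rw [numLeaves_graft, numLeaves_graft, f.numLeaves_eq, g.numLeaves_eq]
  reduced := by
    intro j hj
    have he := g.numLeaves_eq
    by_cases hg : g.upper = leaf
    · have hg' : g.lower = leaf := by
        apply eq_leaf_of_numLeaves
        rw [← he, hg]
        rfl
      rw [hg, hg', graft_leaf, graft_leaf] at hj
      exact f.reduced j hj
    have hg' : g.lower ≠ leaf := by
      intro h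
      apply hg
      apply eq_leaf_of_numLeaves
      rw [he, h]
      rfl
    by_cases hi : i < f.upper.numLeaves
    · have hi' : i < f.lower.numLeaves := f.numLeaves_eq ▸ hi
      rcases hasCaretAt_graft hg hi hj.1 with ⟨a, b⟩ | ⟨k, a, b⟩ | ⟨k, a, b, c⟩ <;>
        rcases hasCaretAt_graft hg' hi' hj.2 with ⟨a', b'⟩ | ⟨k', a', b'⟩ | ⟨k', a', b', c'⟩
      · exact f.reduced j ⟨b, b'⟩
      · omega
      · omega
      · omega
      · have : k = k' := by omega
        exact g.reduced k ⟨b, this ▸ b'⟩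
      · have := b.lt
        omega
      · omega
      · have := b'.lt
        omega
      · have : k = k' := by omega
        exact f.reduced k ⟨c, this ▸ c'⟩
    · rw [graft_of_not_lt _ _ hi, graft_of_not_lt _ _ (f.numLeaves_eq ▸ hi)] at hj
      exact f.reduced j hj

/-- `f ⋄_α g`: attach `g` at the leaf with address `α` of the upper tree of `f`. (Only meant for
addresses `α` of leaves; otherwise the value is `f`.) -/
def diamondAt (f : F3) (α : Address) (g : F3) : F3 :=
  match f.upper.leafIndex α with
  | some i => f.attach i g
  | none => f

/-- `f ⋄_d g`: attach `g` at the leaf of `f` with address `d d ... d`. -/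
def diamond (d : Fin 3) (f g : F3) : F3 :=
  f.diamondAt (constLeaf d f.upper) g

end F3

/-! ### The elements `H^n`, `H^{-n}` and the linking moves -/

/-- The subtree at the address `11` of the upper tree of `H^(k+1)`. Passing from `k` to `k + 1`
adds a caret at the addresses `2^k 0` and `2^(k+1)`. -/
def posUp : ℕ → TernaryTree
  | 0 => caret
  | k + 1 => node caret leaf (posUp k)

/-- The subtree at the address `0` of the lower tree of `H^(k+1)`. Passing from `k` to `k + 1`
replaces the leaf `2^(k+1)` by the tree `node leaf caret leaf`. -/
def posLow : ℕ → TernaryTree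
  | 0 => node leaf caret leaf
  | k + 1 => node leaf caret (posLow k)

/-- The subtree at the address `11` of the upper tree of `H^(-(k+1))`. Passing from `k` to `k + 1`
replaces the leaf `0^k` by the tree `node leaf caret leaf`. -/
def negUp : ℕ → TernaryTree
  | 0 => leaf
  | k + 1 => node (negUp k) caret leaf

/-- The subtree at the address `20` of the lower tree of `H^(-(k+1))`. Passing from `k` to `k + 1`
adds a caret at the addresses `0^(k+1)` and `0^k 2`. -/
def negLow : ℕ → TernaryTree
  | 0 => caret
  | k + 1 => node (negLow k) leaf caret

theorem numLeaves_posUp (k : ℕ) : (posUp k).numLeaves = 4 * k + 3 := by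
  induction k with
  | zero => rfl
  | succ k ih => simp only [posUp, caret, numLeaves, ih]; omega

theorem numLeaves_posLow (k : ℕ) : (posLow k).numLeaves = 4 * k + 5 := by
  induction k with
  | zero => rfl
  | succ k ih => simp only [posLow, caret, numLeaves, ih]; omega

theorem numLeaves_negUp (k : ℕ) : (negUp k).numLeaves = 4 * k + 1 := by
  induction k with
  | zero => rfl
  | succ k ih => simp only [negUp, caret, numLeaves, ih]; omega

theorem numLeaves_negLow (k : ℕ) : (negLow k).numLeaves = 4 * k + 3 := by
  induction k with
  | zero => rfl
  | succ k ih => simp only [negLow, caret, numLeaves, ih]; omega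

theorem caret_mod_posUp (k i : ℕ) (h : (posUp k).HasCaretAt i) : i % 4 = 0 := by
  induction k generalizing i with
  | zero => simp [posUp, caret, HasCaretAt] at h; omega
  | succ k ih =>
      simp only [posUp, caret, HasCaretAt, numLeaves] at h
      rcases h with ⟨h, -⟩ | h | ⟨j, -, h⟩ | ⟨j, rfl, h⟩
      · cases h
      · simp at h; omega
      · exact h.elim
      · have := ih j h; omega

theorem caret_mod_posLow (k i : ℕ) (h : (posLow k).HasCaretAt i) : i % 4 = 1 := by
  induction k generalizing i with
  | zero => simp [posLow, caret, HasCaretAt, numLeaves] at h; omega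
  | succ k ih =>
      simp only [posLow, caret, HasCaretAt, numLeaves] at h
      rcases h with ⟨-, h, -⟩ | h | ⟨j, rfl, h⟩ | ⟨j, rfl, h⟩
      · cases h
      · exact h.elim
      · simp at h; omega
      · have := ih j h; omega

theorem caret_mod_negUp (k i : ℕ) (h : (negUp k).HasCaretAt i) : i % 4 = 1 := by
  induction k generalizing i with
  | zero => exact h.elim
  | succ k ih =>
      simp only [negUp, caret, HasCaretAt, numLeaves, numLeaves_negUp] at h
      rcases h with ⟨-, h, -⟩ | h | ⟨j, rfl, h⟩ | ⟨j, rfl, h⟩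
      · cases h
      · exact ih i h
      · simp at h; omega
      · exact h.elim

theorem caret_mod_negLow (k i : ℕ) (h : (negLow k).HasCaretAt i) : i % 4 = 0 := by
  induction k generalizing i with
  | zero => simp [negLow, caret, HasCaretAt] at h; omega
  | succ k ih =>
      simp only [negLow, caret, HasCaretAt, numLeaves, numLeaves_negLow] at h
      rcases h with ⟨-, -, h, -⟩ | h | ⟨j, -, h⟩ | ⟨j, rfl, h⟩
      · cases h
      · exact ih i h
      · exact h.elim
      · simp at h; omega

/-- The element `H^n`, for `n ≥ 1`. -/
def hopfPos (n : ℕ) : F3 where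
  upper := node leaf (node leaf (posUp (n - 1)) leaf) leaf
  lower := node (posLow (n - 1)) leaf leaf
  numLeaves_eq := by
    simp only [numLeaves, numLeaves_posUp, numLeaves_posLow]; omega
  reduced := by
    rintro i ⟨hu, hl⟩
    simp only [HasCaretAt, numLeaves, and_false, exists_false, or_false, false_or] at hu hl
    rcases hl with ⟨e, -, -, -⟩ | hl
    · have := numLeaves_posLow (n - 1)
      rw [e] at this
      simp only [numLeaves] at this; omega
    have := caret_mod_posLow _ _ hl
    rcases hu with ⟨-, e, -⟩ | ⟨j, rfl, ⟨-, e, -⟩ | ⟨j', rfl, h⟩⟩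
    · cases e
    · have := numLeaves_posUp (n - 1)
      rw [e] at this
      simp only [numLeaves] at this; omega
    · have := caret_mod_posUp _ _ h
      omega

/-- The element `H^{-n}`, for `n ≥ 1`. -/
def hopfNeg (n : ℕ) : F3 where
  upper := node leaf (node leaf (negUp (n - 1)) caret) leaf
  lower := node leaf leaf (node (negLow (n - 1)) leaf leaf)
  numLeaves_eq := by
    simp only [numLeaves, caret, numLeaves_negUp, numLeaves_negLow]; omega
  reduced := by
    rintro i ⟨hu, hl⟩
    simp only [HasCaretAt, numLeaves, and_false, exists_false, or_false, false_or] at hu hl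
    have h2 : i % 4 = 2 := by
      rcases hl with ⟨-, -, e, -⟩ | ⟨j, rfl, ⟨e, -⟩ | h⟩
      · cases e
      · have := numLeaves_negLow (n - 1)
        rw [e] at this
        simp only [numLeaves] at this; omega
      · have := caret_mod_negLow _ _ h
        omega
    rcases hu with ⟨-, e, -⟩ | ⟨j, rfl, ⟨-, -, e, -⟩ | ⟨j', rfl, h⟩ | ⟨j', rfl, h⟩⟩
    · cases e
    · cases e
    · have := caret_mod_negUp _ _ h
      omega
    · simp only [caret, HasCaretAt, numLeaves, numLeaves_negUp] at h h2
      simp at h; omega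

/-- The linking move `l_n(f, g) = (H^n ⋄_{12} f) ⋄_0 g`. -/
def linkPos (n : ℕ) (f g : F3) : F3 := F3.diamond 0 ((hopfPos n).diamondAt [1, 2] f) g

/-- The linking move `l_{-n}(f, g) = (H^{-n} ⋄_{10} f) ⋄_0 g`. -/
def linkNeg (n : ℕ) (f g : F3) : F3 := F3.diamond 0 ((hopfNeg n).diamondAt [1, 0] f) g

/-! ### Link and tangle diagrams up to isotopy -/

/-- The names of the two marked components. -/
inductive Label : Type
  | Kf : Label
  | Kg : Label

/-- The elementary pieces of a planar diagram cut into horizontal slices and read from top to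
bottom; `i` is the number (from the left, starting with `0`) of the leftmost strand involved.
* `cap i`: a local maximum; two new strands `i`, `i + 1` begin.
* `cup i`: a local minimum; the strands `i`, `i + 1` are joined and end.
* `cross b i`: the strands `i`, `i + 1` cross. If `b = true`, the strand from the upper right to the
  lower left lies over the other one, if `b = false`, it lies under it.
* `mark c d i`: the strand `i` carries a point that marks its component as the one named `c` and
  orients it: downwards at that point if `d = true`, upwards if `d = false`. -/
inductive Slice : Type
  | cap (i : ℕ) : Slice
  | cup (i : ℕ) : Slice
  | cross (b : Bool) (i : ℕ) : Slice
  | mark (c : Label) (d : Bool) (i : ℕ) : Slice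

namespace Slice

/-- The number of strands that enter the piece from above. -/
def inputs : Slice → ℕ
  | cap _ => 0
  | cup _ => 2
  | cross _ _ => 2
  | mark _ _ _ => 1

/-- The number of strands that leave the piece below. -/
def outputs : Slice → ℕ
  | cap _ => 2
  | cup _ => 0
  | cross _ _ => 2
  | mark _ _ _ => 1

/-- The number of the leftmost strand involved. -/
def pos : Slice → ℕ
  | cap i => i
  | cup i => i
  | cross _ i => i
  | mark _ _ i => i

/-- The same piece, moved to the strand `i`. -/
def at' : Slice → ℕ → Slice
  | cap _, i => cap i
  | cup _, i => cup i
  | cross b _, i => cross b i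
  | mark c d _, i => mark c d i

end Slice

open Slice

/-- A sliced diagram, from top to bottom. -/
abbrev Diagram : Type := List Slice

/-- `IsTangle w k m`: the word `w` is a tangle diagram with `k` upper and `m` lower endpoints. Link
diagrams are the case `k = m = 0`. -/
inductive IsTangle : Diagram → ℕ → ℕ → Prop
  | nil (k : ℕ) : IsTangle [] k k
  | cons (s : Slice) (w : Diagram) (r m : ℕ) (hs : s.pos ≤ r)
      (hw : IsTangle w (r + s.outputs) m) : IsTangle (s :: w) (r + s.inputs) m

/-- The local moves on sliced diagrams that generate isotopy of tangles: planar isotopies, the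
Reidemeister moves, and sliding a mark along its strand. -/
inductive Move : Diagram → Diagram → Prop
  | exchange (a b : Slice) (i d : ℕ) :
      Move [b.at' (i + a.inputs + d), a.at' i] [a.at' i, b.at' (i + a.outputs + d)]
  | zigzag_left (i : ℕ) : Move [cap (i + 1), cup i] []
  | zigzag_right (i : ℕ) : Move [cap i, cup (i + 1)] []
  | cap_slide (b : Bool) (i : ℕ) : Move [cap i, cross b (i + 1)] [cap (i + 1), cross (!b) i]
  | cup_slide (b : Bool) (i : ℕ) : Move [cross b (i + 1), cup i] [cross (!b) i, cup (i + 1)]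
  | reidemeister_one_cap (b : Bool) (i : ℕ) : Move [cap i, cross b i] [cap i]
  | reidemeister_one_cup (b : Bool) (i : ℕ) : Move [cross b i, cup i] [cup i]
  | reidemeister_two (b : Bool) (i : ℕ) : Move [cross b i, cross (!b) i] []
  | reidemeister_three (b : Bool) (i : ℕ) :
      Move [cross b i, cross b (i + 1), cross b i] [cross b (i + 1), cross b i, cross b (i + 1)]
  | mark_cross_left (c : Label) (d b : Bool) (i : ℕ) :
      Move [mark c d i, cross b i] [cross b i, mark c d (i + 1)]
  | mark_cross_right (c : Label) (d b : Bool) (i : ℕ) :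
      Move [mark c d (i + 1), cross b i] [cross b i, mark c d i]
  | mark_cap (c : Label) (d : Bool) (i : ℕ) :
      Move [cap i, mark c d i] [cap i, mark c (!d) (i + 1)]
  | mark_cup (c : Label) (d : Bool) (i : ℕ) :
      Move [mark c d i, cup i] [mark c (!d) (i + 1), cup i]

/-- One local move, applied somewhere inside a tangle diagram with `k` upper and `m` lower
endpoints. -/
def Step (k m : ℕ) (w w' : Diagram) : Prop :=
  IsTangle w k m ∧ IsTangle w' k m ∧
    ∃ p a b s : Diagram, w = p ++ a ++ s ∧ w' = p ++ b ++ s ∧ Move a b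

/-- Isotopy of links with marked, oriented components, in terms of their diagrams. -/
def LinkIsotopic (w w' : Diagram) : Prop :=
  IsTangle w 0 0 ∧ IsTangle w' 0 0 ∧ Relation.EqvGen (Step 0 0) w w'

/-! ### Jones' construction -/

/-- The diagram of an upper tree whose root is the strand `i`. At every vertex, the strand from the
left to the right child (a local maximum) passes over the strand from the root to the middle child.
The edge that ends in the vertex `α` carries a mark `c`, directed downwards, if `μ α = some c`. -/
def upperDiagram : TernaryTree → (Address → Option Label) → ℕ → Diagram
  | leaf, μ, i => (μ []).toList.map (fun c => mark c true i)
  | node l m r, μ, i =>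
      (μ []).toList.map (fun c => mark c true i) ++ [cap (i + 1), cross true i] ++
        upperDiagram r (fun α => μ (2 :: α)) (i + 2) ++
        upperDiagram m (fun α => μ (1 :: α)) (i + 1) ++
        upperDiagram l (fun α => μ (0 :: α)) i

/-- The diagram of a lower tree (drawn upside down, the root at the bottom) whose root is the strand
`i`. Again the strand from the left to the right child passes over. -/
def lowerDiagram : TernaryTree → ℕ → Diagram
  | leaf, _ => []
  | node l m r, i =>
      lowerDiagram l i ++ lowerDiagram m (i + 1) ++ lowerDiagram r (i + 2) ++
        [cross false i, cup (i + 1)]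

/-- The diagram of the pair of trees of `f` before the two roots are joined, with both roots on the
strand `i`. -/
def openDiagram (f : F3) (μ : Address → Option Label) (i : ℕ) : Diagram :=
  upperDiagram f.upper μ i ++ lowerDiagram f.lower i

/-- The diagram of the link `𝓛(f)`: the two roots are joined by an arc on the left. -/
def linkDiagram (f : F3) (μ : Address → Option Label) : Diagram :=
  [cap 0] ++ openDiagram f μ 1 ++ [cup 0]

/-- The mark `c` at the root, that is on the central component `𝓚(f)`, which is oriented downwards
there (clockwise, as the roots are joined on the left). -/
def markRoot (c : Label) (α : Address) : Option Label :=
  if α = [] then some c else none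

/-- The mark `Kf` at the address `α` and the mark `Kg` at the address `β`. -/
def markAt (α β : Address) (γ : Address) : Option Label :=
  if γ = α then some Label.Kf else if γ = β then some Label.Kg else none

/-- The link diagram of `l_n(f, g)` with the component `𝓚(f)` marked where `f` is attached (address
`12`) and the component `𝓚(g)` marked where `g` is attached (address `0`), both oriented downwards
there as in the conventions for `𝓚(f)` and `𝓚(g)`. -/
def linkPosDiagram (n : ℕ) (f g : F3) : Diagram :=
  linkDiagram (linkPos n f g) (markAt [1, 2] [0])

/-- The same for `l_{-n}(f, g)`, where `f` is attached at the address `10` and `g` at `0`. -/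
def linkNegDiagram (n : ℕ) (f g : F3) : Diagram :=
  linkDiagram (linkNeg n f g) (markAt [1, 0] [0])

/-! ### Components and linking numbers -/

/-- A point of a diagram together with a direction: the strand number `strand` at the height just
above the slice number `level`, travelled downwards or upwards. -/
structure DirectedPoint : Type where
  level : ℕ
  strand : ℕ
  down : Bool

/-- Travel along the strand to the next height. -/
def next (w : Diagram) : DirectedPoint → DirectedPoint
  | ⟨t, i, true⟩ =>
      match w[t]? with
      | none => ⟨t, i, true⟩
      | some (cap j) => if i < j then ⟨t + 1, i, true⟩ else ⟨t + 1, i + 2, true⟩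
      | some (cup j) =>
          if i < j then ⟨t + 1, i, true⟩
          else if i = j then ⟨t, j + 1, false⟩
          else if i = j + 1 then ⟨t, j, false⟩
          else ⟨t + 1, i - 2, true⟩
      | some (cross _ j) =>
          if i = j then ⟨t + 1, j + 1, true⟩
          else if i = j + 1 then ⟨t + 1, j, true⟩
          else ⟨t + 1, i, true⟩
      | some (mark _ _ _) => ⟨t + 1, i, true⟩
  | ⟨0, i, false⟩ => ⟨0, i, false⟩
  | ⟨t + 1, i, false⟩ =>
      match w[t]? with
      | none => ⟨t + 1, i, false⟩
      | some (cap j) =>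
          if i < j then ⟨t, i, false⟩
          else if i = j then ⟨t + 1, j + 1, true⟩
          else if i = j + 1 then ⟨t + 1, j, true⟩
          else ⟨t, i - 2, false⟩
      | some (cup j) => if i < j then ⟨t, i, false⟩ else ⟨t, i + 2, false⟩
      | some (cross _ j) =>
          if i = j then ⟨t, j + 1, false⟩
          else if i = j + 1 then ⟨t, j, false⟩
          else ⟨t, i, false⟩
      | some (mark _ _ _) => ⟨t, i, false⟩

/-- The component of `w` marked by `c` passes through the point `p` in the given direction. -/
def OnComponent (w : Diagram) (c : Label) (p : DirectedPoint) : Prop :=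
  ∃ (t i : ℕ) (d : Bool), w[t]? = some (mark c d i) ∧ ∃ k : ℕ, (next w)^[k] ⟨t, i, d⟩ = p

/-- The components of `w` marked by `c` and `c'` both exist and are different. -/
def DistinctComponents (w : Diagram) (c c' : Label) : Prop :=
  (∃ p, OnComponent w c p) ∧ (∃ p, OnComponent w c' p) ∧
    ∀ t i d d', OnComponent w c ⟨t, i, d⟩ → ¬ OnComponent w c' ⟨t, i, d'⟩

open scoped Classical in
/-- `1` if the component marked by `c` passes downwards through the strand `i` at height `t`, `-1` if
it passes upwards, `0` if it does not pass. -/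
noncomputable def direction (w : Diagram) (c : Label) (t i : ℕ) : ℤ :=
  (if OnComponent w c ⟨t, i, true⟩ then 1 else 0) -
    (if OnComponent w c ⟨t, i, false⟩ then 1 else 0)

/-- The sum of the signs of those crossings in the slice number `t` at which the components marked by
`c` and `c'` meet. If both strands are directed downwards, a crossing is positive exactly if the
strand from the upper right to the lower left lies over; reversing one of them changes the sign. -/
noncomputable def crossingSign (w : Diagram) (c c' : Label) (t : ℕ) : ℤ :=
  match w[t]? with
  | some (cross b i) =>
      (if b then 1 else -1) *
        (direction w c t i * direction w c' t (i + 1) +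
          direction w c' t i * direction w c t (i + 1))
  | _ => 0

/-- The linking number of the components marked by `c` and `c'`: half the sum of the signs of the
crossings between them. -/
noncomputable def linkingNumber (w : Diagram) (c c' : Label) : ℚ :=
  ((∑ t ∈ Finset.range w.length, crossingSign w c c' t : ℤ) : ℚ) / 2

/-! ### The twisted diagrams -/

/-- The standard twisted diagram: the central component of `𝓛(f)` runs down the strand `1`; the
central component of `𝓛(g)` is a loop through the strands `2` and `3`; the strands `1` and `2` are
twisted around each other by `n` full twists, that is by `2 * n` crossings, all alike. The diagram of
`f` sits on the strand `1`, and the diagram of `g` on the strand `j`, which is `2` or `3`. -/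
def twistedDiagram (j n : ℕ) (f g : F3) : Diagram :=
  [cap 0] ++ openDiagram f (markRoot Label.Kf) 1 ++ [cap 2] ++
    openDiagram g (markRoot Label.Kg) j ++ List.replicate (2 * n) (cross true 1) ++ [cup 2, cup 0]

end ThompsonLink

/-!
The diagrams of `f` and `g` are tangles with one upper and one lower endpoint, so they slide along
their strands and past the crossings of other strands, and only the part of the diagram that comes
from `H^{± n}` matters. Passing from `H^{± n}` to `H^{± (n + 1)}` surrounds this part by two carets
in either tree, and straightening these carets leaves one more full twist: by induction on `n` the
part becomes `n` full twists of two strands, and a last sequence of moves brings the closing arcs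
into standard position.

Linking numbers are compared through flows. A flow assigns to every strand at every height an
integer, its strength counted downwards, which is passed on along the strands. The directions of a
component are the unique flow that has strength `1` at the marks of the component and is disjoint
from every flow vanishing there. For two disjoint flows the sum, over all crossings, of the signed
products of their strengths is unchanged by every move: a move is local, and a flow on one side of
it corresponds to exactly one flow on the other. Hence this form can be evaluated on the twisted
diagram, where every crossing of the twists contributes the same sign and the inserted diagrams
contribute nothing.
-/

open ThompsonLink

namespace ThompsonLink

section
open TernaryTree Slice

/-! ### Tangle diagrams -/

theorem isTangle_nil_iff {k m : ℕ} : IsTangle [] k m ↔ k = m :=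
  ⟨fun h => by cases h; rfl, fun h => h ▸ .nil k⟩

theorem isTangle_cons_iff {s : Slice} {w : Diagram} {k m : ℕ} :
    IsTangle (s :: w) k m ↔
      s.pos + s.inputs ≤ k ∧ IsTangle w (k - s.inputs + s.outputs) m := by
  constructor
  · rintro ⟨⟩
    rename_i r hs hw
    exact ⟨by omega, by simpa using hw⟩
  · rintro ⟨h, hw⟩
    have := IsTangle.cons s w (k - s.inputs) m (by omega) hw
    rwa [Nat.sub_add_cancel (by omega)] at this

theorem IsTangle.cast {w : Diagram} {k m k' m' : ℕ} (h : IsTangle w k m) (hk : k = k')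
    (hm : m = m') : IsTangle w k' m' := hk ▸ hm ▸ h

theorem IsTangle.append {a b : Diagram} {k l m : ℕ} (ha : IsTangle a k l) (hb : IsTangle b l m) :
    IsTangle (a ++ b) k m := by
  induction ha with
  | nil => exact hb
  | cons s w r m hs _ ih => exact .cons s _ r _ hs (ih hb)

theorem IsTangle.widen {w : Diagram} {k m : ℕ} (h : IsTangle w k m) (c : ℕ) :
    IsTangle w (k + c) (m + c) := by
  induction h with
  | nil k => exact .nil _
  | cons s w r m hs _ ih =>
      have := IsTangle.cons s w (r + c) (m + c) (by omega) (by convert ih using 1; omega)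
      convert this using 1; omega

/-- A slice moved to the right by `c` strands. -/
def Slice.shift (c : ℕ) (s : Slice) : Slice := s.at' (s.pos + c)

/-- A diagram moved to the right by `c` strands. -/
def shift (c : ℕ) (w : Diagram) : Diagram := w.map (Slice.shift c)

@[simp] theorem Slice.inputs_at' (s : Slice) (i : ℕ) : (s.at' i).inputs = s.inputs := by
  cases s <;> rfl
@[simp] theorem Slice.outputs_at' (s : Slice) (i : ℕ) : (s.at' i).outputs = s.outputs := by
  cases s <;> rfl
@[simp] theorem Slice.pos_at' (s : Slice) (i : ℕ) : (s.at' i).pos = i := by cases s <;> rfl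
@[simp] theorem Slice.at'_at' (s : Slice) (i j : ℕ) : (s.at' i).at' j = s.at' j := by
  cases s <;> rfl
@[simp] theorem Slice.at'_pos (s : Slice) : s.at' s.pos = s := by cases s <;> rfl
@[simp] theorem Slice.inputs_shift (s : Slice) (i : ℕ) : (s.shift i).inputs = s.inputs := by
  simp [Slice.shift]
@[simp] theorem Slice.outputs_shift (s : Slice) (i : ℕ) : (s.shift i).outputs = s.outputs := by
  simp [Slice.shift]
@[simp] theorem Slice.pos_shift (s : Slice) (i : ℕ) : (s.shift i).pos = s.pos + i := by
  simp [Slice.shift]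
@[simp] theorem Slice.shift_at' (s : Slice) (c i : ℕ) : (s.at' i).shift c = s.at' (i + c) := by
  simp [Slice.shift]
@[simp] theorem Slice.shift_cap (c i : ℕ) : (cap i).shift c = cap (i + c) := rfl
@[simp] theorem Slice.shift_cup (c i : ℕ) : (cup i).shift c = cup (i + c) := rfl
@[simp] theorem Slice.shift_cross (c : ℕ) (b : Bool) (i : ℕ) :
    (cross b i).shift c = cross b (i + c) := rfl
@[simp] theorem Slice.shift_mark (c : ℕ) (l : Label) (d : Bool) (i : ℕ) :
    (mark l d i).shift c = mark l d (i + c) := rfl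

@[simp] theorem shift_nil (c : ℕ) : shift c [] = [] := rfl
@[simp] theorem shift_cons (c : ℕ) (s : Slice) (w : Diagram) :
    shift c (s :: w) = s.shift c :: shift c w := rfl
@[simp] theorem shift_append (c : ℕ) (w w' : Diagram) :
    shift c (w ++ w') = shift c w ++ shift c w' := List.map_append

theorem shift_shift (c d : ℕ) (w : Diagram) : shift c (shift d w) = shift (d + c) w := by
  simp [shift, Slice.shift, Nat.add_assoc]

theorem shift_zero (w : Diagram) : shift 0 w = w := by
  have : Slice.shift 0 = id := by funext s; simp [Slice.shift]
  simp [shift, this]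

theorem IsTangle.shift {w : Diagram} {k m : ℕ} (h : IsTangle w k m) (c : ℕ) :
    IsTangle (shift c w) (k + c) (m + c) := by
  induction h with
  | nil k => exact .nil _
  | cons s w r m hs _ ih =>
      have := IsTangle.cons (s.shift c) (ThompsonLink.shift c w) (r + c) (m + c) (by simpa using hs)
        (by convert ih using 1; simp; omega)
      rw [Slice.inputs_shift] at this
      exact this.cast (by omega) rfl

/-! ### Isotopy of tangles -/

/-- Isotopy of tangle diagrams with `k` upper and `m` lower endpoints. -/
def TangleIsotopic (k m : ℕ) (w w' : Diagram) : Prop :=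
  IsTangle w k m ∧ IsTangle w' k m ∧ Relation.EqvGen (Step k m) w w'

notation:50 w:51 "≈[" k "," m "]" w':51 => TangleIsotopic k m w w'

theorem Move.shift {a b : Diagram} (h : Move a b) (c : ℕ) : Move (shift c a) (shift c b) := by
  cases h with
  | exchange a b i d =>
      convert Move.exchange a b (i + c) d using 1
      · simp only [shift_cons, Slice.shift_at', shift_nil, List.cons.injEq, and_true]
        congr 1; omega
      · simp only [shift_cons, Slice.shift_at', shift_nil, List.cons.injEq, and_true, true_and]
        congr 1; omega
  | zigzag_left i => simpa [Nat.add_right_comm] using Move.zigzag_left (i + c)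
  | zigzag_right i => simpa [Nat.add_right_comm] using Move.zigzag_right (i + c)
  | cap_slide b i => simpa [Nat.add_right_comm] using Move.cap_slide b (i + c)
  | cup_slide b i => simpa [Nat.add_right_comm] using Move.cup_slide b (i + c)
  | reidemeister_one_cap b i => exact Move.reidemeister_one_cap b (i + c)
  | reidemeister_one_cup b i => exact Move.reidemeister_one_cup b (i + c)
  | reidemeister_two b i => exact Move.reidemeister_two b (i + c)
  | reidemeister_three b i =>
      simpa [Nat.add_right_comm] using Move.reidemeister_three b (i + c)
  | mark_cross_left l d b i =>
      simpa [Nat.add_right_comm] using Move.mark_cross_left l d b (i + c)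
  | mark_cross_right l d b i =>
      simpa [Nat.add_right_comm] using Move.mark_cross_right l d b (i + c)
  | mark_cap l d i => simpa [Nat.add_right_comm] using Move.mark_cap l d (i + c)
  | mark_cup l d i => simpa [Nat.add_right_comm] using Move.mark_cup l d (i + c)

namespace TangleIsotopic

theorem refl {k m : ℕ} {w : Diagram} (h : IsTangle w k m) : w ≈[k, m] w :=
  ⟨h, h, .refl _⟩

theorem symm {k m : ℕ} {w w' : Diagram} (h : w ≈[k, m] w') : w' ≈[k, m] w :=
  ⟨h.2.1, h.1, h.2.2.symm⟩

theorem trans {k m : ℕ} {w w' w'' : Diagram} (h : w ≈[k, m] w') (h' : w' ≈[k, m] w'') :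
    w ≈[k, m] w'' :=
  ⟨h.1, h'.2.1, h.2.2.trans _ _ _ h'.2.2⟩

instance (k m : ℕ) : Trans (TangleIsotopic k m) (TangleIsotopic k m) (TangleIsotopic k m) :=
  ⟨trans⟩

theorem cast {k m k' m' : ℕ} {w w' : Diagram} (h : w ≈[k, m] w') (hk : k = k') (hm : m = m') :
    w ≈[k', m'] w' := hk ▸ hm ▸ h

theorem map {k m k' m' : ℕ} {a b : Diagram} (h : a ≈[k, m] b) (φ : Diagram → Diagram)
    (hφ : ∀ w w', Step k m w w' → Step k' m' (φ w) (φ w'))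
    (ht : ∀ w, IsTangle w k m → IsTangle (φ w) k' m') : φ a ≈[k', m'] φ b := by
  obtain ⟨ha, hb, steps⟩ := h
  refine ⟨ht a ha, ht b hb, ?_⟩
  clear ha hb
  induction steps with
  | rel x y h => exact .rel _ _ (hφ _ _ h)
  | refl x => exact .refl _
  | symm x y _ ih => exact ih.symm
  | trans x y z _ _ ih₁ ih₂ => exact ih₁.trans _ _ _ ih₂

theorem append_left {k l m : ℕ} {a b p : Diagram} (hp : IsTangle p k l) (h : a ≈[l, m] b) :
    p ++ a ≈[k, m] p ++ b := by
  refine h.map (p ++ ·) ?_ fun w hw => hp.append hw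
  rintro w w' ⟨hw, hw', q, a, b, s, rfl, rfl, hm⟩
  exact ⟨hp.append hw, hp.append hw', p ++ q, a, b, s, by simp, by simp, hm⟩

theorem append_right {k l m : ℕ} {a b s : Diagram} (h : a ≈[k, l] b) (hs : IsTangle s l m) :
    a ++ s ≈[k, m] b ++ s := by
  refine h.map (· ++ s) ?_ fun w hw => hw.append hs
  rintro w w' ⟨hw, hw', q, a, b, s', rfl, rfl, hm⟩
  exact ⟨hw.append hs, hw'.append hs, q, a, b, s' ++ s, by simp, by simp, hm⟩

theorem append {k l m : ℕ} {a b c d : Diagram} (h : a ≈[k, l] b) (h' : c ≈[l, m] d) :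
    a ++ c ≈[k, m] b ++ d :=
  (h.append_right h'.1).trans (h'.append_left h.2.1)

theorem widen {k m : ℕ} {a b : Diagram} (h : a ≈[k, m] b) (c : ℕ) : a ≈[k + c, m + c] b := by
  refine h.map id ?_ fun w hw => hw.widen c
  rintro w w' ⟨hw, hw', h⟩
  exact ⟨hw.widen c, hw'.widen c, h⟩

theorem shift {k m : ℕ} {a b : Diagram} (h : a ≈[k, m] b) (c : ℕ) :
    shift c a ≈[k + c, m + c] shift c b := by
  refine h.map (ThompsonLink.shift c) ?_ fun w hw => hw.shift c
  rintro w w' ⟨hw, hw', p, a, b, s, rfl, rfl, hm⟩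
  exact ⟨hw.shift c, hw'.shift c, ThompsonLink.shift c p, _, _, ThompsonLink.shift c s, by simp,
    by simp, hm.shift c⟩

end TangleIsotopic

theorem IsTangle.place {w : Diagram} {a b i k : ℕ} (h : IsTangle w a b) (hk : i + a ≤ k) :
    IsTangle (ThompsonLink.shift i w) k (k - a + b) :=
  ((h.shift i).widen (k - a - i)).cast (by omega) (by omega)

theorem TangleIsotopic.place {w w' : Diagram} {a b i k : ℕ} (h : w ≈[a, b] w') (hk : i + a ≤ k) :
    ThompsonLink.shift i w ≈[k, k - a + b] ThompsonLink.shift i w' :=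
  ((h.shift i).widen (k - a - i)).cast (by omega) (by omega)

/-- The number of lower endpoints of a diagram with `k` upper endpoints, or `none` if some slice
involves strands that are not there. -/
def width : Diagram → ℕ → Option ℕ
  | [], k => some k
  | s :: w, k => if s.pos + s.inputs ≤ k then width w (k - s.inputs + s.outputs) else none

theorem isTangle_iff_width {w : Diagram} {k m : ℕ} : IsTangle w k m ↔ width w k = some m := by
  induction w generalizing k with
  | nil => simp [width, isTangle_nil_iff]
  | cons s w ih => rw [isTangle_cons_iff, ih, width]; split_ifs <;> simp [*]

theorem IsTangle.of_width {w : Diagram} {k m : ℕ} (h : width w k = some m) : IsTangle w k m :=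
  isTangle_iff_width.2 h

theorem isTangle_singleton {s : Slice} {k : ℕ} (h : s.pos + s.inputs ≤ k) :
    IsTangle [s] k (k - s.inputs + s.outputs) :=
  isTangle_cons_iff.2 ⟨h, .nil _⟩

theorem TangleIsotopic.of_move {k m : ℕ} {a b : Diagram} (h : Move a b)
    (ha : width a k = some m := by rfl) (hb : width b k = some m := by rfl) : a ≈[k, m] b :=
  have ta := IsTangle.of_width ha
  have tb := IsTangle.of_width hb
  ⟨ta, tb, .rel _ _ ⟨ta, tb, [], a, b, [], by simp, by simp, h⟩⟩

theorem TangleIsotopic.of_move_within {k m : ℕ} {a b : Diagram} (p s : Diagram) (h : Move a b)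
    (ha : width (p ++ a ++ s) k = some m := by rfl)
    (hb : width (p ++ b ++ s) k = some m := by rfl) : p ++ a ++ s ≈[k, m] p ++ b ++ s :=
  have ta := IsTangle.of_width ha
  have tb := IsTangle.of_width hb
  ⟨ta, tb, .rel _ _ ⟨ta, tb, p, a, b, s, rfl, rfl, h⟩⟩

/-! ### Tangles side by side -/

namespace TangleIsotopic

theorem swap_slices {s s' : Slice} {k m : ℕ} (h : s.pos + s.inputs ≤ k)
    (h' : s'.pos + s'.inputs ≤ m) :
    [s, s'.shift (k - s.inputs + s.outputs)]
      ≈[k + m, k - s.inputs + s.outputs + (m - s'.inputs + s'.outputs)] [s'.shift k, s] := by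
  have exchange := Move.exchange s s' s.pos (k - s.inputs - s.pos + s'.pos)
  rw [Slice.at'_pos, show s.pos + s.inputs + (k - s.inputs - s.pos + s'.pos) = s'.pos + k by omega,
    show s.pos + s.outputs + (k - s.inputs - s.pos + s'.pos) =
      s'.pos + (k - s.inputs + s.outputs) by omega] at exchange
  refine (of_move exchange ?_ ?_).symm <;> rw [← isTangle_iff_width] <;>
    simp only [isTangle_cons_iff, isTangle_nil_iff, Slice.inputs_at', Slice.outputs_at',
      Slice.pos_at'] <;> omega

theorem swap_slice {s : Slice} {k m m' : ℕ} {w : Diagram} (h : s.pos + s.inputs ≤ k)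
    (hw : IsTangle w m m') :
    [s] ++ ThompsonLink.shift (k - s.inputs + s.outputs) w
      ≈[k + m, k - s.inputs + s.outputs + m'] ThompsonLink.shift k w ++ [s] := by
  induction w generalizing m with
  | nil =>
      obtain rfl := isTangle_nil_iff.1 hw
      exact refl ((isTangle_singleton h).widen m)
  | cons s' w ih =>
      obtain ⟨hs', hw⟩ := isTangle_cons_iff.1 hw
      have head : IsTangle [s'.shift k] (k + m) (k + (m - s'.inputs + s'.outputs)) :=
        ((isTangle_singleton hs').shift k).cast (by omega) (by omega)
      have tail := (hw.shift (k - s.inputs + s.outputs)).cast (Nat.add_comm _ _) (Nat.add_comm _ _)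
      exact ((swap_slices h hs').append_right tail).trans ((ih hw).append_left head)

theorem interchange {k k' m m' : ℕ} {a b : Diagram} (ha : IsTangle a k k')
    (hb : IsTangle b m m') :
    a ++ ThompsonLink.shift k' b ≈[k + m, k' + m'] ThompsonLink.shift k b ++ a := by
  induction a generalizing k with
  | nil =>
      obtain rfl := isTangle_nil_iff.1 ha
      simpa using refl ((hb.shift k).cast (Nat.add_comm _ _) (Nat.add_comm _ _))
  | cons s a ih =>
      obtain ⟨hs, ha⟩ := isTangle_cons_iff.1 ha
      calc s :: a ++ ThompsonLink.shift k' b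
          ≈[k + m, k' + m'] [s] ++ ThompsonLink.shift (k - s.inputs + s.outputs) b ++ a := by
            rw [List.append_assoc]
            exact (ih ha).append_left ((isTangle_singleton hs).widen m)
        _ ≈[k + m, k' + m'] ThompsonLink.shift k b ++ [s] ++ a :=
            (swap_slice hs hb).append_right (ha.widen m')
        _ = ThompsonLink.shift k b ++ s :: a := by simp

end TangleIsotopic

/-! ### A strand passing over or under a tangle -/

/-- The strand number `m` moves to the far left, crossing the strands `m - 1, ..., 0`: over them if
`b = true`, under them if `b = false`. -/
def passLeft (b : Bool) : ℕ → Diagram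
  | 0 => []
  | m + 1 => cross b m :: passLeft b m

/-- The strand number `0` moves to the right of the strands `1, ..., m`: under them if `b = true`,
over them if `b = false`. -/
def passRight (b : Bool) : ℕ → Diagram
  | 0 => []
  | m + 1 => passRight b m ++ [cross b m]

theorem isTangle_passLeft (b : Bool) (m : ℕ) : IsTangle (passLeft b m) (m + 1) (m + 1) := by
  induction m with
  | zero => exact .nil _
  | succ m ih => exact .cons (cross b m) _ m _ le_rfl (ih.widen 1)

theorem isTangle_passRight (b : Bool) (m : ℕ) : IsTangle (passRight b m) (m + 1) (m + 1) := by
  induction m with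
  | zero => exact .nil _
  | succ m ih => exact (ih.widen 1).append (.cons (cross b m) _ m _ le_rfl (.nil _))

theorem passLeft_add (b : Bool) (c q : ℕ) :
    passLeft b (c + q) = shift c (passLeft b q) ++ passLeft b c := by
  induction q with
  | zero => rfl
  | succ q ih => simp [passLeft, ih, Nat.add_comm]

namespace TangleIsotopic

theorem cross_cancel (b : Bool) {i k : ℕ} (h : i + 2 ≤ k) : [cross b i, cross (!b) i] ≈[k, k] [] :=
  of_move (.reidemeister_two b i)
    (by rw [← isTangle_iff_width]
        simp only [isTangle_cons_iff, isTangle_nil_iff, Slice.pos, Slice.inputs, Slice.outputs]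
        omega)

theorem passLeft_passRight (b : Bool) (m : ℕ) :
    passLeft b m ++ passRight (!b) m ≈[m + 1, m + 1] [] := by
  induction m with
  | zero => exact refl (.nil _)
  | succ m ih =>
      have hc : ∀ b, IsTangle [cross b m] (m + 2) (m + 2) := fun b => isTangle_singleton le_rfl
      calc passLeft b (m + 1) ++ passRight (!b) (m + 1)
          = [cross b m] ++ (passLeft b m ++ passRight (!b) m) ++ [cross (!b) m] := by
            simp [passLeft, passRight]
        _ ≈[m + 2, m + 2] [cross b m] ++ [] ++ [cross (!b) m] :=
            ((ih.widen 1).append_left (hc b)).append_right (hc _)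
        _ ≈[m + 2, m + 2] [] := cross_cancel b le_rfl

theorem passRight_passLeft (b : Bool) (m : ℕ) :
    passRight b m ++ passLeft (!b) m ≈[m + 1, m + 1] [] := by
  induction m with
  | zero => exact refl (.nil _)
  | succ m ih =>
      calc passRight b (m + 1) ++ passLeft (!b) (m + 1)
          = passRight b m ++ [cross b m, cross (!b) m] ++ passLeft (!b) m := by
            simp [passLeft, passRight]
        _ ≈[m + 2, m + 2] passRight b m ++ [] ++ passLeft (!b) m :=
            ((cross_cancel b le_rfl).append_left ((isTangle_passRight b m).widen 1)).append_right
              ((isTangle_passLeft _ m).widen 1)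
        _ ≈[m + 2, m + 2] [] := by simpa using ih.widen 1

theorem sweep_cap (b : Bool) : [cap 0, cross b 1, cross b 0] ≈[1, 3] [cap 1] :=
  calc [cap 0, cross b 1, cross b 0]
      ≈[1, 3] [cap 1, cross (!b) 0, cross b 0] := of_move_within [] [_] (.cap_slide b 0)
    _ ≈[1, 3] [cap 1] := by
      simpa using of_move_within (k := 1) (m := 3) [cap 1] [] (.reidemeister_two (!b) 0)

theorem sweep_cup (b : Bool) : [cup 0] ≈[3, 1] [cross b 1, cross b 0, cup 1] :=
  calc [cup 0]
      ≈[3, 1] [cross b 1, cross (!b) 1, cup 0] :=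
        (of_move_within [] [cup 0] (.reidemeister_two b 1)).symm
    _ ≈[3, 1] [cross b 1, cross b 0, cup 1] := by
      simpa using of_move_within (k := 3) (m := 1) [cross b 1] [] (.cup_slide (!b) 0)

theorem sweep_cross (b c : Bool) :
    [cross c 0, cross b 1, cross b 0] ≈[3, 3] [cross b 1, cross b 0, cross c 1] := by
  obtain rfl | rfl : c = b ∨ c = !b := by cases b <;> cases c <;> simp
  · exact of_move (.reidemeister_three c 0)
  · calc [cross (!b) 0, cross b 1, cross b 0]
        ≈[3, 3] [cross (!b) 0, cross b 1, cross b 0, cross b 1, cross (!b) 1] :=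
          (of_move_within [_, _, _] [] (.reidemeister_two b 1)).symm
      _ ≈[3, 3] [cross (!b) 0, cross b 0, cross b 1, cross b 0, cross (!b) 1] :=
          (of_move_within [_] [_] (.reidemeister_three b 0)).symm
      _ ≈[3, 3] [cross b 1, cross b 0, cross (!b) 1] := by
          simpa using of_move_within (k := 3) (m := 3) [] [cross b 1, cross b 0, cross (!b) 1]
            (.reidemeister_two (!b) 0)

theorem sweep_slice (b : Bool) (s : Slice) :
    [s.at' 0] ++ passLeft b s.outputs ≈[s.inputs + 1, s.outputs + 1]
      passLeft b s.inputs ++ [s.at' 1] := by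
  cases s with
  | cap i => exact sweep_cap b
  | cup i => exact sweep_cup b
  | cross c i => exact sweep_cross b c
  | mark l d i => exact of_move (.mark_cross_left l d b 0)

theorem sweep_slice_rightmost (b : Bool) (s : Slice) :
    [s] ++ passLeft b (s.pos + s.outputs) ≈[s.pos + s.inputs + 1, s.pos + s.outputs + 1]
      passLeft b (s.pos + s.inputs) ++ [s.shift 1] := by
  have left_strands : IsTangle (passLeft b s.pos) (s.pos + s.outputs + 1) (s.pos + s.outputs + 1) :=
    ((isTangle_passLeft b s.pos).widen s.outputs).cast (by omega) (by omega)
  have slice_strands : IsTangle (ThompsonLink.shift s.pos (passLeft b s.inputs))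
      (s.pos + s.inputs + 1) (s.pos + s.inputs + 1) :=
    ((isTangle_passLeft b s.inputs).shift s.pos).cast (by omega) (by omega)
  have pass_slice : [s] ++ ThompsonLink.shift s.pos (passLeft b s.outputs)
      ≈[s.pos + s.inputs + 1, s.pos + s.outputs + 1]
        ThompsonLink.shift s.pos (passLeft b s.inputs) ++ [s.at' (s.pos + 1)] := by
    simpa [Nat.add_comm 1] using
      ((sweep_slice b s).shift s.pos).cast (k' := s.pos + s.inputs + 1)
        (m' := s.pos + s.outputs + 1) (by omega) (by omega)
  have pass_left_strands : [s.at' (s.pos + 1)] ++ passLeft b s.pos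
      ≈[s.pos + s.inputs + 1, s.pos + s.outputs + 1] passLeft b s.pos ++ [s.shift 1] := by
    have swap := interchange (isTangle_passLeft b s.pos) (b := [s.at' 0])
      ((isTangle_singleton (k := s.inputs) (by simp)).cast (m' := s.outputs) rfl (by simp))
    simpa [Slice.shift] using swap.symm.cast (k' := s.pos + s.inputs + 1)
      (m' := s.pos + s.outputs + 1) (by omega) (by omega)
  rw [passLeft_add b s.pos, passLeft_add b s.pos]
  simpa using (pass_slice.append_right left_strands).trans
    (by simpa using pass_left_strands.append_left slice_strands)

theorem sweep_slice_at (b : Bool) (s : Slice) (q : ℕ) :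
    [s] ++ passLeft b (s.pos + s.outputs + q)
      ≈[s.pos + s.inputs + q + 1, s.pos + s.outputs + q + 1]
        passLeft b (s.pos + s.inputs + q) ++ [s.shift 1] := by
  have slice : IsTangle [s] (s.pos + s.inputs) (s.pos + s.outputs) :=
    (isTangle_singleton le_rfl).cast rfl (by omega)
  have right_strands : IsTangle (ThompsonLink.shift (s.pos + s.inputs) (passLeft b q))
      (s.pos + s.inputs + q + 1) (s.pos + s.inputs + 1 + q) :=
    ((isTangle_passLeft b q).shift (s.pos + s.inputs)).cast (by omega) (by omega)
  have left_strands : IsTangle (passLeft b (s.pos + s.outputs))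
      (s.pos + s.outputs + (q + 1)) (s.pos + s.outputs + q + 1) :=
    ((isTangle_passLeft b _).widen q).cast (by omega) (by omega)
  have pass_right_strands := (interchange slice (isTangle_passLeft b q)).append_right left_strands
  have pass_slice := (((sweep_slice_rightmost b s).widen q).cast
    (m' := s.pos + s.outputs + q + 1) rfl (by omega)).append_left right_strands
  rw [passLeft_add b (s.pos + s.outputs), passLeft_add b (s.pos + s.inputs)]
  simp only [List.append_assoc] at pass_right_strands pass_slice ⊢
  exact pass_right_strands.trans pass_slice

theorem sweep_left (b : Bool) {w : Diagram} {k m : ℕ} (h : IsTangle w k m) :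
    w ++ passLeft b m ≈[k + 1, m + 1] passLeft b k ++ ThompsonLink.shift 1 w := by
  induction h with
  | nil k => simpa using refl (isTangle_passLeft b k)
  | cons s w r m hs hw ih =>
      obtain ⟨q, rfl⟩ := Nat.exists_eq_add_of_le hs
      have sweep_first := (sweep_slice_at b s q).cast (k' := s.pos + q + s.inputs + 1)
        (m' := s.pos + q + s.outputs + 1) (by omega) (by omega)
      rw [Nat.add_right_comm s.pos s.outputs, Nat.add_right_comm s.pos s.inputs] at sweep_first
      calc s :: w ++ passLeft b m
          = [s] ++ (w ++ passLeft b m) := rfl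
        _ ≈[s.pos + q + s.inputs + 1, m + 1]
            [s] ++ (passLeft b (s.pos + q + s.outputs) ++ ThompsonLink.shift 1 w) :=
            ih.append_left ((isTangle_singleton (by omega)).cast rfl (by omega))
        _ = [s] ++ passLeft b (s.pos + q + s.outputs) ++ ThompsonLink.shift 1 w := by simp
        _ ≈[s.pos + q + s.inputs + 1, m + 1]
            passLeft b (s.pos + q + s.inputs) ++ [s.shift 1] ++ ThompsonLink.shift 1 w :=
            sweep_first.append_right (hw.shift 1)
        _ = passLeft b (s.pos + q + s.inputs) ++ ThompsonLink.shift 1 (s :: w) := by simp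

theorem sweep_right (b : Bool) {w : Diagram} {k m : ℕ} (h : IsTangle w k m) :
    passRight b k ++ w ≈[k + 1, m + 1] ThompsonLink.shift 1 w ++ passRight b m := by
  have hk := isTangle_passRight b k
  have hm := isTangle_passRight b m
  have insert_pair := (passLeft_passRight (!b) m).symm.append_left (hk.append (h.widen 1))
  have sweep := ((sweep_left (!b) h).append_left hk).append_right hm
  have remove_pair := (passRight_passLeft b k).append_right ((h.shift 1).append hm)
  simp only [List.append_assoc, Bool.not_not, List.append_nil, List.nil_append]
    at insert_pair sweep remove_pair
  exact insert_pair.trans (sweep.trans remove_pair)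

end TangleIsotopic

end

/-! ### Twists -/

section
open Slice

/-- The two-strand braid with `m` equal crossings. -/
def twist (m : ℕ) : Diagram := List.replicate m (cross true 0)

theorem twist_succ' (m : ℕ) : twist (m + 1) = twist m ++ [cross true 0] :=
  List.replicate_succ'

theorem shift_twist (i m : ℕ) : shift i (twist m) = List.replicate m (cross true i) := by
  simp [twist, shift]

theorem isTangle_twist (m : ℕ) : IsTangle (twist m) 2 2 := by
  induction m with
  | zero => exact .nil 2
  | succ m ih => exact .cons (cross true 0) _ 0 2 le_rfl ih

namespace TangleIsotopic

theorem cross_comm (b c : Bool) : [cross b 0, cross c 0] ≈[2, 2] [cross c 0, cross b 0] := by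
  obtain rfl | rfl : c = b ∨ c = !b := by cases b <;> cases c <;> simp
  · exact refl (.of_width rfl)
  · exact (cross_cancel b le_rfl).trans (by simpa using (cross_cancel (!b) le_rfl).symm)

theorem twist_cross_comm (b : Bool) (m : ℕ) :
    twist m ++ [cross b 0] ≈[2, 2] [cross b 0] ++ twist m := by
  induction m with
  | zero => exact refl (.of_width rfl)
  | succ m ih =>
      have isTangle_cross : IsTangle [cross true 0] 2 2 := .of_width rfl
      calc twist (m + 1) ++ [cross b 0]
          ≈[2, 2] [cross true 0] ++ ([cross b 0] ++ twist m) := ih.append_left isTangle_cross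
        _ ≈[2, 2] [cross b 0] ++ twist (m + 1) :=
            (cross_comm true b).append_right (isTangle_twist m)

theorem nested_caps_cross (b : Bool) : [cap 0, cap 1, cross b 2] ≈[0, 4]
    [cap 0, cap 1, cross b 0] :=
  calc [cap 0, cap 1, cross b 2]
      ≈[0, 4] [cap 0, cap 2, cross (!b) 1] := of_move_within [_] [] (.cap_slide b 1)
    _ ≈[0, 4] [cap 0, cap 0, cross (!b) 1] :=
        (of_move_within [] [_] (.exchange (cap 0) (cap 0) 0 0)).symm
    _ ≈[0, 4] [cap 0, cap 1, cross b 0] := by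
        simpa using of_move_within (k := 0) (m := 4) [cap 0] [] (.cap_slide (!b) 0)

theorem nested_cups_cross (b : Bool) : [cross b 0, cup 1, cup 0] ≈[4, 0]
    [cross b 2, cup 1, cup 0] :=
  calc [cross b 0, cup 1, cup 0]
      ≈[4, 0] [cross (!b) 1, cup 0, cup 0] := by
        simpa using (of_move_within (k := 4) (m := 0) [] [cup 0] (.cup_slide (!b) 0)).symm
    _ ≈[4, 0] [cross (!b) 1, cup 2, cup 0] :=
        (of_move_within [_] [] (.exchange (cup 0) (cup 0) 0 0)).symm
    _ ≈[4, 0] [cross b 2, cup 1, cup 0] := (of_move_within [] [_] (.cup_slide b 1)).symm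

theorem nested_caps_twist (m : ℕ) :
    [cap 0, cap 1] ++ ThompsonLink.shift 2 (twist m) ≈[0, 4] [cap 0, cap 1] ++ twist m := by
  induction m with
  | zero => exact refl (.of_width rfl)
  | succ m ih =>
      calc [cap 0, cap 1] ++ ThompsonLink.shift 2 (twist (m + 1))
          ≈[0, 4] [cap 0, cap 1] ++ (twist 1 ++ ThompsonLink.shift 2 (twist m)) :=
            (nested_caps_cross true).append_right ((isTangle_twist m).shift 2)
        _ ≈[0, 4] [cap 0, cap 1] ++ (ThompsonLink.shift 2 (twist m) ++ twist 1) :=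
            (interchange (isTangle_twist 1) (isTangle_twist m)).append_left (.of_width rfl)
        _ = [cap 0, cap 1] ++ ThompsonLink.shift 2 (twist m) ++ twist 1 := by simp
        _ ≈[0, 4] [cap 0, cap 1] ++ twist m ++ twist 1 :=
            ih.append_right ((isTangle_twist 1).widen 2)
        _ = [cap 0, cap 1] ++ twist (m + 1) := by rw [twist_succ' m, List.append_assoc]; rfl

theorem nested_cups_twist (m : ℕ) :
    twist m ++ [cup 1, cup 0] ≈[4, 0] ThompsonLink.shift 2 (twist m) ++ [cup 1, cup 0] := by
  induction m with
  | zero => exact refl (.of_width rfl)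
  | succ m ih =>
      calc twist (m + 1) ++ [cup 1, cup 0]
          = twist m ++ [cross true 0, cup 1, cup 0] := by rw [twist_succ', List.append_assoc]; rfl
        _ ≈[4, 0] twist m ++ [cross true 2, cup 1, cup 0] :=
            (nested_cups_cross true).append_left ((isTangle_twist m).widen 2)
        _ = twist m ++ ThompsonLink.shift 2 (twist 1) ++ [cup 1, cup 0] := by simp [twist]
        _ ≈[4, 0] ThompsonLink.shift 2 (twist 1) ++ twist m ++ [cup 1, cup 0] :=
            (interchange (isTangle_twist m) (isTangle_twist 1)).append_right (.of_width rfl)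
        _ = ThompsonLink.shift 2 (twist 1) ++ (twist m ++ [cup 1, cup 0]) := by simp
        _ ≈[4, 0] ThompsonLink.shift 2 (twist 1) ++
              (ThompsonLink.shift 2 (twist m) ++ [cup 1, cup 0]) :=
            ih.append_left ((isTangle_twist 1).shift 2)
        _ = ThompsonLink.shift 2 (twist (m + 1)) ++ [cup 1, cup 0] := by
            rw [← List.append_assoc, ← shift_append]; rfl

theorem tangle_twist_comm {w : Diagram} (h : IsTangle w 1 1) (n : ℕ) :
    w ++ twist (2 * n) ≈[2, 2] twist (2 * n) ++ w := by
  induction n with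
  | zero => simpa [twist] using refl (h.widen 1)
  | succ n ih =>
      have isTangle_cross : IsTangle [cross true 0] 2 2 := .of_width rfl
      have to_right : [cross true 0] ++ ThompsonLink.shift 1 w ≈[2, 2] w ++ [cross true 0] :=
        (sweep_left true h).symm
      have to_left : [cross true 0] ++ w ≈[2, 2] ThompsonLink.shift 1 w ++ [cross true 0] :=
        sweep_right true h
      calc w ++ ([cross true 0] ++ [cross true 0] ++ twist (2 * n))
          = w ++ [cross true 0] ++ [cross true 0] ++ twist (2 * n) := by simp
        _ ≈[2, 2] [cross true 0] ++ ThompsonLink.shift 1 w ++ [cross true 0] ++ twist (2 * n) :=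
            (to_right.symm.append_right isTangle_cross).append_right (isTangle_twist _)
        _ = [cross true 0] ++ (ThompsonLink.shift 1 w ++ [cross true 0]) ++ twist (2 * n) := by simp
        _ ≈[2, 2] [cross true 0] ++ ([cross true 0] ++ w) ++ twist (2 * n) :=
            (to_left.symm.append_left isTangle_cross).append_right (isTangle_twist _)
        _ = [cross true 0] ++ [cross true 0] ++ (w ++ twist (2 * n)) := by simp
        _ ≈[2, 2] [cross true 0] ++ [cross true 0] ++ (twist (2 * n) ++ w) :=
            ih.append_left (isTangle_cross.append isTangle_cross)
        _ = [cross true 0] ++ [cross true 0] ++ twist (2 * n) ++ w := by simp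

end TangleIsotopic

end

/-! ### Words with twist regions and inserted tangles -/

/-- The elementary pieces of a diagram in which `n` full twists of two strands (`coil`) and two
unspecified tangles with one upper and one lower endpoint (`box false` and `box true`) are treated
as single pieces. The number is the position of the leftmost strand involved, as in `Slice`. -/
inductive Letter : Type
  | cap (i : ℕ) : Letter
  | cup (i : ℕ) : Letter
  | cross (b : Bool) (i : ℕ) : Letter
  | coil (i : ℕ) : Letter
  | box (g : Bool) (i : ℕ) : Letter
  deriving DecidableEq

namespace Letter

/-- The number of strands that enter a letter from above. -/
def inputs : Letter → ℕ
  | cap _ => 0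
  | cup _ => 2
  | cross _ _ => 2
  | coil _ => 2
  | box _ _ => 1

/-- The number of strands that leave a letter below. -/
def outputs : Letter → ℕ
  | cap _ => 2
  | cup _ => 0
  | cross _ _ => 2
  | coil _ => 2
  | box _ _ => 1

/-- The number of strands to the left of a letter. -/
def pos : Letter → ℕ
  | cap i => i
  | cup i => i
  | cross _ i => i
  | coil i => i
  | box _ i => i

/-- A letter moved to the position `i`. -/
def at' : Letter → ℕ → Letter
  | cap _, i => cap i
  | cup _, i => cup i
  | cross b _, i => cross b i
  | coil _, i => coil i
  | box g _, i => box g i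

/-- The diagram of a letter at the position `0`, where `B` gives the inserted tangles. -/
def core (n : ℕ) (B : Bool → Diagram) : Letter → Diagram
  | cap _ => [.cap 0]
  | cup _ => [.cup 0]
  | cross b _ => [.cross b 0]
  | coil _ => twist (2 * n)
  | box g _ => B g

theorem inputs_at' (x : Letter) (i : ℕ) : (x.at' i).inputs = x.inputs := by cases x <;> rfl
theorem outputs_at' (x : Letter) (i : ℕ) : (x.at' i).outputs = x.outputs := by cases x <;> rfl
theorem pos_at' (x : Letter) (i : ℕ) : (x.at' i).pos = i := by cases x <;> rfl

theorem core_at' (n : ℕ) (B : Bool → Diagram) (x : Letter) (i : ℕ) :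
    (x.at' i).core n B = x.core n B := by
  cases x <;> rfl

theorem isTangle_core (n : ℕ) {B : Bool → Diagram} (hB : ∀ g, IsTangle (B g) 1 1) (x : Letter) :
    IsTangle (x.core n B) x.inputs x.outputs := by
  cases x with
  | cap i => exact .of_width rfl
  | cup i => exact .of_width rfl
  | cross b i => exact .of_width rfl
  | coil i => exact isTangle_twist _
  | box g i => exact hB g

end Letter

/-- A diagram with twist regions and inserted tangles. -/
abbrev Word : Type := List Letter

namespace Word

/-- The diagram of a word, for `n` full twists in each twist region and the inserted tangles `B`. -/
def diagram (n : ℕ) (B : Bool → Diagram) (w : Word) : Diagram :=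
  w.flatMap fun x => ThompsonLink.shift x.pos (x.core n B)

/-- The number of lower endpoints of a word with `k` upper endpoints, or `none` if some letter
involves strands that are not there. -/
def width : Word → ℕ → Option ℕ
  | [], k => some k
  | x :: w, k => if x.pos + x.inputs ≤ k then width w (k - x.inputs + x.outputs) else none

/-- A word moved to the right by `c` strands. -/
def shift (c : ℕ) (w : Word) : Word := w.map fun x => x.at' (x.pos + c)

/-- Isotopy of words: for all numbers of twists and all inserted tangles, the diagrams of the two
words are isotopic tangles with `k` upper and `m` lower endpoints. -/
def Isotopic (k m : ℕ) (w w' : Word) : Prop :=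
  ∀ (n : ℕ) (B : Bool → Diagram), (∀ g, IsTangle (B g) 1 1) →
    w.diagram n B ≈[k, m] w'.diagram n B

notation:50 w:51 "∼[" k "," m "]" w':51 => Isotopic k m w w'

theorem diagram_cons (n : ℕ) (B : Bool → Diagram) (x : Letter) (w : Word) :
    diagram n B (x :: w) = ThompsonLink.shift x.pos (x.core n B) ++ diagram n B w := rfl

theorem diagram_append (n : ℕ) (B : Bool → Diagram) (w w' : Word) :
    diagram n B (w ++ w') = diagram n B w ++ diagram n B w' := List.flatMap_append

theorem diagram_shift (n : ℕ) (B : Bool → Diagram) (c : ℕ) (w : Word) :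
    diagram n B (w.shift c) = ThompsonLink.shift c (diagram n B w) := by
  induction w with
  | nil => rfl
  | cons x w ih =>
      rw [diagram_cons, shift_append, ← ih, shift_shift, ← x.pos_at' (x.pos + c),
        ← x.core_at' n B (x.pos + c)]
      rfl

theorem width_append {w w' : Word} {k m : ℕ} :
    width (w ++ w') k = some m ↔ ∃ l, width w k = some l ∧ width w' l = some m := by
  induction w generalizing k with
  | nil => simp [width]
  | cons x w ih =>
      rw [List.cons_append, width, width]
      split_ifs
      · exact ih
      · simp

theorem isTangle_diagram (n : ℕ) {B : Bool → Diagram} (hB : ∀ g, IsTangle (B g) 1 1) {w : Word}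
    {k m : ℕ} (h : width w k = some m) : IsTangle (w.diagram n B) k m := by
  induction w generalizing k with
  | nil => rw [width, Option.some.injEq] at h; subst h; exact .nil k
  | cons x w ih =>
      rw [width] at h
      split_ifs at h with hx
      exact ((x.isTangle_core n hB).place hx).append (ih h)

/-- `ThompsonLink.passLeft` as a word. -/
def passLeft (b : Bool) : ℕ → Word
  | 0 => []
  | m + 1 => .cross b m :: passLeft b m

/-- `ThompsonLink.passRight` as a word. -/
def passRight (b : Bool) : ℕ → Word
  | 0 => []
  | m + 1 => passRight b m ++ [.cross b m]

theorem diagram_passLeft (n : ℕ) (B : Bool → Diagram) (b : Bool) (m : ℕ) :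
    diagram n B (passLeft b m) = ThompsonLink.passLeft b m := by
  induction m with
  | zero => rfl
  | succ m ih => rw [passLeft, diagram_cons, ih, ThompsonLink.passLeft]
                 simp [Letter.core, Letter.pos]

theorem diagram_passRight (n : ℕ) (B : Bool → Diagram) (b : Bool) (m : ℕ) :
    diagram n B (passRight b m) = ThompsonLink.passRight b m := by
  induction m with
  | zero => rfl
  | succ m ih =>
      rw [passRight, diagram_append, ih]
      simp [ThompsonLink.passRight, diagram, Letter.core, Letter.pos]

namespace Isotopic

theorem refl {w : Word} {k m : ℕ} (h : width w k = some m) : w ∼[k, m] w :=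
  fun n _ hB => .refl (isTangle_diagram n hB h)

theorem symm {w w' : Word} {k m : ℕ} (h : w ∼[k, m] w') : w' ∼[k, m] w :=
  fun n B hB => (h n B hB).symm

theorem trans {w w' w'' : Word} {k m : ℕ} (h : w ∼[k, m] w') (h' : w' ∼[k, m] w'') :
    w ∼[k, m] w'' :=
  fun n B hB => (h n B hB).trans (h' n B hB)

instance (k m : ℕ) : Trans (Isotopic k m) (Isotopic k m) (Isotopic k m) := ⟨trans⟩

theorem append_left {k l m : ℕ} {p w w' : Word} (hp : width p k = some l) (h : w ∼[l, m] w') :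
    p ++ w ∼[k, m] p ++ w' := fun n B hB => by
  simpa only [diagram_append] using (h n B hB).append_left (isTangle_diagram n hB hp)

theorem append_right {k l m : ℕ} {w w' s : Word} (h : w ∼[k, l] w') (hs : width s l = some m) :
    w ++ s ∼[k, m] w' ++ s := fun n B hB => by
  simpa only [diagram_append] using (h n B hB).append_right (isTangle_diagram n hB hs)

theorem place {w w' : Word} {c d i k : ℕ} (h : w ∼[c, d] w') (hk : i + c ≤ k) :
    w.shift i ∼[k, k - c + d] w'.shift i := fun n B hB => by
  simpa only [diagram_shift] using (h n B hB).place hk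

theorem swap {x y : Letter} {k m : ℕ} (hxy : y.pos + y.inputs ≤ x.pos)
    (h : width [x, y] k = some m) :
    [x, y] ∼[k, m] [y, x.at' (x.pos - y.inputs + y.outputs)] := fun n B hB => by
  simp only [width] at h
  split_ifs at h with hx hy
  obtain rfl := Option.some.inj h
  have y_left := ((y.isTangle_core n hB).shift y.pos).widen (x.pos - y.inputs - y.pos)
  have interchanged := ((TangleIsotopic.interchange (y_left.cast (k' := x.pos)
    (m' := x.pos - y.inputs + y.outputs) (by omega) (by omega)) (x.isTangle_core n hB)).symm.widen
    (k - x.inputs - x.pos)).cast (k' := k) (m' := k - x.inputs + x.outputs - y.inputs + y.outputs)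
    (by omega) (by omega)
  simpa [diagram, Letter.pos_at', Letter.core_at'] using interchanged

end Isotopic

/-- Moves a letter below all following letters that lie entirely to its left. -/
def sink (x : Letter) : Word → Word
  | [] => [x]
  | y :: w =>
    if y.pos + y.inputs ≤ x.pos then y :: sink (x.at' (x.pos - y.inputs + y.outputs)) w
    else x :: y :: w

/-- The word obtained by sinking all letters in turn, from the lowest one to the highest. -/
def normalize (w : Word) : Word := w.foldr sink []

theorem width_swap {x y : Letter} {w : Word} {k m : ℕ} (hxy : y.pos + y.inputs ≤ x.pos)
    (h : width (x :: y :: w) k = some m) :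
    width (y :: x.at' (x.pos - y.inputs + y.outputs) :: w) k = some m := by
  simp only [width, Letter.pos_at', Letter.inputs_at', Letter.outputs_at'] at h ⊢
  split_ifs at h with hx hy
  rw [if_pos (by omega), if_pos (by omega), ← h]
  congr 1
  omega

theorem width_sink {x : Letter} {w : Word} {k m : ℕ} (h : width (x :: w) k = some m) :
    width (sink x w) k = some m := by
  induction w generalizing x k with
  | nil => exact h
  | cons y w ih =>
      rw [sink]
      split_ifs with hxy
      · obtain ⟨l, hy, hw⟩ := (width_append (w := [y])).mp (width_swap hxy h)
        exact width_append.mpr ⟨l, hy, ih hw⟩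
      · exact h

theorem isotopic_sink {x : Letter} {w : Word} {k m : ℕ} (h : width (x :: w) k = some m) :
    x :: w ∼[k, m] sink x w := by
  induction w generalizing x k with
  | nil => exact .refl h
  | cons y w ih =>
      rw [sink]
      split_ifs with hxy
      · obtain ⟨_, hxy', hw⟩ := (width_append (w := [x, y])).mp h
        obtain ⟨_, hy, hw'⟩ := (width_append (w := [y])).mp (width_swap hxy h)
        exact ((Isotopic.swap hxy hxy').append_right hw).trans ((ih hw').append_left hy)
      · exact .refl h

theorem width_normalize {w : Word} {k m : ℕ} (h : width w k = some m) :
    width (normalize w) k = some m := by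
  induction w generalizing k with
  | nil => exact h
  | cons x w ih =>
      obtain ⟨l, hx, hw⟩ := (width_append (w := [x])).mp h
      exact width_sink ((width_append (w := [x])).mpr ⟨l, hx, ih hw⟩)

theorem isotopic_normalize {w : Word} {k m : ℕ} (h : width w k = some m) :
    w ∼[k, m] normalize w := by
  induction w generalizing k with
  | nil => exact .refl h
  | cons x w ih =>
      obtain ⟨l, hx, hw⟩ := (width_append (w := [x])).mp h
      exact ((ih hw).append_left (p := [x]) hx).trans
        (isotopic_sink ((width_append (w := [x])).mpr ⟨l, hx, width_normalize hw⟩))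

namespace Isotopic

open Letter

theorem exchange {w w' : Word} {k m : ℕ}
    (check : width w k = some m ∧ width w' k = some m ∧ normalize w = normalize w' := by decide) :
    w ∼[k, m] w' :=
  calc w ∼[k, m] normalize w := isotopic_normalize check.1
    _ = normalize w' := check.2.2
    _ ∼[k, m] w' := (isotopic_normalize check.2.1).symm

/-- The pattern `a` occurs in `w` from the index `p` on, moved to the right by `i` strands. That
replacing it by `b` leads to `w'` up to exchanges of distant letters is decided by comparing normal
forms. -/
theorem rewrite {w w' a b : Word} {k m c d : ℕ} (h : a ∼[c, d] b) (p i : ℕ)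
    (check : w.take p ++ (a.shift i ++ w.drop (p + a.length)) = w ∧
      (∃ l ∈ width (w.take p) k,
        i + c ≤ l ∧ width (w.drop (p + a.length)) (l - c + d) = some m) ∧
      width (w.take p ++ (b.shift i ++ w.drop (p + a.length))) k = some m ∧
      width w' k = some m ∧
      normalize (w.take p ++ (b.shift i ++ w.drop (p + a.length))) = normalize w' := by decide) :
    w ∼[k, m] w' := by
  obtain ⟨hw, ⟨l, width_take, hi, width_drop⟩, exchangeable⟩ := check
  calc w = w.take p ++ (a.shift i ++ w.drop (p + a.length)) := hw.symm
    _ ∼[k, m] w.take p ++ (b.shift i ++ w.drop (p + a.length)) :=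
        ((h.place hi).append_right width_drop).append_left width_take
    _ ∼[k, m] w' := exchange exchangeable

/-! ### Moves of words -/

theorem zigzag_left : [cap 1, cup 0] ∼[1, 1] [] := fun _ _ _ => .of_move (.zigzag_left 0)

theorem zigzag_right : [cap 0, cup 1] ∼[1, 1] [] := fun _ _ _ => .of_move (.zigzag_right 0)

theorem cap_slide (b : Bool) : [cap 0, cross b 1] ∼[1, 3] [cap 1, cross (!b) 0] :=
  fun _ _ _ => .of_move (.cap_slide b 0)

theorem cup_slide (b : Bool) : [cross b 1, cup 0] ∼[3, 1] [cross (!b) 0, cup 1] :=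
  fun _ _ _ => .of_move (.cup_slide b 0)

theorem kink_cap (b : Bool) : [cap 0, cross b 0] ∼[0, 2] [cap 0] :=
  fun _ _ _ => .of_move (.reidemeister_one_cap b 0)

theorem kink_cup (b : Bool) : [cross b 0, cup 0] ∼[2, 0] [cup 0] :=
  fun _ _ _ => .of_move (.reidemeister_one_cup b 0)

theorem cancel (b : Bool) : [cross b 0, cross (!b) 0] ∼[2, 2] [] :=
  fun _ _ _ => .of_move (.reidemeister_two b 0)

theorem nested_cups_cross (b : Bool) : [cross b 0, cup 1, cup 0] ∼[4, 0]
    [cross b 2, cup 1, cup 0] :=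
  fun _ _ _ => .nested_cups_cross b

theorem coil_cross (b : Bool) : [cross b 0, coil 0] ∼[2, 2] [coil 0, cross b 0] := fun n _ _ => by
  simpa [diagram, core, pos, shift_zero] using (TangleIsotopic.twist_cross_comm b (2 * n)).symm

theorem nested_caps_coil : [cap 0, cap 1, coil 2] ∼[0, 4] [cap 0, cap 1, coil 0] := fun n _ _ => by
  simpa [diagram, core, pos, shift_zero] using TangleIsotopic.nested_caps_twist (2 * n)

theorem nested_cups_coil : [coil 0, cup 1, cup 0] ∼[4, 0] [coil 2, cup 1, cup 0] := fun n _ _ => by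
  simpa [diagram, core, pos, shift_zero] using TangleIsotopic.nested_cups_twist (2 * n)

theorem box_coil (g : Bool) : [box g 0, coil 0] ∼[2, 2] [coil 0, box g 0] := fun n B hB => by
  simpa [diagram, core, pos, shift_zero] using TangleIsotopic.tangle_twist_comm (hB g) n

theorem sweep_left (b : Bool) (w : Word) (k m : ℕ) (h : width w k = some m := by rfl) :
    w ++ passLeft b m ∼[k + 1, m + 1] passLeft b k ++ w.shift 1 := fun n B hB => by
  simpa [diagram_append, diagram_shift, diagram_passLeft] using
    TangleIsotopic.sweep_left b (isTangle_diagram n hB h)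

theorem sweep_right (b : Bool) (w : Word) (k m : ℕ) (h : width w k = some m := by rfl) :
    passRight b k ++ w ∼[k + 1, m + 1] w.shift 1 ++ passRight b m := fun n B hB => by
  simpa [diagram_append, diagram_shift, diagram_passRight] using
    TangleIsotopic.sweep_right b (isTangle_diagram n hB h)

end Isotopic
end Word

/-! ### Untwisting the linking moves -/

namespace Word
namespace Isotopic

open Letter

local notation "σ₊" => cross true
local notation "σ₋" => cross false

theorem extract_coil :
    [cap 3, σ₊ 2, cap 3, σ₊ 2, σ₋ 4, coil 5, σ₊ 4, cup 5, σ₋ 1, cup 2, σ₋ 0, cup 1] ∼[3, 1]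
      [cap 3, coil 2, σ₊ 2, σ₋ 1, cup 2, σ₋ 0, cup 1] :=
  calc [cap 3, σ₊ 2, cap 3, σ₊ 2, σ₋ 4, coil 5, σ₊ 4, cup 5, σ₋ 1, cup 2, σ₋ 0, cup 1]
    _ ∼[3, 1] [cap 3, σ₊ 2, cap 3, σ₊ 2, σ₋ 1, σ₋ 0, cup 2, σ₋ 2, coil 3, σ₊ 2, cup 1, cup 1] :=
        exchange
    _ ∼[3, 1] [cap 2, cap 3, σ₊ 2, σ₋ 1, σ₋ 0, cup 2, σ₋ 3, σ₋ 2, coil 3, σ₊ 2, cup 1,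
      cup 1] := (cap_slide false).symm.rewrite 0 2
    _ ∼[3, 1] [cap 2, cap 3, σ₊ 2, σ₋ 1, σ₋ 0, cup 2, coil 2, σ₋ 3, σ₋ 2, σ₊ 2, cup 1,
      cup 1] := (sweep_left false [coil 0] 2 2).symm.rewrite 6 2
    _ ∼[3, 1] [cap 2, cap 3, σ₊ 2, σ₋ 1, σ₋ 0, cup 2, coil 2, cup 1, σ₋ 1, cup 1] :=
        (cancel false).rewrite 8 2
    _ ∼[3, 1] [cap 2, cap 3, coil 4, σ₊ 2, σ₋ 1, σ₋ 0, cup 2, cup 1, cup 1] :=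
        (kink_cup false).rewrite 8 1
    _ ∼[3, 1] [cap 2, cup 3, cap 3, coil 2, σ₊ 2, σ₋ 1, σ₋ 0, cup 2, cup 1] :=
        nested_caps_coil.rewrite 0 2
    _ ∼[3, 1] [cap 3, coil 2, σ₊ 2, σ₋ 1, cup 2, σ₋ 0, cup 1] := zigzag_right.rewrite 0 2

theorem full_twist_pos :
    [cap 3, coil 2, σ₊ 2, σ₋ 1, cup 2, σ₋ 0, cup 1] ∼[3, 1]
      [σ₋ 0, coil 1, σ₊ 1, σ₊ 1, σ₊ 0, cup 1] :=
  calc [cap 3, coil 2, σ₊ 2, σ₋ 1, cup 2, σ₋ 0, cup 1]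
    _ ∼[3, 1] [cap 3, coil 2, σ₊ 2, σ₊ 2, cup 1, σ₋ 0, cup 1] := (cup_slide true).symm.rewrite 3 1
    _ ∼[3, 1] [cap 3, σ₊ 2, coil 2, σ₊ 2, cup 1, σ₋ 0, cup 1] := (coil_cross true).symm.rewrite 1 2
    _ ∼[3, 1] [cap 3, σ₊ 2, coil 2, σ₊ 2, cup 1, σ₋ 0, σ₋ 1, cup 1] :=
        (kink_cup false).symm.rewrite 6 1
    _ ∼[3, 1] [σ₋ 0, σ₋ 1, cap 2, cup 3, σ₊ 1, coil 1, σ₊ 1, cup 0] :=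
        (sweep_right false [cap 2, σ₊ 1, coil 1, σ₊ 1, cup 0] 2 2).symm.rewrite 0 0
    _ ∼[3, 1] [σ₋ 0, σ₋ 1, σ₊ 1, coil 1, σ₊ 1, cup 0] := zigzag_right.rewrite 2 2
    _ ∼[3, 1] [σ₋ 0, coil 1, σ₊ 1, cup 0] := (cancel false).rewrite 1 1
    _ ∼[3, 1] [σ₋ 0, coil 1, σ₊ 1, σ₊ 1, σ₊ 0, cup 1] := (sweep_left true [cup 0] 2 0).rewrite 3 0

theorem straighten_pos :
    [cap 0, cap 2, σ₊ 1, cap 3, σ₊ 2, box true 1, σ₋ 1, coil 2, σ₊ 1, cup 2, box false 2, σ₋ 1,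
      cup 2, cup 0] ∼[0, 0]
      [cap 0, box false 1, cap 2, box true 2, coil 1, cup 2, cup 0] :=
  calc [cap 0, cap 2, σ₊ 1, cap 3, σ₊ 2, box true 1, σ₋ 1, coil 2, σ₊ 1, cup 2, box false 2, σ₋ 1,
      cup 2, cup 0]
    _ ∼[0, 0] [cap 0, cap 2, σ₊ 1, box true 1, cap 3, box false 4, σ₊ 2, σ₋ 1, coil 2, σ₊ 1, cup 2,
      σ₋ 1, cup 0, cup 0] :=
        exchange
    _ ∼[0, 0] [cap 0, cap 2, cap 4, σ₋ 3, σ₊ 1, σ₊ 2, box true 1, σ₋ 1, coil 2, σ₊ 1,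
      cup 2, box false 3, σ₋ 2, σ₋ 1, cup 0, cup 0] :=
        (sweep_right false [cap 0, box false 1] 0 2).rewrite 4 3
    _ ∼[0, 0] [cap 0, cap 2, box true 2, cap 4, σ₋ 3, σ₋ 2, σ₊ 1, σ₊ 2, coil 2, σ₊ 1,
      cup 2, box false 3, σ₋ 2, σ₋ 1, cup 2, cup 0] :=
        (sweep_right true [box true 0, σ₋ 0] 2 2).rewrite 4 1
    _ ∼[0, 0] [cap 0, box true 0, cap 2, σ₋ 1, σ₋ 0, cap 0, σ₊ 1, σ₊ 2, coil 2, σ₊ 1,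
      cup 2, cup 1, box false 1, cup 0] := (sweep_left false [cup 0] 2 0).symm.rewrite 12 1
    _ ∼[0, 0] [cap 0, cap 0, box true 0, σ₋ 1, σ₋ 0, cap 1, σ₋ 0, σ₊ 2, coil 2, σ₊ 1,
      cup 2, cup 1, box false 1, cup 0] := (cap_slide true).rewrite 5 0
    _ ∼[0, 0] [cap 0, cap 1, σ₋ 0, cap 3, box true 3, σ₊ 2, coil 2, σ₊ 1, cup 2, cup 1,
      box false 1, cup 0] := (sweep_left false [cap 0, box true 0] 0 2).rewrite 1 0
    _ ∼[0, 0] [cap 0, cap 1, σ₋ 0, cap 3, box true 3, coil 2, σ₊ 2, σ₊ 1, cup 2, cup 1,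
      box false 1, cup 0] := (coil_cross true).rewrite 5 2
    _ ∼[0, 0] [cap 0, cap 1, σ₋ 1, σ₋ 0, cap 3, box true 3, coil 2, σ₊ 2, σ₊ 1, cup 2,
      cup 1, box false 1, cup 0] := (kink_cap false).symm.rewrite 1 1
    _ ∼[0, 0] [cap 0, box false 1, cap 1, cup 2, cap 2, box true 2, coil 1, σ₊ 1, σ₊ 0,
      cup 1, cup 0] :=
        (sweep_left false [cap 2, box true 2, coil 1, σ₊ 1, σ₊ 0, cup 1, cup 0] 2 0)
          |>.symm.rewrite 2 0
    _ ∼[0, 0] [cap 0, box false 1, cap 2, box true 2, coil 1, σ₊ 1, σ₊ 0, cup 1, cup 0] :=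
        zigzag_right.rewrite 2 1
    _ ∼[0, 0] [cap 0, box false 1, cap 2, box true 2, coil 1, cup 2, cup 0] :=
        (sweep_left true [cup 0] 2 0).symm.rewrite 5 0

theorem full_twist_neg :
    [cap 1, σ₊ 0, cap 2, σ₊ 1, coil 1, σ₊ 1, cup 0, σ₋ 2, cup 3, σ₋ 0, cup 1] ∼[3, 1]
      [coil 1, σ₊ 1, σ₊ 1, σ₊ 1, cup 0] :=
  calc [cap 1, σ₊ 0, cap 2, σ₊ 1, coil 1, σ₊ 1, cup 0, σ₋ 2, cup 3, σ₋ 0, cup 1]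
    _ ∼[3, 1] [cap 1, σ₊ 0, cap 2, σ₊ 1, coil 1, σ₊ 1, cup 0, σ₋ 2, σ₋ 0, cup 1, cup 1] :=
        exchange
    _ ∼[3, 1] [cap 1, σ₋ 2, σ₊ 0, cap 2, σ₊ 1, coil 1, σ₊ 1, cup 0, σ₊ 1, cup 0, cup 1] :=
        (cup_slide true).symm.rewrite 8 0
    _ ∼[3, 1] [cap 2, σ₊ 1, σ₊ 0, cap 2, σ₊ 1, coil 1, σ₊ 1, σ₊ 3, cup 2, cup 0, cup 1] :=
        (cap_slide false).rewrite 0 1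
    _ ∼[3, 1] [cap 1, σ₊ 0, coil 0, σ₊ 0, σ₊ 2, cup 1, cap 2, cup 3, σ₊ 1, σ₊ 0, cup 0] :=
        (sweep_left true [cap 1, σ₊ 0, coil 0, σ₊ 0, σ₊ 2, cup 1] 2 2).symm.rewrite 1 0
    _ ∼[3, 1] [cap 1, σ₊ 0, coil 0, σ₊ 0, σ₊ 2, cup 1, σ₊ 1, σ₊ 0, cup 0] :=
        zigzag_right.rewrite 6 2
    _ ∼[3, 1] [cap 1, σ₊ 0, coil 0, σ₊ 0, σ₊ 2, cup 1, σ₊ 1, cup 0] := (kink_cup true).rewrite 7 0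
    _ ∼[3, 1] [cap 1, σ₊ 1, σ₊ 0, coil 0, σ₊ 2, σ₊ 3, σ₊ 0, cup 1, cup 0] :=
        (kink_cap true).symm.rewrite 0 1
    _ ∼[3, 1] [cap 1, σ₊ 1, σ₊ 0, σ₊ 2, σ₊ 3, σ₊ 2, coil 0, cup 1, cup 0] :=
        (nested_cups_cross true).rewrite 6 0
    _ ∼[3, 1] [cap 1, σ₊ 1, σ₊ 0, σ₊ 2, σ₊ 3, σ₊ 2, coil 2, cup 1, cup 0] :=
        nested_cups_coil.rewrite 6 0
    _ ∼[3, 1] [cap 1, σ₊ 1, σ₊ 2, σ₊ 3, coil 2, σ₊ 2, σ₊ 0, cup 1, cup 0] :=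
        (coil_cross true).rewrite 5 2
    _ ∼[3, 1] [cap 1, σ₊ 1, σ₊ 2, σ₊ 3, coil 2, σ₊ 2, σ₊ 2, cup 1, cup 0] :=
        (nested_cups_cross true).rewrite 6 0
    _ ∼[3, 1] [coil 1, σ₊ 1, σ₊ 1, cap 1, cup 2, σ₊ 1, cup 0] :=
        (sweep_right true [coil 1, σ₊ 1, σ₊ 1, cup 0] 3 1).rewrite 1 1
    _ ∼[3, 1] [coil 1, σ₊ 1, σ₊ 1, σ₊ 1, cup 0] := zigzag_right.rewrite 3 1

theorem merge_arcs_neg :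
    [cap 0, cap 2, σ₊ 1, cap 3, σ₊ 2, box true 1, box false 2, cap 5, coil 4, cup 3, σ₋ 3,
      cup 4, σ₋ 1, cup 2, cup 0] ∼[0, 0]
      [cap 0, cap 2, σ₊ 1, box true 1, σ₊ 0, cap 3, coil 2, box false 2, cup 1, σ₋ 1, σ₋ 1,
        cup 0, cup 0] :=
  calc [cap 0, cap 2, σ₊ 1, cap 3, σ₊ 2, box true 1, box false 2, cap 5, coil 4, cup 3, σ₋ 3,
      cup 4, σ₋ 1, cup 2, cup 0]
    _ ∼[0, 0] [cap 0, cap 2, σ₊ 1, box true 1, cap 3, σ₊ 2, box false 2, σ₋ 1, cup 0, cap 3, coil 2,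
      cup 1, σ₋ 1, cup 0, cup 0] :=
        exchange
    _ ∼[0, 0] [cap 0, cap 2, σ₊ 1, box true 1, cap 2, box false 2, σ₋ 1, cup 0, σ₋ 1,
      cap 3, coil 2, cup 1, σ₋ 1, cup 0, cup 0] := (cap_slide false).symm.rewrite 4 2
    _ ∼[0, 0] [cap 0, cap 2, σ₊ 1, box true 1, cap 2, box false 2, σ₋ 1, cup 0, σ₋ 1,
      cap 3, σ₋ 3, coil 2, cup 1, σ₋ 1, cup 0, cup 0] := (kink_cap false).symm.rewrite 9 3
    _ ∼[0, 0] [cap 0, cap 2, σ₊ 1, box true 1, cap 2, box false 2, σ₋ 1, cup 0, cap 2,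
      σ₋ 2, coil 1, σ₋ 3, σ₋ 2, σ₋ 1, cup 1, σ₋ 1, cup 0, cup 0] :=
        (sweep_left false [cap 1, σ₋ 1, coil 0] 1 3).symm.rewrite 8 1
    _ ∼[0, 0] [cap 0, cap 2, σ₊ 1, box true 1, cap 2, box false 2, σ₋ 1, cup 0, cap 2,
      σ₋ 2, coil 1, σ₋ 3, σ₋ 2, cup 1, σ₋ 1, cup 0, cup 0] := (kink_cup false).rewrite 13 1
    _ ∼[0, 0] [cap 0, cap 2, σ₊ 1, box true 1, cap 2, cap 2, σ₊ 3, box false 2, σ₋ 1,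
      cup 0, σ₋ 1, σ₋ 2, coil 1, σ₋ 3, σ₋ 2, cup 1, σ₋ 1, cup 0, cup 0] :=
        (cancel true).symm.rewrite 9 1
    _ ∼[0, 0] [cap 0, cap 2, σ₊ 1, box true 1, cap 2, cap 3, σ₋ 2, box false 2, σ₋ 1,
      cup 0, σ₋ 1, σ₋ 2, σ₋ 3, coil 1, σ₋ 2, cup 1, σ₋ 1, cup 0, cup 0] :=
        (cap_slide true).rewrite 5 2
    _ ∼[0, 0] [cap 0, cap 2, σ₊ 1, box true 1, cap 2, cap 3, σ₋ 2, box false 2, σ₋ 1,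
      cup 0, coil 2, σ₋ 3, cup 2, σ₋ 1, σ₋ 1, cup 0, cup 0] :=
        (sweep_right false [coil 0, σ₋ 1, cup 0] 3 1).rewrite 10 1
    _ ∼[0, 0] [cap 0, cap 2, σ₊ 1, box true 1, σ₊ 0, cap 2, cap 3, coil 4, σ₋ 2,
      box false 2, cup 1, σ₋ 3, cup 2, σ₋ 1, σ₋ 1, cup 0, cup 0] := (cup_slide false).rewrite 8 0
    _ ∼[0, 0] [cap 0, cap 2, σ₊ 1, box true 1, σ₊ 0, cap 2, σ₋ 3, cap 3, cup 4, coil 2,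
      σ₋ 2, box false 2, cup 1, σ₋ 1, σ₋ 1, cup 0, cup 0] := nested_caps_coil.rewrite 5 2
    _ ∼[0, 0] [cap 0, cap 2, σ₊ 1, box true 1, σ₊ 0, cap 2, σ₋ 3, coil 2, σ₋ 2,
      box false 2, cup 1, σ₋ 1, σ₋ 1, cup 0, cup 0] := zigzag_right.rewrite 7 3
    _ ∼[0, 0] [cap 0, cap 2, σ₊ 1, box true 1, σ₊ 0, cap 2, σ₋ 3, σ₋ 2, coil 2,
      box false 2, cup 1, σ₋ 1, σ₋ 1, cup 0, cup 0] := (coil_cross false).symm.rewrite 7 2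
    _ ∼[0, 0] [cap 0, cap 2, σ₊ 1, box true 1, σ₊ 0, cap 3, coil 2, box false 2, cup 1,
      σ₋ 1, σ₋ 1, cup 0, cup 0] := (sweep_left false [cap 0] 0 2).rewrite 5 2

theorem straighten_merged_neg :
    [cap 0, cap 2, σ₊ 1, box true 1, σ₊ 0, cap 3, coil 2, box false 2, cup 1, σ₋ 1, σ₋ 1,
      cup 0, cup 0] ∼[0, 0]
      [cap 0, box false 1, cap 2, box true 3, coil 1, cup 2, cup 0] :=
  calc [cap 0, cap 2, σ₊ 1, box true 1, σ₊ 0, cap 3, coil 2, box false 2, cup 1, σ₋ 1, σ₋ 1,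
      cup 0, cup 0]
    _ ∼[0, 0] [cap 0, cap 2, σ₊ 1, σ₊ 0, box true 0, cap 3, coil 2, box false 2, cup 1,
      σ₋ 1, σ₋ 1, cup 0, cup 0] := (sweep_right true [box true 0] 1 1).symm.rewrite 3 0
    _ ∼[0, 0] [cap 0, cap 2, σ₊ 2, σ₊ 1, σ₊ 0, cap 3, coil 2, box false 2, cup 1, σ₋ 1,
      σ₋ 1, cup 2, box true 0, cup 0] := (kink_cap true).symm.rewrite 1 2
    _ ∼[0, 0] [cap 0, cap 2, coil 1, box false 1, cup 0, σ₋ 0, σ₋ 0, cap 2, cup 1, σ₊ 0,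
      box true 0, cup 0] :=
        (sweep_left true [cap 2, coil 1, box false 1, cup 0, σ₋ 0, σ₋ 0, cup 1] 3 1)
          |>.symm.rewrite 2 0
    _ ∼[0, 0] [cap 0, cap 2, coil 1, box false 1, cup 0, σ₋ 0, σ₋ 0, σ₊ 0, box true 0,
      cup 0] := zigzag_left.rewrite 7 1
    _ ∼[0, 0] [cap 0, cap 2, coil 1, box false 1, cup 0, σ₋ 0, box true 0, cup 0] :=
        (cancel false).rewrite 6 0
    _ ∼[0, 0] [cap 0, box false 1, cap 2, coil 1, cup 0, σ₋ 0, box true 0, cup 0] :=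
        (box_coil false).symm.rewrite 2 1
    _ ∼[0, 0] [cap 0, box false 1, cap 2, coil 1, cup 0, box true 1, σ₋ 0, cup 0] :=
        (sweep_right false [box true 0] 1 1).rewrite 5 0
    _ ∼[0, 0] [cap 0, box false 1, cap 2, box true 3, coil 1, cup 2, cup 0] :=
        (kink_cup false).rewrite 6 0

theorem straighten_neg :
    [cap 0, cap 2, σ₊ 1, cap 3, σ₊ 2, box true 1, box false 2, cap 5, coil 4, cup 3, σ₋ 3,
      cup 4, σ₋ 1, cup 2, cup 0] ∼[0, 0]
      [cap 0, box false 1, cap 2, box true 3, coil 1, cup 2, cup 0] :=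
  merge_arcs_neg.trans straighten_merged_neg

end Isotopic
end Word

open TernaryTree Slice

/-! ### The diagrams of trees -/

theorem shift_upperDiagram (T : TernaryTree) (μ : Address → Option Label) (i c : ℕ) :
    shift c (upperDiagram T μ i) = upperDiagram T μ (i + c) := by
  induction T generalizing μ i with
  | leaf => cases h : μ [] <;> simp [upperDiagram, h]
  | node l m r hl hm hr =>
      cases h : μ [] <;> simp [upperDiagram, h, hl, hm, hr, Nat.add_right_comm]

theorem shift_lowerDiagram (T : TernaryTree) (i c : ℕ) :
    shift c (lowerDiagram T i) = lowerDiagram T (i + c) := by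
  induction T generalizing i with
  | leaf => rfl
  | node l m r hl hm hr => simp [lowerDiagram, hl, hm, hr, Nat.add_right_comm]

theorem shift_openDiagram (f : F3) (μ : Address → Option Label) (i c : ℕ) :
    shift c (openDiagram f μ i) = openDiagram f μ (i + c) := by
  simp [openDiagram, shift_upperDiagram, shift_lowerDiagram]

theorem isTangle_upperDiagram (T : TernaryTree) (μ : Address → Option Label) (i c : ℕ) :
    IsTangle (upperDiagram T μ i) (i + 1 + c) (i + T.numLeaves + c) := by
  have isTangle_marks : ∀ (μ : Address → Option Label) (i c : ℕ),
      IsTangle ((μ []).toList.map fun c => mark c true i) (i + 1 + c) (i + 1 + c) := by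
    intro μ i c
    cases μ [] with
    | none => exact .nil _
    | some c' =>
        simp only [Option.toList_some, List.map_cons, List.map_nil, isTangle_cons_iff,
          isTangle_nil_iff, Slice.pos, Slice.inputs, Slice.outputs]
        omega
  induction T generalizing μ i c with
  | leaf => exact isTangle_marks μ i c
  | node l m r ihl ihm ihr =>
      refine ((((isTangle_marks μ i c).append ?_).append (ihr _ (i + 2) c)).append
        ((ihm _ (i + 1) (r.numLeaves + c)).cast (by omega) rfl)).append
        ((ihl _ i (m.numLeaves + r.numLeaves + c)).cast (by omega) (by
          simp only [numLeaves]; omega))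
      simp only [isTangle_cons_iff, isTangle_nil_iff, Slice.pos, Slice.inputs, Slice.outputs]
      omega

theorem isTangle_lowerDiagram (T : TernaryTree) (i c : ℕ) :
    IsTangle (lowerDiagram T i) (i + T.numLeaves + c) (i + 1 + c) := by
  induction T generalizing i c with
  | leaf => exact .nil _
  | node l m r ihl ihm ihr =>
      refine ((((ihl i (m.numLeaves + r.numLeaves + c)).cast (by
        simp only [numLeaves]; omega) rfl).append
        ((ihm (i + 1) (r.numLeaves + c)).cast (by omega) rfl)).append
        ((ihr (i + 2) c).cast (by omega) rfl)).append ?_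
      simp only [isTangle_cons_iff, isTangle_nil_iff, Slice.pos, Slice.inputs, Slice.outputs]
      omega

theorem isTangle_openDiagram (f : F3) (μ : Address → Option Label) :
    IsTangle (openDiagram f μ 0) 1 1 :=
  (isTangle_upperDiagram f.upper μ 0 0).append
    ((isTangle_lowerDiagram f.lower 0 0).cast (by rw [f.numLeaves_eq]) rfl)

/-! ### The pairs of trees of the linking moves -/

theorem graft_zero_node (l m r S : TernaryTree) :
    (node l m r).graft 0 S = node (l.graft 0 S) m r := by
  simp [graft, numLeaves_pos]

theorem upper_linkPos (n : ℕ) (f g : F3) :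
    (linkPos n f g).upper = node g.upper (node leaf (posUp (n - 1)) f.upper) leaf := by
  simp [linkPos, F3.diamond, F3.diamondAt, hopfPos, leafIndex, F3.attach, graft, numLeaves,
    constLeaf, numLeaves_posUp]

theorem lower_linkPos (n : ℕ) (f g : F3) :
    (linkPos n f g).lower = node ((posLow (n - 1)).graft 0 g.lower) f.lower leaf := by
  have not_left : ¬1 + (1 + (4 * (n - 1) + 3)) < 4 * (n - 1) + 5 := by omega
  have is_middle : 1 + (1 + (4 * (n - 1) + 3)) < 4 * (n - 1) + 5 + 1 := by omega
  have offset : 1 + (1 + (4 * (n - 1) + 3)) - (4 * (n - 1) + 5) = 0 := by omega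
  simp [linkPos, F3.diamond, F3.diamondAt, hopfPos, leafIndex, F3.attach, graft, numLeaves,
    constLeaf, numLeaves_posUp, numLeaves_posLow, not_left, is_middle, offset]

theorem upper_linkNeg (n : ℕ) (f g : F3) :
    (linkNeg n f g).upper = node g.upper (node f.upper (negUp (n - 1)) caret) leaf := by
  simp [linkNeg, F3.diamond, F3.diamondAt, hopfNeg, leafIndex, F3.attach, graft, numLeaves,
    constLeaf]

theorem lower_linkNeg (n : ℕ) (f g : F3) :
    (linkNeg n f g).lower = node g.lower f.lower (node (negLow (n - 1)) leaf leaf) := by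
  simp [linkNeg, F3.diamond, F3.diamondAt, hopfNeg, leafIndex, F3.attach, graft, numLeaves,
    constLeaf]

theorem lowerDiagram_graft_posLow (k : ℕ) (S : TernaryTree) (i : ℕ) :
    lowerDiagram ((posLow k).graft 0 S) i = lowerDiagram S i ++ lowerDiagram (posLow k) i := by
  cases k <;> simp [posLow, graft, graft_zero_node, lowerDiagram]

theorem upperDiagram_posUp_succ (k i : ℕ) :
    upperDiagram (posUp (k + 1)) (fun _ => none) i =
      [cap (i + 1), cross true i] ++ upperDiagram (posUp k) (fun _ => none) (i + 2) ++
        [cap (i + 1), cross true i] := by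
  simp [posUp, caret, upperDiagram]

theorem lowerDiagram_posLow_succ (k i : ℕ) :
    lowerDiagram (posLow (k + 1)) i =
      [cross false (i + 1), cup (i + 2)] ++ lowerDiagram (posLow k) (i + 2) ++
        [cross false i, cup (i + 1)] := by
  simp [posLow, caret, lowerDiagram]

theorem upperDiagram_negUp_succ (k i : ℕ) :
    upperDiagram (negUp (k + 1)) (fun _ => none) i =
      [cap (i + 1), cross true i, cap (i + 2), cross true (i + 1)] ++
        upperDiagram (negUp k) (fun _ => none) i := by
  simp [negUp, caret, upperDiagram]

theorem lowerDiagram_negLow_succ (k i : ℕ) :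
    lowerDiagram (negLow (k + 1)) i =
      lowerDiagram (negLow k) i ++
        [cross false (i + 2), cup (i + 3), cross false i, cup (i + 1)] := by
  simp [negLow, caret, lowerDiagram]

/-! ### The twists in the linking moves -/

theorem twist_two_mul_succ (n : ℕ) :
    twist (2 * (n + 1)) = twist (2 * n) ++ [cross true 0, cross true 0] := by
  rw [show 2 * (n + 1) = 2 * n + 1 + 1 by ring, twist_succ', twist_succ', List.append_assoc]
  rfl

theorem isotopic_carets_between {T S : TernaryTree} (μ : Address → Option Label)
    (h : S.numLeaves = T.numLeaves + 2) :
    upperDiagram T μ 4 ++ [cap 3, cross true 2] ++ ([cross false 1, cup 2] ++ lowerDiagram S 2)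
      ≈[5, 3] [cap 3, cross true 2] ++ upperDiagram T μ 6 ++
        (lowerDiagram S 4 ++ [cross false 1, cup 2]) := by
  have upper := TangleIsotopic.interchange (a := [cap 3, cross true 2]) (k := 3) (k' := 5)
    (.of_width rfl) (isTangle_upperDiagram T μ 1 0)
  have lower := TangleIsotopic.interchange (a := [cross false 1, cup 2]) (k := 4) (k' := 2)
    (.of_width rfl) (isTangle_lowerDiagram S 0 0)
  simp only [shift_upperDiagram, shift_lowerDiagram] at upper lower
  exact upper.symm.append (lower.cast (by omega) rfl)

section
variable {B : Bool → Diagram} (hB : ∀ g, IsTangle (B g) 1 1)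
include hB

theorem isotopic_posUp_posLow (k : ℕ) :
    upperDiagram (posUp k) (fun _ => none) 2 ++ lowerDiagram (posLow k) 0 ≈[3, 1]
      Word.diagram (k + 1) B [.cross false 0, .coil 1, .cross true 0, .cup 1] := by
  have full_twist (k : ℕ) :
      Word.diagram k B [.cap 3, .coil 2, .cross true 2, .cross false 1, .cup 2, .cross false 0,
        .cup 1] ≈[3, 1]
      Word.diagram (k + 1) B [.cross false 0, .coil 1, .cross true 0, .cup 1] := by
    simpa [Word.diagram, Letter.core, Letter.pos, twist_two_mul_succ] using
      Word.Isotopic.full_twist_pos k B hB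
  induction k with
  | zero => exact full_twist 0
  | succ k ih =>
      rw [upperDiagram_posUp_succ, lowerDiagram_posLow_succ]
      have carets_between := isotopic_carets_between (T := posUp k) (S := posLow k) (fun _ => none)
        (by rw [numLeaves_posUp, numLeaves_posLow])
      have pair := ih.shift 4
      rw [shift_append, shift_upperDiagram, shift_lowerDiagram, ← Word.diagram_shift] at pair
      set U := upperDiagram (posUp k) fun _ => none
      set L := lowerDiagram (posLow k)
      calc [cap 3, cross true 2] ++ U 4 ++ [cap 3, cross true 2] ++
            ([cross false 1, cup 2] ++ L 2 ++ [cross false 0, cup 1])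
          = [cap 3, cross true 2] ++ (U 4 ++ [cap 3, cross true 2] ++
              ([cross false 1, cup 2] ++ L 2)) ++ [cross false 0, cup 1] := by simp
        _ ≈[3, 1] [cap 3, cross true 2] ++ ([cap 3, cross true 2] ++ U 6 ++
              (L 4 ++ [cross false 1, cup 2])) ++ [cross false 0, cup 1] :=
            (carets_between.append_left (.of_width rfl)).append_right (.of_width rfl)
        _ = [cap 3, cross true 2, cap 3, cross true 2] ++ (U 6 ++ L 4) ++
              [cross false 1, cup 2, cross false 0, cup 1] := by simp
        _ ≈[3, 1] [cap 3, cross true 2, cap 3, cross true 2] ++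
              Word.diagram (k + 1) B [.cross false 4, .coil 5, .cross true 4, .cup 5] ++
              [cross false 1, cup 2, cross false 0, cup 1] :=
            (pair.append_left (.of_width rfl)).append_right (.of_width rfl)
        _ ≈[3, 1] Word.diagram (k + 1) B [.cap 3, .coil 2, .cross true 2, .cross false 1, .cup 2,
              .cross false 0, .cup 1] := by
            simpa [Word.diagram, Letter.core, Letter.pos] using
              Word.Isotopic.extract_coil (k + 1) B hB
        _ ≈[3, 1] Word.diagram (k + 1 + 1) B [.cross false 0, .coil 1, .cross true 0, .cup 1] :=
            full_twist (k + 1)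

theorem isotopic_negUp_negLow (k : ℕ) :
    upperDiagram (negUp k) (fun _ => none) 0 ++ lowerDiagram (negLow k) 0 ≈[3, 1]
      Word.diagram k B [.coil 1, .cross true 1, .cup 0] := by
  induction k with
  | zero => exact (TangleIsotopic.of_move (.cup_slide true 0)).symm
  | succ k ih =>
      rw [upperDiagram_negUp_succ, lowerDiagram_negLow_succ]
      calc [cap 1, cross true 0, cap 2, cross true 1] ++ upperDiagram (negUp k) (fun _ => none) 0 ++
            (lowerDiagram (negLow k) 0 ++ [cross false 2, cup 3, cross false 0, cup 1])
          = [cap 1, cross true 0, cap 2, cross true 1] ++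
              (upperDiagram (negUp k) (fun _ => none) 0 ++ lowerDiagram (negLow k) 0) ++
              [cross false 2, cup 3, cross false 0, cup 1] := by simp
        _ ≈[3, 1] [cap 1, cross true 0, cap 2, cross true 1] ++
              Word.diagram k B [.coil 1, .cross true 1, .cup 0] ++
              [cross false 2, cup 3, cross false 0, cup 1] :=
            ((ih.widen 4).append_left (.of_width rfl)).append_right (.of_width rfl)
        _ ≈[3, 1] Word.diagram k B [.coil 1, .cross true 1, .cross true 1, .cross true 1, .cup 0] :=
            by
              simpa [Word.diagram, Letter.core, Letter.pos] using
                Word.Isotopic.full_twist_neg k B hB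
        _ = Word.diagram (k + 1) B [.coil 1, .cross true 1, .cup 0] := by
            simp [Word.diagram, Letter.core, Letter.pos, twist_two_mul_succ]

end

/-! ### The isotopies of the main result -/

theorem markAt_pos_f : (fun α => markAt [1, 2] [0] (1 :: 2 :: α)) = markRoot Label.Kf := by
  funext α; simp [markAt, markRoot]

theorem markAt_neg_f : (fun α => markAt [1, 0] [0] (1 :: 0 :: α)) = markRoot Label.Kf := by
  funext α; simp [markAt, markRoot]

theorem markAt_g (i : Fin 3) : (fun α => markAt [1, i] [0] (0 :: α)) = markRoot Label.Kg := by
  funext α; simp [markAt, markRoot]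

/-- The tangles inserted into the two twisted strands: that of `f` for `false`, that of `g` for
`true`. -/
def boxes (f g : F3) (b : Bool) : Diagram :=
  if b then openDiagram g (markRoot Label.Kg) 0 else openDiagram f (markRoot Label.Kf) 0

theorem isTangle_boxes (f g : F3) (b : Bool) : IsTangle (boxes f g b) 1 1 := by
  cases b <;> exact isTangle_openDiagram _ _

theorem diagram_box_false (n : ℕ) (f g : F3) (i : ℕ) :
    Word.diagram n (boxes f g) [.box false i] = openDiagram f (markRoot Label.Kf) i := by
  simp [Word.diagram, Letter.core, Letter.pos, boxes, shift_openDiagram]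

theorem diagram_box_true (n : ℕ) (f g : F3) (i : ℕ) :
    Word.diagram n (boxes f g) [.box true i] = openDiagram g (markRoot Label.Kg) i := by
  simp [Word.diagram, Letter.core, Letter.pos, boxes, shift_openDiagram]

/-- The diagram of `l_{k+1}(f, g)` without the arc that joins the roots and without the vertices `∅`
and `1` of both trees, moved to the left by one strand. -/
def linkPosCore (k : ℕ) (f g : F3) : Diagram :=
  upperDiagram f.upper (markRoot Label.Kf) 3 ++ upperDiagram (posUp k) (fun _ => none) 2 ++
    openDiagram g (markRoot Label.Kg) 0 ++ lowerDiagram (posLow k) 0 ++ lowerDiagram f.lower 1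

/-- The diagram of `l_{-(k+1)}(f, g)` without the arc that joins the roots, without the vertices `∅`
and `1` of the upper tree and without the vertices `∅` and `2` of the lower tree, moved to the left
by one strand. -/
def linkNegCore (k : ℕ) (f g : F3) : Diagram :=
  [cap 4, cross true 3] ++ upperDiagram (negUp k) (fun _ => none) 2 ++
    upperDiagram f.upper (markRoot Label.Kf) 1 ++ openDiagram g (markRoot Label.Kg) 0 ++
    lowerDiagram f.lower 1 ++ lowerDiagram (negLow k) 2

theorem linkPosDiagram_eq (k : ℕ) (f g : F3) :
    linkPosDiagram (k + 1) f g = [cap 0, cap 2, cross true 1, cap 3, cross true 2] ++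
      shift 1 (linkPosCore k f g) ++ [cross false 1, cup 2, cup 0] := by
  have no_mark : (fun α => markAt [1, 2] [0] (1 :: 1 :: α)) = fun _ => none := by
    funext α; simp [markAt]
  simp only [linkPosDiagram, linkDiagram, openDiagram, upper_linkPos, lower_linkPos, upperDiagram,
    lowerDiagram, lowerDiagram_graft_posLow, markAt_pos_f, markAt_g, no_mark, linkPosCore,
    Nat.add_sub_cancel, shift_append, shift_upperDiagram, shift_lowerDiagram]
  simp [markAt]

theorem linkNegDiagram_eq (k : ℕ) (f g : F3) :
    linkNegDiagram (k + 1) f g = [cap 0, cap 2, cross true 1, cap 3, cross true 2] ++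
      shift 1 (linkNegCore k f g) ++ [cross false 3, cup 4, cross false 1, cup 2, cup 0] := by
  have no_mark : (fun α => markAt [1, 0] [0] (1 :: 1 :: α)) = fun _ => none := by
    funext α; simp [markAt]
  simp only [linkNegDiagram, linkDiagram, openDiagram, upper_linkNeg, lower_linkNeg, upperDiagram,
    lowerDiagram, markAt_neg_f, markAt_g, no_mark, caret, linkNegCore, Nat.add_sub_cancel,
    shift_append, shift_upperDiagram, shift_lowerDiagram]
  simp [markAt]

theorem isotopic_tangle_upperDiagram {w : Diagram} (h : IsTangle w 1 1) (T : TernaryTree)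
    (μ : Address → Option Label) (i : ℕ) :
    upperDiagram T μ (i + 1) ++ w ≈[i + 2, i + 1 + T.numLeaves] w ++ upperDiagram T μ (i + 1) := by
  have interchanged := TangleIsotopic.interchange h (isTangle_upperDiagram T μ i 0)
  rw [shift_upperDiagram] at interchanged
  exact interchanged.symm.cast (by omega) (by omega)

theorem isotopic_linkPosCore (k : ℕ) (f g : F3) :
    linkPosCore k f g ≈[4, 2] Word.diagram (k + 1) (boxes f g)
      [.box true 0, .cross false 0, .coil 1, .cross true 0, .cup 1, .box false 1] := by
  set U := upperDiagram (posUp k) fun _ => none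
  set L := lowerDiagram (posLow k) 0
  set F := upperDiagram f.upper (markRoot Label.Kf)
  set F' := lowerDiagram f.lower 1
  set G := openDiagram g (markRoot Label.Kg) 0
  have hG : IsTangle G 1 1 := isTangle_openDiagram _ _
  have G_word : G = Word.diagram (k + 1) (boxes f g) [.box true 0] :=
    (diagram_box_true (k + 1) f g 0).symm
  have hL : IsTangle L (1 + 1 + (posUp k).numLeaves) 1 :=
    (isTangle_lowerDiagram (posLow k) 0 0).cast (by rw [numLeaves_posLow, numLeaves_posUp]; omega)
      rfl
  have hF' : IsTangle F' (1 + (0 + f.upper.numLeaves + 0)) 2 :=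
    (isTangle_lowerDiagram f.lower 1 0).cast (by rw [f.numLeaves_eq]; omega) rfl
  have inner : U 2 ++ G ++ L ≈[3, 1]
      Word.diagram (k + 1) (boxes f g)
        [.box true 0, .cross false 0, .coil 1, .cross true 0, .cup 1] :=
    calc U 2 ++ G ++ L
        ≈[3, 1] G ++ U 2 ++ L := (isotopic_tangle_upperDiagram hG (posUp k) _ 1).append_right hL
      _ = G ++ (U 2 ++ L) := by simp
      _ ≈[3, 1] G ++ Word.diagram (k + 1) (boxes f g)
            [.cross false 0, .coil 1, .cross true 0, .cup 1] :=
          (isotopic_posUp_posLow (isTangle_boxes f g) k).append_left (hG.widen 2)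
      _ = _ := by rw [G_word, ← Word.diagram_append]; rfl
  have outer := (TangleIsotopic.interchange inner.1
    (isTangle_upperDiagram f.upper (markRoot Label.Kf) 0 0)).symm
  rw [shift_upperDiagram, shift_upperDiagram] at outer
  calc linkPosCore k f g
      = F 3 ++ (U 2 ++ G ++ L) ++ F' := by simp [linkPosCore, F, U, G, L, F']
    _ ≈[4, 2] U 2 ++ G ++ L ++ F 1 ++ F' := outer.append_right hF'
    _ = U 2 ++ G ++ L ++ openDiagram f (markRoot Label.Kf) 1 := by simp [openDiagram, F, F']
    _ ≈[4, 2] Word.diagram (k + 1) (boxes f g)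
          [.box true 0, .cross false 0, .coil 1, .cross true 0, .cup 1] ++
          openDiagram f (markRoot Label.Kf) 1 :=
        (inner.widen 1).append_right (by
          simpa [shift_openDiagram] using (isTangle_openDiagram f (markRoot Label.Kf)).shift 1)
    _ = _ := by rw [← diagram_box_false (k + 1) f g, ← Word.diagram_append]; rfl

theorem isotopic_boxes (n : ℕ) (f g : F3) :
    upperDiagram f.upper (markRoot Label.Kf) 1 ++ openDiagram g (markRoot Label.Kg) 0 ++
      lowerDiagram f.lower 1 ≈[2, 2]
      Word.diagram n (boxes f g) [.box true 0, .box false 1] := by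
  have lower_f : IsTangle (lowerDiagram f.lower 1) (1 + f.upper.numLeaves) 2 :=
    (isTangle_lowerDiagram f.lower 1 0).cast (by rw [f.numLeaves_eq]; omega) rfl
  have pass := isotopic_tangle_upperDiagram (isTangle_openDiagram g (markRoot Label.Kg)) f.upper
    (markRoot Label.Kf) 0
  calc upperDiagram f.upper (markRoot Label.Kf) 1 ++ openDiagram g (markRoot Label.Kg) 0 ++
        lowerDiagram f.lower 1
      ≈[2, 2] openDiagram g (markRoot Label.Kg) 0 ++ upperDiagram f.upper (markRoot Label.Kf) 1 ++
        lowerDiagram f.lower 1 := (pass.cast rfl (by omega)).append_right lower_f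
    _ = openDiagram g (markRoot Label.Kg) 0 ++ openDiagram f (markRoot Label.Kf) 1 := by
        simp [openDiagram]
    _ = Word.diagram n (boxes f g) [.box true 0, .box false 1] := by
        rw [← diagram_box_true n f g, ← diagram_box_false n f g, ← Word.diagram_append]; rfl

theorem isotopic_negUp_boxes_negLow {B : Bool → Diagram} (hB : ∀ b, IsTangle (B b) 1 1) (k : ℕ) :
    upperDiagram (negUp k) (fun _ => none) 2 ++
      Word.diagram k B [.box true 0, .box false 1] ++ lowerDiagram (negLow k) 2 ≈[5, 3]
      Word.diagram k B [.box true 0, .box false 1, .coil 3, .cross true 3, .cup 2] := by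
  set U := upperDiagram (negUp k) fun _ => none
  set L := lowerDiagram (negLow k)
  set W := Word.diagram k B [.box true 0, .box false 1]
  have hW : IsTangle W 2 2 := Word.isTangle_diagram _ hB rfl
  have hL : IsTangle (L 2) (2 + (0 + (negUp k).numLeaves + 2)) 3 :=
    (isTangle_lowerDiagram (negLow k) 2 0).cast
      (by rw [numLeaves_negLow, numLeaves_negUp]; omega) rfl
  have past_boxes : U 2 ++ W ≈[5, 2 + (0 + (negUp k).numLeaves + 2)] W ++ U 2 := by
    simpa [shift_upperDiagram] using
      (TangleIsotopic.interchange hW (isTangle_upperDiagram (negUp k) (fun _ => none) 0 2)).symm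
  have twists : U 2 ++ L 2 ≈[5, 3] Word.diagram k B [.coil 3, .cross true 3, .cup 2] := by
    simpa [shift_upperDiagram, shift_lowerDiagram, Word.diagram, Letter.core, Letter.pos,
      shift_shift] using (isotopic_negUp_negLow hB k).shift 2
  calc U 2 ++ W ++ L 2
      ≈[5, 3] W ++ U 2 ++ L 2 := past_boxes.append_right hL
    _ = W ++ (U 2 ++ L 2) := List.append_assoc ..
    _ ≈[5, 3] W ++ Word.diagram k B [.coil 3, .cross true 3, .cup 2] :=
        twists.append_left (hW.widen 3)
    _ = _ := by rw [← Word.diagram_append]; rfl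

theorem isotopic_linkNegCore (k : ℕ) (f g : F3) :
    linkNegCore k f g ≈[5, 5] Word.diagram (k + 1) (boxes f g)
      [.box true 0, .box false 1, .cap 4, .coil 3, .cup 2] := by
  set U := upperDiagram (negUp k) (fun _ => none) 2
  set L := lowerDiagram (negLow k) 2
  set BB := upperDiagram f.upper (markRoot Label.Kf) 1 ++ openDiagram g (markRoot Label.Kg) 0 ++
    lowerDiagram f.lower 1
  have hU : IsTangle U 5 (2 + (0 + (negUp k).numLeaves + 2)) :=
    (isTangle_upperDiagram (negUp k) _ 2 2).cast rfl (by omega)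
  have hL : IsTangle L (2 + (0 + (negUp k).numLeaves + 2)) 3 :=
    (isTangle_lowerDiagram (negLow k) 2 0).cast
      (by rw [numLeaves_negLow, numLeaves_negUp]; omega) rfl
  have inner : U ++ BB ++ L ≈[5, 3] Word.diagram k (boxes f g)
      [.box true 0, .box false 1, .coil 3, .cross true 3, .cup 2] :=
    ((((isotopic_boxes k f g).widen _).append_left hU).append_right hL).trans
      (isotopic_negUp_boxes_negLow (isTangle_boxes f g) k)
  have past_boxes : [.cap 4, .cross true 3, .box true 0, .box false 1, .coil 3, .cross true 3,
      .cup 2] ∼[5, 5]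
      [.box true 0, .box false 1, .cap 4, .coil 3, .cross true 3, .cross true 3, .cup 2] :=
    ((Word.Isotopic.coil_cross true).symm.rewrite 3 3).symm
  calc linkNegCore k f g
      = [cap 4, cross true 3] ++ (U ++ BB ++ L) := by simp [linkNegCore, BB, U, L]
    _ ≈[5, 5] [cap 4, cross true 3] ++ Word.diagram k (boxes f g)
          [.box true 0, .box false 1, .coil 3, .cross true 3, .cup 2] :=
        (inner.widen 2).append_left (.of_width rfl)
    _ = Word.diagram k (boxes f g) [.cap 4, .cross true 3, .box true 0, .box false 1, .coil 3,
          .cross true 3, .cup 2] := by simp [Word.diagram, Letter.core, Letter.pos]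
    _ ≈[5, 5] Word.diagram k (boxes f g) [.box true 0, .box false 1, .cap 4, .coil 3,
          .cross true 3, .cross true 3, .cup 2] := past_boxes k (boxes f g) (isTangle_boxes f g)
    _ = _ := by simp [Word.diagram, Letter.core, Letter.pos, twist_two_mul_succ]

theorem linkIsotopic_pos {n : ℕ} (hn : 1 ≤ n) (f g : F3) :
    LinkIsotopic (linkPosDiagram n f g) (twistedDiagram 2 n f g) := by
  obtain ⟨k, rfl⟩ := Nat.exists_eq_add_of_le' hn
  calc linkPosDiagram (k + 1) f g
      = [cap 0, cap 2, cross true 1, cap 3, cross true 2] ++ shift 1 (linkPosCore k f g) ++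
        [cross false 1, cup 2, cup 0] := linkPosDiagram_eq k f g
    _ ≈[0, 0] [cap 0, cap 2, cross true 1, cap 3, cross true 2] ++
        shift 1 (Word.diagram (k + 1) (boxes f g)
          [.box true 0, .cross false 0, .coil 1, .cross true 0, .cup 1, .box false 1]) ++
        [cross false 1, cup 2, cup 0] :=
      ((((isotopic_linkPosCore k f g).shift 1).widen 1).append_left (.of_width rfl)).append_right
        (.of_width rfl)
    _ ≈[0, 0] Word.diagram (k + 1) (boxes f g)
          [.cap 0, .box false 1, .cap 2, .box true 2, .coil 1, .cup 2, .cup 0] := by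
        simpa [Word.diagram, Letter.core, Letter.pos, shift_shift] using
          Word.Isotopic.straighten_pos (k + 1) (boxes f g) (isTangle_boxes f g)
    _ = twistedDiagram 2 (k + 1) f g := by
        rw [twistedDiagram, ← shift_twist, ← diagram_box_true (k + 1) f g,
          ← diagram_box_false (k + 1) f g]
        simp [Word.diagram, Letter.core, Letter.pos]

theorem linkIsotopic_neg {n : ℕ} (hn : 1 ≤ n) (f g : F3) :
    LinkIsotopic (linkNegDiagram n f g) (twistedDiagram 3 n f g) := by
  obtain ⟨k, rfl⟩ := Nat.exists_eq_add_of_le' hn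
  calc linkNegDiagram (k + 1) f g
      = [cap 0, cap 2, cross true 1, cap 3, cross true 2] ++ shift 1 (linkNegCore k f g) ++
        [cross false 3, cup 4, cross false 1, cup 2, cup 0] := linkNegDiagram_eq k f g
    _ ≈[0, 0] [cap 0, cap 2, cross true 1, cap 3, cross true 2] ++
        shift 1 (Word.diagram (k + 1) (boxes f g)
          [.box true 0, .box false 1, .cap 4, .coil 3, .cup 2]) ++
        [cross false 3, cup 4, cross false 1, cup 2, cup 0] :=
      (((isotopic_linkNegCore k f g).shift 1).append_left (.of_width rfl)).append_right
        (.of_width rfl)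
    _ ≈[0, 0] Word.diagram (k + 1) (boxes f g)
          [.cap 0, .box false 1, .cap 2, .box true 3, .coil 1, .cup 2, .cup 0] := by
        simpa [Word.diagram, Letter.core, Letter.pos, shift_shift] using
          Word.Isotopic.straighten_neg (k + 1) (boxes f g) (isTangle_boxes f g)
    _ = twistedDiagram 3 (k + 1) f g := by
        rw [twistedDiagram, ← shift_twist, ← diagram_box_true (k + 1) f g,
          ← diagram_box_false (k + 1) f g]
        simp [Word.diagram, Letter.core, Letter.pos]

/-! ### Flows -/

/-- The relation between the strengths of the strands that enter a slice from above (`v`) and of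
those that leave it below (`u`), both numbered from `0`: a local extremum reverses the direction, a
crossing and a mark pass the strengths on. -/
def Slice.Joins : Slice → (ℕ → ℤ) → (ℕ → ℤ) → Prop
  | cap _, _, u => u 0 + u 1 = 0
  | cup _, v, _ => v 0 + v 1 = 0
  | cross _ _, v, u => u 0 = v 1 ∧ u 1 = v 0
  | mark _ _ _, v, u => u 0 = v 0

/-- Signed strengths of the strands above (`v`) and below (`u`) a slice that are constant along the
strands: the strand `j` carries the strength `v j` downwards. -/
structure SliceFlow (s : Slice) (v u : ℕ → ℤ) : Prop where
  left : ∀ j < s.pos, v j = u j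
  joins : s.Joins (fun j => v (s.pos + j)) fun j => u (s.pos + j)
  right : ∀ j, v (s.pos + s.inputs + j) = u (s.pos + s.outputs + j)

/-- A flow on a diagram, i.e. strengths that are constant along the strands, with the values `v` at
the top and `u` at the bottom. The list contains the values at the heights just above the slices, so
it starts with `v` and does not contain `u`. -/
inductive Flow : Diagram → List (ℕ → ℤ) → (ℕ → ℤ) → (ℕ → ℤ) → Prop
  | nil (v : ℕ → ℤ) : Flow [] [] v v
  | cons {s : Slice} {w : Diagram} {x : List (ℕ → ℤ)} {v m u : ℕ → ℤ} (hs : SliceFlow s v m)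
      (hw : Flow w x m u) : Flow (s :: w) (v :: x) v u

theorem flow_nil_iff {x : List (ℕ → ℤ)} {v u : ℕ → ℤ} : Flow [] x v u ↔ x = [] ∧ v = u :=
  ⟨by rintro ⟨⟩; exact ⟨rfl, rfl⟩, by rintro ⟨rfl, rfl⟩; exact .nil v⟩

theorem flow_cons_iff {s : Slice} {w : Diagram} {x : List (ℕ → ℤ)} {v u : ℕ → ℤ} :
    Flow (s :: w) x v u ↔ ∃ m y, x = v :: y ∧ SliceFlow s v m ∧ Flow w y m u :=
  ⟨by rintro ⟨⟩; exact ⟨_, _, rfl, ‹_›, ‹_›⟩, by rintro ⟨m, y, rfl, hs, hw⟩; exact .cons hs hw⟩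

theorem flow_append_iff {a b : Diagram} {x : List (ℕ → ℤ)} {v u : ℕ → ℤ} :
    Flow (a ++ b) x v u ↔ ∃ m y z, x = y ++ z ∧ Flow a y v m ∧ Flow b z m u := by
  induction a generalizing x v with
  | nil => simp [flow_nil_iff]
  | cons s a ih =>
      simp only [List.cons_append, flow_cons_iff, ih]
      constructor
      · rintro ⟨m, _, rfl, hs, n, y, z, rfl, hy, hz⟩
        exact ⟨n, v :: y, z, rfl, ⟨m, y, rfl, hs, hy⟩, hz⟩
      · rintro ⟨n, _, z, rfl, ⟨m, y, rfl, hs, hy⟩, hz⟩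
        exact ⟨m, y ++ z, rfl, hs, n, y, z, rfl, hy, hz⟩

theorem Flow.append {a b : Diagram} {x y : List (ℕ → ℤ)} {v m u : ℕ → ℤ} (ha : Flow a x v m)
    (hb : Flow b y m u) : Flow (a ++ b) (x ++ y) v u :=
  flow_append_iff.2 ⟨m, x, y, rfl, ha, hb⟩

theorem Flow.length_eq {w : Diagram} {x : List (ℕ → ℤ)} {v u : ℕ → ℤ} (h : Flow w x v u) :
    w.length = x.length := by
  induction h with
  | nil => rfl
  | cons _ _ ih => exact congrArg (· + 1) ih

/-- If the slice is a mark `c`, the marked strand has the strength `z` in its direction. -/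
def Slice.HasMarkStrength : Slice → (ℕ → ℤ) → Label → ℤ → Prop
  | mark c' d i, v, c, z => c' = c → (if d then v i else -v i) = z
  | _, _, _, _ => True

/-- The flow has the strength `z` at every mark `c`, in the direction of the mark. -/
def HasMarkStrength (w : Diagram) (x : List (ℕ → ℤ)) (c : Label) (z : ℤ) : Prop :=
  ∀ p ∈ w.zip x, p.1.HasMarkStrength p.2 c z

/-- No strand carries both flows. -/
def FlowDisjoint (x y : List (ℕ → ℤ)) : Prop := ∀ p ∈ x.zip y, p.1 * p.2 = 0

/-- The contribution of a slice to the crossing form of two flows. -/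
def sliceForm : Slice → (ℕ → ℤ) → (ℕ → ℤ) → ℤ
  | cross b i, v, v' => (if b then 1 else -1) * (v i * v' (i + 1) + v' i * v (i + 1))
  | _, _, _ => 0

/-- The crossing form of two flows: the crossings are counted with the products of their signs and
the strengths of the flows, so that unit flows along two components yield twice their linking
number. -/
def flowForm (w : Diagram) (x y : List (ℕ → ℤ)) : ℤ :=
  ((w.zip (x.zip y)).map fun p => sliceForm p.1 p.2.1 p.2.2).sum

variable {a b w : Diagram} {x x' y y' : List (ℕ → ℤ)} {c : Label} {z : ℤ} {v v' u u' : ℕ → ℤ}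

theorem hasMarkStrength_append_iff (h : a.length = x.length) :
    HasMarkStrength (a ++ b) (x ++ y) c z ↔
      HasMarkStrength a x c z ∧ HasMarkStrength b y c z := by
  simp only [HasMarkStrength, List.zip_append h, List.mem_append, or_imp, forall_and]

theorem flowDisjoint_append_iff (h : x.length = y.length) :
    FlowDisjoint (x ++ x') (y ++ y') ↔ FlowDisjoint x y ∧ FlowDisjoint x' y' := by
  simp only [FlowDisjoint, List.zip_append h, List.mem_append, or_imp, forall_and]

theorem flowForm_append (h : a.length = x.length) (h' : x.length = y.length) :
    flowForm (a ++ b) (x ++ x') (y ++ y') = flowForm a x y + flowForm b x' y' := by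
  simp only [flowForm, List.zip_append h', List.map_append, List.sum_append,
    List.zip_append (h.trans (by simp [h'] : x.length = (x.zip y).length))]

theorem Flow.mul_eq_zero_of_flowDisjoint (h : Flow w x v u) (h' : Flow w x' v' u')
    (hd : FlowDisjoint x x') (hu : u * u' = 0) : v * v' = 0 := by
  cases h with
  | nil => cases h'; exact hu
  | cons => cases h'; exact hd (v, v') (by simp)

/-- The data that make two tangle diagrams with the same endpoints interchangeable in the
computation of linking numbers by flows. Only flows that are disjoint on the boundary need to have
equal crossing forms, because a kink contributes the product of the two strengths. -/
structure FlowEquivalent (a b : Diagram) : Prop where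
  exists_flow_iff : ∀ v u, (∃ x, Flow a x v u) ↔ ∃ y, Flow b y v u
  hasMarkStrength_iff : ∀ {x y v u c z}, Flow a x v u → Flow b y v u →
    (HasMarkStrength a x c z ↔ HasMarkStrength b y c z)
  flowDisjoint_left : ∀ {x x' v v' u u'}, Flow a x v u → Flow a x' v' u' → v * v' = 0 →
    u * u' = 0 → FlowDisjoint x x'
  flowDisjoint_right : ∀ {y y' v v' u u'}, Flow b y v u → Flow b y' v' u' → v * v' = 0 →
    u * u' = 0 → FlowDisjoint y y'
  flowForm_eq : ∀ {x x' y y' v v' u u'}, Flow a x v u → Flow a x' v' u' → Flow b y v u →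
    Flow b y' v' u' → v * v' = 0 → u * u' = 0 → flowForm a x x' = flowForm b y y'

theorem FlowEquivalent.symm (h : FlowEquivalent a b) : FlowEquivalent b a where
  exists_flow_iff v u := (h.exists_flow_iff v u).symm
  hasMarkStrength_iff hx hy := (h.hasMarkStrength_iff hy hx).symm
  flowDisjoint_left := h.flowDisjoint_right
  flowDisjoint_right := h.flowDisjoint_left
  flowForm_eq hx hx' hy hy' hv hu := (h.flowForm_eq hy hy' hx hx' hv hu).symm

theorem FlowEquivalent.of_solutions {P : (ℕ → ℤ) → (ℕ → ℤ) → Prop}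
    {X Y : (ℕ → ℤ) → (ℕ → ℤ) → List (ℕ → ℤ)}
    (ha : ∀ x v u, Flow a x v u ↔ P v u ∧ x = X v u)
    (hb : ∀ y v u, Flow b y v u ↔ P v u ∧ y = Y v u)
    (mark : ∀ v u c z, P v u →
      (HasMarkStrength a (X v u) c z ↔ HasMarkStrength b (Y v u) c z))
    (disjoint : ∀ v u v' u', v * v' = 0 → u * u' = 0 →
      FlowDisjoint (X v u) (X v' u') ∧ FlowDisjoint (Y v u) (Y v' u'))
    (form : ∀ v u v' u', P v u → P v' u' → v * v' = 0 → u * u' = 0 →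
      flowForm a (X v u) (X v' u') = flowForm b (Y v u) (Y v' u')) : FlowEquivalent a b where
  exists_flow_iff v u := by simp only [ha, hb, exists_and_left, exists_eq, and_true]
  hasMarkStrength_iff hx hy := by
    obtain ⟨h, rfl⟩ := (ha _ _ _).1 hx
    obtain ⟨-, rfl⟩ := (hb _ _ _).1 hy
    exact mark _ _ _ _ h
  flowDisjoint_left hx hx' hv hu := by
    obtain ⟨-, rfl⟩ := (ha _ _ _).1 hx
    obtain ⟨-, rfl⟩ := (ha _ _ _).1 hx'
    exact (disjoint _ _ _ _ hv hu).1
  flowDisjoint_right hy hy' hv hu := by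
    obtain ⟨-, rfl⟩ := (hb _ _ _).1 hy
    obtain ⟨-, rfl⟩ := (hb _ _ _).1 hy'
    exact (disjoint _ _ _ _ hv hu).2
  flowForm_eq hx hx' hy hy' hv hu := by
    obtain ⟨h, rfl⟩ := (ha _ _ _).1 hx
    obtain ⟨h', rfl⟩ := (ha _ _ _).1 hx'
    obtain ⟨-, rfl⟩ := (hb _ _ _).1 hy
    obtain ⟨-, rfl⟩ := (hb _ _ _).1 hy'
    exact form _ _ _ _ h h' hv hu

theorem flow_pair_iff {s t : Slice} : Flow [s, t] x v u ↔
    ∃ m, x = [v, m] ∧ SliceFlow s v m ∧ SliceFlow t m u := by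
  simp only [flow_cons_iff, flow_nil_iff]
  constructor
  · rintro ⟨m, _, rfl, hs, n, _, rfl, ht, rfl, rfl⟩
    exact ⟨m, rfl, hs, ht⟩
  · rintro ⟨m, rfl, hs, ht⟩
    exact ⟨m, [m], rfl, hs, u, [], rfl, ht, rfl, rfl⟩

theorem flow_singleton_iff {s : Slice} : Flow [s] x v u ↔ x = [v] ∧ SliceFlow s v u := by
  simp only [flow_cons_iff, flow_nil_iff]
  constructor
  · rintro ⟨m, _, rfl, hs, rfl, rfl⟩
    exact ⟨rfl, hs⟩
  · rintro ⟨rfl, hs⟩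
    exact ⟨u, [], rfl, hs, rfl, rfl⟩

/-- The renumbering of strands caused by a local extremum at the strands `i`, `i + 1`: the strand
`j` on its empty side is the strand `skipTwo i j` on its other side. -/
def skipTwo (i j : ℕ) : ℕ := if j < i then j else j + 2

theorem sliceFlow_cap_iff {i : ℕ} :
    SliceFlow (cap i) v u ↔ u i + u (i + 1) = 0 ∧ v = u ∘ skipTwo i := by
  constructor
  · rintro ⟨hl, hj, hr⟩
    refine ⟨hj, funext fun j => ?_⟩
    rcases lt_or_ge j i with h | h
    · simpa [skipTwo, h] using hl j h
    · obtain ⟨k, rfl⟩ := Nat.exists_eq_add_of_le h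
      simpa [skipTwo, pos, inputs, outputs, Nat.add_right_comm] using hr k
  · rintro ⟨hj, rfl⟩
    refine ⟨fun j hj => ?_, hj, fun j => ?_⟩ <;> grind [skipTwo, pos, inputs, outputs]

theorem sliceFlow_cup_iff {i : ℕ} :
    SliceFlow (cup i) v u ↔ v i + v (i + 1) = 0 ∧ u = v ∘ skipTwo i := by
  rw [← sliceFlow_cap_iff]
  exact ⟨fun h => ⟨fun j hj => (h.1 j hj).symm, h.2, fun j => (h.3 j).symm⟩,
    fun h => ⟨fun j hj => (h.1 j hj).symm, h.2, fun j => (h.3 j).symm⟩⟩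

theorem sliceFlow_cross_iff {d : Bool} {i : ℕ} :
    SliceFlow (cross d i) v u ↔ u = v ∘ Equiv.swap i (i + 1) := by
  constructor
  · rintro ⟨hl, hj, hr⟩
    funext j
    rcases lt_or_ge j (i + 2) with h | h
    · rcases lt_trichotomy j i with hj' | rfl | hj'
      · simpa [Equiv.swap_apply_of_ne_of_ne hj'.ne (by lia : j ≠ i + 1)] using (hl j hj').symm
      · simpa [pos] using hj.1
      · obtain rfl : j = i + 1 := by lia
        simpa [pos] using hj.2
    · obtain ⟨k, rfl⟩ := Nat.exists_eq_add_of_le h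
      have hk : Equiv.swap i (i + 1) (i + 2 + k) = i + 2 + k :=
        Equiv.swap_apply_of_ne_of_ne (by lia) (by lia)
      simpa [hk, pos, inputs, outputs] using (hr k).symm
  · rintro rfl
    refine ⟨fun j hj => ?_, ?_, fun j => ?_⟩ <;>
      grind [pos, inputs, outputs, Joins]

theorem sliceFlow_cross_iff' {d : Bool} {i : ℕ} :
    SliceFlow (cross d i) v u ↔ v = u ∘ Equiv.swap i (i + 1) := by
  rw [sliceFlow_cross_iff]
  constructor <;> rintro rfl <;> funext j <;> simp

theorem sliceFlow_mark_iff {d : Bool} {i : ℕ} : SliceFlow (mark c d i) v u ↔ u = v := by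
  constructor
  · rintro ⟨hl, hj, hr⟩
    funext j
    rcases lt_trichotomy j i with h | rfl | h
    · exact (hl j h).symm
    · exact hj
    · obtain ⟨k, rfl⟩ := Nat.exists_eq_add_of_le (Nat.succ_le_of_lt h)
      exact (hr k).symm
  · rintro rfl
    exact ⟨fun _ _ => rfl, rfl, fun _ => rfl⟩

/-- The strengths at the middle height of a zigzag at the strands `i`, `i + 1`, `i + 2` with the
boundary values `v`. -/
def zigzag (i : ℕ) (v : ℕ → ℤ) (j : ℕ) : ℤ :=
  if j ≤ i then v j else if j = i + 1 then -v i else v (j - 2)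

theorem zigzag_mul_zigzag (i : ℕ) (h : v * v' = 0) : zigzag i v * zigzag i v' = 0 := by
  funext j
  have hv k : v k * v' k = 0 := congrFun h k
  simp only [zigzag, Pi.mul_apply, Pi.zero_apply]
  split_ifs <;> simp [hv]

theorem eq_zigzag_iff_left {i : ℕ} {m : ℕ → ℤ} :
    (m (i + 1) + m (i + 1 + 1) = 0 ∧ v = m ∘ skipTwo (i + 1)) ∧ m i + m (i + 1) = 0 ∧
      u = m ∘ skipTwo i ↔ v = u ∧ m = zigzag i v := by
  constructor
  · rintro ⟨⟨h, rfl⟩, h', rfl⟩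
    constructor <;> funext j <;> grind [skipTwo, zigzag]
  · rintro ⟨rfl, rfl⟩
    refine ⟨⟨?_, funext fun j => ?_⟩, ?_, funext fun j => ?_⟩ <;> grind [skipTwo, zigzag]

theorem eq_zigzag_iff_right {i : ℕ} {m : ℕ → ℤ} :
    (m i + m (i + 1) = 0 ∧ v = m ∘ skipTwo i) ∧ m (i + 1) + m (i + 1 + 1) = 0 ∧
      u = m ∘ skipTwo (i + 1) ↔ v = u ∧ m = zigzag i v := by
  rw [and_comm, eq_zigzag_iff_left, eq_comm (a := u)]
  exact and_congr_right fun h => by rw [h]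

theorem flowEquivalent_zigzag_left (i : ℕ) : FlowEquivalent [cap (i + 1), cup i] [] := by
  refine .of_solutions (P := fun v u => v = u) (X := fun v _ => [v, zigzag i v])
    (Y := fun _ _ => []) (fun x v u => ?_) (by simp [flow_nil_iff, and_comm])
    (by simp [HasMarkStrength, Slice.HasMarkStrength])
    (fun v u v' u' hv _ => ?_) (by simp [flowForm, sliceForm])
  · simp only [flow_pair_iff, sliceFlow_cap_iff, sliceFlow_cup_iff, eq_zigzag_iff_left]
    grind
  · simp [FlowDisjoint, hv, zigzag_mul_zigzag]

theorem flowEquivalent_zigzag_right (i : ℕ) : FlowEquivalent [cap i, cup (i + 1)] [] := by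
  refine .of_solutions (P := fun v u => v = u) (X := fun v _ => [v, zigzag i v])
    (Y := fun _ _ => []) (fun x v u => ?_) (by simp [flow_nil_iff, and_comm])
    (by simp [HasMarkStrength, Slice.HasMarkStrength])
    (fun v u v' u' hv _ => ?_) (by simp [flowForm, sliceForm])
  · simp only [flow_pair_iff, sliceFlow_cap_iff, sliceFlow_cup_iff, eq_zigzag_iff_right]
    grind
  · simp [FlowDisjoint, hv, zigzag_mul_zigzag]

theorem flowEquivalent_reidemeister_two (d : Bool) (i : ℕ) :
    FlowEquivalent [cross d i, cross (!d) i] [] := by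
  refine .of_solutions (P := fun v u => v = u) (X := fun v _ => [v, v ∘ Equiv.swap i (i + 1)])
    (Y := fun _ _ => []) ?_ (by simp [flow_nil_iff, and_comm])
    (by simp [HasMarkStrength, Slice.HasMarkStrength])
    (fun v u v' u' hv _ => ?_) (fun v u v' u' _ _ _ _ => ?_)
  · grind [flow_pair_iff, sliceFlow_cross_iff, sliceFlow_cross_iff']
  · simp [FlowDisjoint, ← Pi.mul_comp, hv]
  · cases d <;> simp [flowForm, sliceForm] <;> ring

theorem swap_comp_skipTwo (i : ℕ) :
    Equiv.swap (i + 1) (i + 2) ∘ skipTwo i = Equiv.swap i (i + 1) ∘ skipTwo (i + 1) := by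
  funext j; grind [skipTwo]

theorem swap_left_apply (i : ℕ) : Equiv.swap i (i + 1) (i + 2) = i + 2 :=
  Equiv.swap_apply_of_ne_of_ne (by lia) (by lia)

theorem swap_right_apply (i : ℕ) : Equiv.swap (i + 1) (i + 2) i = i :=
  Equiv.swap_apply_of_ne_of_ne (by lia) (by lia)

theorem flowEquivalent_cap_slide (d : Bool) (i : ℕ) :
    FlowEquivalent [cap i, cross d (i + 1)] [cap (i + 1), cross (!d) i] := by
  refine .of_solutions
    (P := fun v u => u i + u (i + 2) = 0 ∧ v = u ∘ Equiv.swap (i + 1) (i + 2) ∘ skipTwo i)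
    (X := fun v u => [v, u ∘ Equiv.swap (i + 1) (i + 2)])
    (Y := fun v u => [v, u ∘ Equiv.swap i (i + 1)]) (fun x v u => ?_) (fun y v u => ?_)
    (by simp [HasMarkStrength, Slice.HasMarkStrength])
    (fun v u v' u' hv hu => ?_) (fun v u v' u' h h' _ _ => ?_)
  · simp [flow_pair_iff, sliceFlow_cap_iff, sliceFlow_cross_iff', swap_right_apply,
      Function.comp_assoc, and_comm]
  · simp [flow_pair_iff, sliceFlow_cap_iff, sliceFlow_cross_iff', swap_left_apply,
      swap_comp_skipTwo, Function.comp_assoc, and_comm]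
  · simp [FlowDisjoint, ← Pi.mul_comp, hv, hu]
  · have hi : u (i + 2) = -u i := by linear_combination h.1
    have hi' : u' (i + 2) = -u' i := by linear_combination h'.1
    cases d <;> simp [flowForm, sliceForm, hi, hi'] <;> ring

theorem flowEquivalent_cup_slide (d : Bool) (i : ℕ) :
    FlowEquivalent [cross d (i + 1), cup i] [cross (!d) i, cup (i + 1)] := by
  refine .of_solutions
    (P := fun v u => v i + v (i + 2) = 0 ∧ u = v ∘ Equiv.swap (i + 1) (i + 2) ∘ skipTwo i)
    (X := fun v _ => [v, v ∘ Equiv.swap (i + 1) (i + 2)])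
    (Y := fun v _ => [v, v ∘ Equiv.swap i (i + 1)]) (fun x v u => ?_) (fun y v u => ?_)
    (by simp [HasMarkStrength, Slice.HasMarkStrength])
    (fun v u v' u' hv _ => ?_) (fun v u v' u' h h' _ _ => ?_)
  · simp [flow_pair_iff, sliceFlow_cup_iff, sliceFlow_cross_iff, swap_right_apply,
      Function.comp_assoc, and_comm]
  · simp [flow_pair_iff, sliceFlow_cup_iff, sliceFlow_cross_iff, swap_left_apply,
      swap_comp_skipTwo, Function.comp_assoc, and_comm]
  · simp [FlowDisjoint, ← Pi.mul_comp, hv]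
  · have hi : v (i + 2) = -v i := by linear_combination h.1
    have hi' : v' (i + 2) = -v' i := by linear_combination h'.1
    cases d <;> simp [flowForm, sliceForm, hi, hi'] <;> ring

theorem swap_comp_skipTwo_self (i : ℕ) : Equiv.swap i (i + 1) ∘ skipTwo i = skipTwo i := by
  funext j; grind [skipTwo]

theorem flowEquivalent_reidemeister_one_cap (d : Bool) (i : ℕ) :
    FlowEquivalent [cap i, cross d i] [cap i] := by
  refine .of_solutions (P := fun v u => u i + u (i + 1) = 0 ∧ v = u ∘ skipTwo i)
    (X := fun v u => [v, u ∘ Equiv.swap i (i + 1)]) (Y := fun v _ => [v])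
    (fun x v u => ?_) (fun y v u => ?_)
    (by simp [HasMarkStrength, Slice.HasMarkStrength])
    (fun v u v' u' hv hu => ?_) (fun v u v' u' h h' _ hu => ?_)
  · simp [flow_pair_iff, sliceFlow_cap_iff, sliceFlow_cross_iff', swap_comp_skipTwo_self,
      Function.comp_assoc, add_comm, and_comm]
  · simp [flow_singleton_iff, sliceFlow_cap_iff, and_comm]
  · simp [FlowDisjoint, ← Pi.mul_comp, hv, hu]
  · have hi : u (i + 1) = -u i := by linear_combination h.1
    have hi' : u' (i + 1) = -u' i := by linear_combination h'.1
    have hu' : u i * u' i = 0 := congrFun hu i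
    simp [flowForm, sliceForm, hi, hi', hu', mul_comm (u' i)]

theorem flowEquivalent_reidemeister_one_cup (d : Bool) (i : ℕ) :
    FlowEquivalent [cross d i, cup i] [cup i] := by
  refine .of_solutions (P := fun v u => v i + v (i + 1) = 0 ∧ u = v ∘ skipTwo i)
    (X := fun v _ => [v, v ∘ Equiv.swap i (i + 1)]) (Y := fun v _ => [v])
    (fun x v u => ?_) (fun y v u => ?_)
    (by simp [HasMarkStrength, Slice.HasMarkStrength])
    (fun v u v' u' hv _ => ?_) (fun v u v' u' h h' hv _ => ?_)
  · simp [flow_pair_iff, sliceFlow_cup_iff, sliceFlow_cross_iff, swap_comp_skipTwo_self,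
      Function.comp_assoc, add_comm, and_comm]
  · simp [flow_singleton_iff, sliceFlow_cup_iff, and_comm]
  · simp [FlowDisjoint, ← Pi.mul_comp, hv]
  · have hi : v (i + 1) = -v i := by linear_combination h.1
    have hi' : v' (i + 1) = -v' i := by linear_combination h'.1
    have hv' : v i * v' i = 0 := congrFun hv i
    simp [flowForm, sliceForm, hi, hi', hv', mul_comm (v' i)]

theorem swap_braid (i : ℕ) :
    Equiv.swap i (i + 1) ∘ Equiv.swap (i + 1) (i + 2) ∘ Equiv.swap i (i + 1) =
      Equiv.swap (i + 1) (i + 2) ∘ Equiv.swap i (i + 1) ∘ Equiv.swap (i + 1) (i + 2) := by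
  funext j; grind

theorem flowEquivalent_reidemeister_three (d : Bool) (i : ℕ) :
    FlowEquivalent [cross d i, cross d (i + 1), cross d i]
      [cross d (i + 1), cross d i, cross d (i + 1)] := by
  refine .of_solutions
    (P := fun v u => u =
      v ∘ Equiv.swap i (i + 1) ∘ Equiv.swap (i + 1) (i + 2) ∘ Equiv.swap i (i + 1))
    (X := fun v _ => [v, v ∘ Equiv.swap i (i + 1),
      v ∘ Equiv.swap i (i + 1) ∘ Equiv.swap (i + 1) (i + 2)])
    (Y := fun v _ => [v, v ∘ Equiv.swap (i + 1) (i + 2),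
      v ∘ Equiv.swap (i + 1) (i + 2) ∘ Equiv.swap i (i + 1)])
    (fun x v u => ?_) (fun y v u => ?_)
    (by simp [HasMarkStrength, Slice.HasMarkStrength])
    (fun v u v' u' hv _ => ?_) (fun v u v' u' _ _ _ _ => ?_)
  · simp [flow_cons_iff, flow_nil_iff, sliceFlow_cross_iff, Function.comp_assoc, and_comm, eq_comm]
  · simp [flow_cons_iff, flow_nil_iff, sliceFlow_cross_iff, Function.comp_assoc, and_comm, eq_comm,
      swap_braid]
  · simp [FlowDisjoint, ← Pi.mul_comp, hv]
  · simp only [flowForm, sliceForm, swap_left_apply, swap_right_apply, Equiv.swap_apply_left,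
      Equiv.swap_apply_right, Function.comp_apply, List.zip_cons_cons, List.zip_nil_right,
      List.map_cons, List.map_nil, List.sum_cons, List.sum_nil]
    ring

theorem flowEquivalent_mark_cross_left (c : Label) (d b : Bool) (i : ℕ) :
    FlowEquivalent [mark c d i, cross b i] [cross b i, mark c d (i + 1)] := by
  refine .of_solutions (P := fun v u => u = v ∘ Equiv.swap i (i + 1)) (X := fun v _ => [v, v])
    (Y := fun v _ => [v, v ∘ Equiv.swap i (i + 1)]) (fun x v u => ?_) (fun y v u => ?_)
    (fun v u c z _ => ?_) (fun v u v' u' hv _ => ?_) (fun v u v' u' _ _ _ _ => ?_)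
  · simp [flow_pair_iff, sliceFlow_mark_iff, sliceFlow_cross_iff, and_comm]
  · simp +contextual [flow_pair_iff, sliceFlow_mark_iff, sliceFlow_cross_iff, and_comm]
  · cases d <;> simp +contextual [HasMarkStrength, Slice.HasMarkStrength]
  · simp [FlowDisjoint, ← Pi.mul_comp, hv]
  · simp [flowForm, sliceForm]

theorem flowEquivalent_mark_cross_right (c : Label) (d b : Bool) (i : ℕ) :
    FlowEquivalent [mark c d (i + 1), cross b i] [cross b i, mark c d i] := by
  refine .of_solutions (P := fun v u => u = v ∘ Equiv.swap i (i + 1)) (X := fun v _ => [v, v])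
    (Y := fun v _ => [v, v ∘ Equiv.swap i (i + 1)]) (fun x v u => ?_) (fun y v u => ?_)
    (fun v u c z _ => ?_) (fun v u v' u' hv _ => ?_) (fun v u v' u' _ _ _ _ => ?_)
  · simp [flow_pair_iff, sliceFlow_mark_iff, sliceFlow_cross_iff, and_comm]
  · simp +contextual [flow_pair_iff, sliceFlow_mark_iff, sliceFlow_cross_iff, and_comm]
  · cases d <;> simp +contextual [HasMarkStrength, Slice.HasMarkStrength]
  · simp [FlowDisjoint, ← Pi.mul_comp, hv]
  · simp [flowForm, sliceForm]

theorem flowEquivalent_mark_cap (c : Label) (d : Bool) (i : ℕ) :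
    FlowEquivalent [cap i, mark c d i] [cap i, mark c (!d) (i + 1)] := by
  refine .of_solutions (P := fun v u => u i + u (i + 1) = 0 ∧ v = u ∘ skipTwo i)
    (X := fun v u => [v, u]) (Y := fun v u => [v, u]) (fun x v u => ?_) (fun y v u => ?_)
    (fun v u c z h => ?_) (fun v u v' u' hv hu => ?_) (fun v u v' u' _ _ _ _ => ?_)
  · simp [flow_pair_iff, sliceFlow_mark_iff, sliceFlow_cap_iff, and_comm]
  · simp [flow_pair_iff, sliceFlow_mark_iff, sliceFlow_cap_iff, and_comm]
  · have hi : u (i + 1) = -u i := by linear_combination h.1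
    cases d <;> simp +contextual [HasMarkStrength, Slice.HasMarkStrength, hi]
  · simp [FlowDisjoint, hv, hu]
  · simp [flowForm, sliceForm]

theorem flowEquivalent_mark_cup (c : Label) (d : Bool) (i : ℕ) :
    FlowEquivalent [mark c d i, cup i] [mark c (!d) (i + 1), cup i] := by
  refine .of_solutions (P := fun v u => v i + v (i + 1) = 0 ∧ u = v ∘ skipTwo i)
    (X := fun v _ => [v, v]) (Y := fun v _ => [v, v]) (fun x v u => ?_) (fun y v u => ?_)
    (fun v u c z h => ?_) (fun v u v' u' hv _ => ?_) (fun v u v' u' _ _ _ _ => ?_)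
  · simp [flow_pair_iff, sliceFlow_mark_iff, sliceFlow_cup_iff, and_comm]
  · simp [flow_pair_iff, sliceFlow_mark_iff, sliceFlow_cup_iff, and_comm]
  · have hi : v (i + 1) = -v i := by linear_combination h.1
    cases d <;> simp +contextual [HasMarkStrength, Slice.HasMarkStrength, hi]
  · simp [FlowDisjoint, hv]
  · simp [flowForm, sliceForm]

theorem Slice.Joins.congr {s : Slice} (hv : ∀ j < s.inputs, v j = v' j)
    (hu : ∀ j < s.outputs, u j = u' j) : s.Joins v u ↔ s.Joins v' u' := by
  cases s <;> simp_all [Joins, inputs, outputs]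

theorem sliceFlow_at'_iff {s : Slice} {i : ℕ} : SliceFlow (s.at' i) v u ↔
    (∀ j < i, v j = u j) ∧ s.Joins (fun j => v (i + j)) (fun j => u (i + j)) ∧
      ∀ j, v (i + s.inputs + j) = u (i + s.outputs + j) := by
  cases s <;> exact ⟨fun ⟨h₁, h₂, h₃⟩ => ⟨h₁, h₂, h₃⟩, fun ⟨h₁, h₂, h₃⟩ => ⟨h₁, h₂, h₃⟩⟩

/-- The boundary values of the flows on two slices side by side, separated by `i` strands on the
left and by `d` strands in between. -/
structure SideBySideFlow (a b : Slice) (i d : ℕ) (v u : ℕ → ℤ) : Prop where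
  left : ∀ j < i, v j = u j
  joins_left : a.Joins (fun j => v (i + j)) fun j => u (i + j)
  middle : ∀ j < d, v (i + a.inputs + j) = u (i + a.outputs + j)
  joins_right : b.Joins (fun j => v (i + a.inputs + d + j)) fun j => u (i + a.outputs + d + j)
  right : ∀ j, v (i + a.inputs + d + b.inputs + j) = u (i + a.outputs + d + b.outputs + j)

/-- The strengths at a height that looks like the upper boundary, with the values `v`, on its first
`k` strands, and from there on like the lower boundary, with the values `u`, from strand `l` on. -/
def splice (k l : ℕ) (v u : ℕ → ℤ) (j : ℕ) : ℤ := if j < k then v j else u (l + (j - k))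

theorem splice_of_lt {k l j : ℕ} (h : j < k) : splice k l v u j = v j := if_pos h

theorem splice_add (k l j : ℕ) : splice k l v u (k + j) = u (l + j) := by
  simp [splice]

theorem eq_splice_iff {k l : ℕ} {m : ℕ → ℤ} :
    m = splice k l v u ↔ (∀ j < k, m j = v j) ∧ ∀ j, m (k + j) = u (l + j) := by
  constructor
  · rintro rfl
    exact ⟨fun _ h => splice_of_lt h, splice_add k l⟩
  · rintro ⟨hv, hu⟩
    funext j
    rcases lt_or_ge j k with h | h
    · rw [hv j h, splice_of_lt h]
    · obtain ⟨j, rfl⟩ := Nat.exists_eq_add_of_le h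
      rw [hu, splice_add]

theorem splice_mul_splice (k l : ℕ) (hv : v * v' = 0) (hu : u * u' = 0) :
    splice k l v u * splice k l v' u' = 0 := by
  funext j
  rcases lt_or_ge j k with h | h
  · simpa [splice_of_lt h] using congrFun hv j
  · obtain ⟨j, rfl⟩ := Nat.exists_eq_add_of_le h
    simpa [splice_add] using congrFun hu (l + j)

theorem flow_right_left_iff {a b : Slice} {i d : ℕ} :
    Flow [b.at' (i + a.inputs + d), a.at' i] x v u ↔ SideBySideFlow a b i d v u ∧
      x = [v, splice (i + a.inputs) (i + a.outputs) v u] := by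
  simp only [flow_pair_iff, sliceFlow_at'_iff]
  constructor
  · rintro ⟨m, rfl, ⟨hvm, hb, hvm'⟩, hmu, ha, hmu'⟩
    have hm : m = splice (i + a.inputs) (i + a.outputs) v u :=
      eq_splice_iff.2 ⟨fun j hj => (hvm j (by lia)).symm, hmu'⟩
    refine ⟨⟨?_, ?_, ?_, ?_, ?_⟩, by rw [hm]⟩
    · exact fun j hj => (hvm j (by lia)).trans (hmu j hj)
    · exact (Joins.congr (fun j _ => hvm (i + j) (by lia)) fun _ _ => rfl).2 ha
    · exact fun j hj => (hvm _ (by lia)).trans (hmu' j)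
    · refine (Joins.congr (fun _ _ => rfl) fun j _ => ?_).1 hb
      simpa only [add_assoc] using hmu' (d + j)
    · intro j
      refine (hvm' j).trans ?_
      simpa only [add_assoc] using hmu' (d + b.outputs + j)
  · rintro ⟨⟨hl, ha, hm, hb, hr⟩, rfl⟩
    refine ⟨_, rfl, ⟨?_, ?_, ?_⟩, ?_, ?_, ?_⟩
    · intro j hj
      have := hm (j - (i + a.inputs))
      grind [splice]
    · refine (Joins.congr (fun _ _ => rfl) fun j _ => ?_).1 hb
      grind [splice]
    · grind [splice]
    · grind [splice]
    · refine (Joins.congr (fun j hj => ?_) fun _ _ => rfl).1 ha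
      grind [splice]
    · exact splice_add _ _

theorem flow_left_right_iff {a b : Slice} {i d : ℕ} :
    Flow [a.at' i, b.at' (i + a.outputs + d)] x v u ↔ SideBySideFlow a b i d v u ∧
      x = [v, splice (i + a.outputs) (i + a.inputs) u v] := by
  simp only [flow_pair_iff, sliceFlow_at'_iff]
  constructor
  · rintro ⟨m, rfl, ⟨hvm, ha, hvm'⟩, hmu, hb, hmu'⟩
    have hm : m = splice (i + a.outputs) (i + a.inputs) u v :=
      eq_splice_iff.2 ⟨fun j hj => hmu j (by lia), fun j => (hvm' j).symm⟩
    refine ⟨⟨?_, ?_, ?_, ?_, ?_⟩, by rw [hm]⟩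
    · exact fun j hj => (hvm j hj).trans (hmu j (by lia))
    · exact (Joins.congr (fun _ _ => rfl) fun j _ => hmu (i + j) (by lia)).1 ha
    · exact fun j hj => (hvm' j).trans (hmu _ (by lia))
    · refine (Joins.congr (fun j _ => ?_) fun _ _ => rfl).2 hb
      simpa only [add_assoc] using hvm' (d + j)
    · intro j
      refine .trans ?_ (hmu' j)
      simpa only [add_assoc] using hvm' (d + b.inputs + j)
  · rintro ⟨⟨hl, ha, hm, hb, hr⟩, rfl⟩
    refine ⟨_, rfl, ⟨?_, ?_, ?_⟩, ?_, ?_, ?_⟩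
    · grind [splice]
    · refine (Joins.congr (fun _ _ => rfl) fun j hj => ?_).1 ha
      grind [splice]
    · exact fun j => (splice_add _ _ j).symm
    · intro j hj
      have := hm (j - (i + a.outputs))
      grind [splice]
    · refine (Joins.congr (fun j _ => ?_) fun _ _ => rfl).1 hb
      grind [splice]
    · grind [splice]

theorem Slice.HasMarkStrength.at'_congr {s : Slice} {i i' : ℕ}
    (h : ∀ j < s.inputs, v (i + j) = v' (i' + j)) :
    (s.at' i).HasMarkStrength v c z ↔ (s.at' i').HasMarkStrength v' c z := by
  cases s <;> simp_all [Slice.HasMarkStrength, at', inputs]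

theorem sliceForm_at'_congr {s : Slice} {i i' : ℕ} (h : ∀ j < s.inputs, v (i + j) = v' (i' + j))
    (h' : ∀ j < s.inputs, u (i + j) = u' (i' + j)) :
    sliceForm (s.at' i) v u = sliceForm (s.at' i') v' u' := by
  cases s with
  | cross b _ =>
      have hv : v i = v' i' := h 0 two_pos
      have hu : u i = u' i' := h' 0 two_pos
      simp only [sliceForm, at', hv, hu, h 1 one_lt_two, h' 1 one_lt_two]
  | _ => rfl

theorem flowEquivalent_exchange (a b : Slice) (i d : ℕ) :
    FlowEquivalent [b.at' (i + a.inputs + d), a.at' i] [a.at' i, b.at' (i + a.outputs + d)] := by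
  have left v u : ∀ j < a.inputs,
      splice (i + a.inputs) (i + a.outputs) v u (i + j) = v (i + j) :=
    fun j hj => splice_of_lt (by lia)
  have right v u : ∀ j < b.inputs,
      splice (i + a.outputs) (i + a.inputs) u v (i + a.outputs + d + j) =
        v (i + a.inputs + d + j) :=
    fun j _ => by simpa only [add_assoc] using splice_add (i + a.outputs) (i + a.inputs) (d + j)
  refine .of_solutions (fun _ _ _ => flow_right_left_iff) (fun _ _ _ => flow_left_right_iff)
    (fun v u c z _ => ?_) (fun v u v' u' hv hu => ?_) (fun v u v' u' _ _ _ _ => ?_)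
  · have ha := HasMarkStrength.at'_congr (c := c) (z := z) (left v u)
    have hb := HasMarkStrength.at'_congr (c := c) (z := z) (right v u)
    simp [HasMarkStrength, ha, hb, and_comm]
  · simp [FlowDisjoint, hv, hu, splice_mul_splice]
  · have ha := sliceForm_at'_congr (left v u) (left v' u')
    have hb := sliceForm_at'_congr (right v u) (right v' u')
    simp [flowForm, ha, hb, add_comm (sliceForm (b.at' _) _ _)]

theorem Move.flowEquivalent (h : Move a b) : FlowEquivalent a b := by
  cases h with
  | exchange a b i d => exact flowEquivalent_exchange a b i d
  | zigzag_left i => exact flowEquivalent_zigzag_left i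
  | zigzag_right i => exact flowEquivalent_zigzag_right i
  | cap_slide b i => exact flowEquivalent_cap_slide b i
  | cup_slide b i => exact flowEquivalent_cup_slide b i
  | reidemeister_one_cap b i => exact flowEquivalent_reidemeister_one_cap b i
  | reidemeister_one_cup b i => exact flowEquivalent_reidemeister_one_cup b i
  | reidemeister_two b i => exact flowEquivalent_reidemeister_two b i
  | reidemeister_three b i => exact flowEquivalent_reidemeister_three b i
  | mark_cross_left c d b i => exact flowEquivalent_mark_cross_left c d b i
  | mark_cross_right c d b i => exact flowEquivalent_mark_cross_right c d b i
  | mark_cap c d i => exact flowEquivalent_mark_cap c d i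
  | mark_cup c d i => exact flowEquivalent_mark_cup c d i

/-! ### Travelling along the components -/

/-- The number of strands of a diagram with `k` upper endpoints just above the slice number `t`. -/
def strands : Diagram → ℕ → ℕ → ℕ
  | _, k, 0 => k
  | [], k, _ + 1 => k
  | s :: w, k, t + 1 => strands w (k - s.inputs + s.outputs) t

theorem strands_of_getElem? {w : Diagram} {k m t : ℕ} {s : Slice} (h : IsTangle w k m)
    (hs : w[t]? = some s) : s.pos + s.inputs ≤ strands w k t ∧
      strands w k (t + 1) = strands w k t - s.inputs + s.outputs := by
  induction w generalizing k t with
  | nil => simp at hs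
  | cons s' w ih =>
      rw [isTangle_cons_iff] at h
      cases t with
      | zero =>
          obtain rfl : s' = s := by simpa using hs
          cases w <;> simp [strands, h.1]
      | succ t => exact ih h.2 (by simpa using hs)

theorem strands_of_length_le {w : Diagram} {k m t : ℕ} (h : IsTangle w k m) (ht : w.length ≤ t) :
    strands w k t = m := by
  induction w generalizing k t with
  | nil => cases t <;> exact isTangle_nil_iff.1 h
  | cons s w ih =>
      cases t with
      | zero => simp at ht
      | succ t => exact ih (isTangle_cons_iff.1 h).2 (by simpa using ht)

/-- The point lies on a strand of the link diagram `w`. -/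
def Inside (w : Diagram) (p : DirectedPoint) : Prop := p.strand < strands w 0 p.level

/-- The same point with the opposite direction. -/
def DirectedPoint.rev (p : DirectedPoint) : DirectedPoint := ⟨p.level, p.strand, !p.down⟩

theorem DirectedPoint.rev_rev (p : DirectedPoint) : p.rev.rev = p := by simp [rev]

theorem DirectedPoint.rev_ne (p : DirectedPoint) : p.rev ≠ p := by
  obtain ⟨t, i, d⟩ := p
  simp [rev]

section Next

variable {w : Diagram} {p q : DirectedPoint} {t i : ℕ} {d : Bool} {s : Slice}

theorem inside_rev : Inside w p.rev ↔ Inside w p := Iff.rfl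

theorem Inside.exists_below (h : IsTangle w 0 0) (hp : Inside w p) : ∃ s, w[p.level]? = some s := by
  by_contra hs
  have ht : w.length ≤ p.level := List.getElem?_eq_none_iff.1 (by
    simpa [← Option.eq_none_iff_forall_ne_some] using hs)
  exact absurd hp (by simp [Inside, strands_of_length_le h ht])

theorem Inside.exists_above (h : IsTangle w 0 0) (hp : Inside w ⟨t, i, d⟩) :
    ∃ t' s, t = t' + 1 ∧ w[t']? = some s := by
  cases t with
  | zero => cases w <;> simp [Inside, strands] at hp
  | succ t =>
      obtain ⟨s, hs⟩ := hp.exists_below h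
      have ht := (List.getElem?_eq_some_iff.1 hs).1
      exact ⟨t, w[t], rfl, List.getElem?_eq_getElem (by simp only at ht; omega)⟩

theorem next_down_left (hs : w[t]? = some s) {j : ℕ} (hj : j < s.pos) :
    next w ⟨t, j, true⟩ = ⟨t + 1, j, true⟩ := by
  cases s <;> simp only [Slice.pos] at hj <;> simp only [next, hs] <;> grind

theorem next_up_left (hs : w[t]? = some s) {j : ℕ} (hj : j < s.pos) :
    next w ⟨t + 1, j, false⟩ = ⟨t, j, false⟩ := by
  cases s <;> simp only [Slice.pos] at hj <;> simp only [next, hs] <;> grind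

theorem next_down_right (hs : w[t]? = some s) (j : ℕ) :
    next w ⟨t, s.pos + s.inputs + j, true⟩ = ⟨t + 1, s.pos + s.outputs + j, true⟩ := by
  cases s <;> simp only [Slice.pos, Slice.inputs, Slice.outputs, next, hs] <;> grind

theorem next_up_right (hs : w[t]? = some s) (j : ℕ) :
    next w ⟨t + 1, s.pos + s.outputs + j, false⟩ = ⟨t, s.pos + s.inputs + j, false⟩ := by
  cases s <;> simp only [Slice.pos, Slice.inputs, Slice.outputs, next, hs] <;> grind

theorem next_spec (h : IsTangle w 0 0) (hp : Inside w p) :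
    Inside w (next w p) ∧ next w (next w p).rev = p.rev ∧ next w p ≠ p.rev := by
  obtain ⟨t, i, d⟩ := p
  cases d with
  | true =>
      obtain ⟨s, hs⟩ := hp.exists_below h
      obtain ⟨hpos, hstrands⟩ := strands_of_getElem? h hs
      simp only [Inside] at hp hs hpos hstrands
      cases s <;> simp only [Slice.pos, Slice.inputs, Slice.outputs] at hpos hstrands <;>
        simp only [next, hs] <;> (try split_ifs) <;>
        simp [Inside, DirectedPoint.rev, hs, hstrands] <;> grind
  | false =>
      obtain ⟨t, s, rfl, hs⟩ := hp.exists_above h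
      obtain ⟨hpos, hstrands⟩ := strands_of_getElem? h hs
      simp only [Inside] at hp
      cases s <;> simp only [Slice.pos, Slice.inputs, Slice.outputs] at hpos hstrands <;>
        simp only [next, hs] <;> (try split_ifs) <;>
        simp [Inside, DirectedPoint.rev, hs, hstrands] <;> grind

theorem next_injOn (h : IsTangle w 0 0) : Set.InjOn (next w) {p | Inside w p} := by
  intro p hp q hq e
  rw [← p.rev_rev, ← (next_spec h hp).2.1, e, (next_spec h hq).2.1, q.rev_rev]

theorem mapsTo_next (h : IsTangle w 0 0) :
    Set.MapsTo (next w) {p | Inside w p} {p | Inside w p} := fun _ hp => (next_spec h hp).1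

theorem inside_iterate (h : IsTangle w 0 0) (hp : Inside w p) (k : ℕ) :
    Inside w ((next w)^[k] p) :=
  (mapsTo_next h).iterate k hp

theorem iterate_injOn (h : IsTangle w 0 0) (k : ℕ) : Set.InjOn (next w)^[k] {p | Inside w p} :=
  (next_injOn h).iterate (mapsTo_next h) k

theorem iterate_rev (h : IsTangle w 0 0) (hp : Inside w p) (k : ℕ) :
    (next w)^[k] ((next w)^[k] p).rev = p.rev := by
  induction k with
  | zero => rfl
  | succ k ih =>
      rw [Function.iterate_succ_apply, Function.iterate_succ_apply',
        (next_spec h (inside_iterate h hp k)).2.1, ih]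

theorem finite_inside (h : IsTangle w 0 0) : {p | Inside w p}.Finite := by
  let width := (Finset.range w.length).sup (strands w 0)
  refine ((((Set.finite_Iio w.length).prod (Set.finite_Iio width)).prod
    (Set.finite_univ (α := Bool))).image fun x => ⟨x.1.1, x.1.2, x.2⟩).subset ?_
  rintro ⟨t, i, d⟩ hp
  obtain ⟨s, hs⟩ := Inside.exists_below h hp
  have ht : t < w.length := (List.getElem?_eq_some_iff.1 hs).1
  refine ⟨⟨⟨t, i⟩, d⟩, ⟨⟨ht, Set.mem_Iio.2 (lt_of_lt_of_le hp ?_)⟩, trivial⟩, rfl⟩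
  exact Finset.le_sup (f := strands w 0) (Finset.mem_range.2 ht)

theorem mem_periodicPts_next (h : IsTangle w 0 0) (hp : Inside w p) :
    p ∈ Function.periodicPts (next w) := by
  have := (finite_inside h).to_subtype
  have hinj := (mapsTo_next h).restrict_inj.2 (next_injOn h)
  obtain ⟨k, hk, e⟩ := hinj.mem_periodicPts ⟨p, hp⟩
  exact ⟨k, hk, ((mapsTo_next h).coe_iterate_restrict ⟨p, hp⟩ k).symm.trans (congrArg _ e)⟩

theorem iterate_ne_rev (h : IsTangle w 0 0) (hp : Inside w p) (k : ℕ) :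
    (next w)^[k] p ≠ p.rev := by
  intro e
  obtain ⟨j, rfl | rfl⟩ := Nat.even_or_odd' k
  · rw [two_mul, Function.iterate_add_apply, ← iterate_rev h hp j] at e
    have hj := inside_iterate h hp j
    exact DirectedPoint.rev_ne _ (iterate_injOn h j hj (inside_rev.2 hj) e).symm
  · rw [show 2 * j + 1 = j + (1 + j) by ring, Function.iterate_add_apply,
      Function.iterate_add_apply, Function.iterate_one, ← iterate_rev h hp j] at e
    have hj := inside_iterate h hp j
    exact (next_spec h hj).2.2
      (iterate_injOn h j (next_spec h hj).1 (inside_rev.2 hj) e)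

end Next

section Strength

variable {w : Diagram} {p : DirectedPoint} {x y : List (ℕ → ℤ)} {v u : ℕ → ℤ} {s : Slice} {t : ℕ}
  {c : Label} {z : ℤ}

theorem Flow.getD_zero (hx : Flow w x v u) : x.getD 0 u = v := by
  cases hx <;> rfl

theorem Flow.sliceFlow (hx : Flow w x v u) (hs : w[t]? = some s) :
    SliceFlow s (x.getD t u) (x.getD (t + 1) u) := by
  induction hx generalizing t with
  | nil => simp at hs
  | cons hslice hflow ih =>
      cases t with
      | zero =>
          obtain rfl := Option.some.inj hs
          rwa [List.getD_cons_succ, hflow.getD_zero]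
      | succ t => exact ih hs

theorem flow_map_range {φ : ℕ → ℕ → ℤ}
    (hφ : ∀ t s, w[t]? = some s → SliceFlow s (φ t) (φ (t + 1))) :
    Flow w ((List.range w.length).map φ) (φ 0) (φ w.length) := by
  induction w generalizing φ with
  | nil => exact .nil _
  | cons s w ih =>
      rw [List.length_cons, List.range_succ_eq_map, List.map_cons, List.map_map]
      exact .cons (hφ 0 s rfl) (ih fun t s hs => hφ (t + 1) s hs)

/-- The strength of a flow in a link diagram at a point, in the direction of the point. -/
def strength (x : List (ℕ → ℤ)) (p : DirectedPoint) : ℤ :=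
  (if p.down then 1 else -1) * x.getD p.level 0 p.strand

theorem forall_mem_zip_iff {α β : Type*} {l : List α} {l' : List β} {P : α × β → Prop} (b : β)
    (h : l.length = l'.length) :
    (∀ p ∈ l.zip l', P p) ↔ ∀ t a, l[t]? = some a → P (a, l'.getD t b) := by
  induction l generalizing l' with
  | nil => simp
  | cons a l ih =>
      obtain ⟨b', l', rfl⟩ := List.exists_cons_of_length_eq_add_one h.symm
      simp only [List.zip_cons_cons, List.forall_mem_cons, ih (Nat.succ.inj h)]
      exact ⟨fun h t a ht => by cases t <;> simp_all, fun h => ⟨h 0 a rfl, fun t => h (t + 1)⟩⟩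

theorem hasMarkStrength_iff (h : w.length = x.length) : HasMarkStrength w x c z ↔
    ∀ t i d, w[t]? = some (mark c d i) → strength x ⟨t, i, d⟩ = z := by
  rw [HasMarkStrength, forall_mem_zip_iff 0 h]
  constructor
  · intro hx t i d ht
    simpa [strength] using hx t _ ht rfl
  · rintro hx t (_ | _ | _ | ⟨c', d, i⟩) ht <;> try exact trivial
    rintro rfl
    simpa [strength] using hx t i d ht

theorem flowDisjoint_iff (h : x.length = y.length) : FlowDisjoint x y ↔
    ∀ t i, x.getD t 0 i * y.getD t 0 i = 0 := by
  rw [FlowDisjoint, forall_mem_zip_iff 0 h]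
  constructor
  · intro hx t i
    rcases ht : x[t]? with _ | a
    · simp [List.getD, ht]
    · simpa [List.getD, ht] using congrFun (hx t a ht) i
  · intro hx t a ht
    funext i
    simpa [List.getD, ht] using hx t i

theorem lt_or_exists_eq_add (a k i : ℕ) :
    i < a ∨ (∃ j < k, i = a + j) ∨ ∃ j, i = a + k + j := by
  rcases lt_or_ge i a with hi | hi
  · exact .inl hi
  rcases lt_or_ge i (a + k) with hi' | hi'
  · exact .inr (.inl ⟨i - a, by omega, by omega⟩)
  · exact .inr (.inr ⟨i - (a + k), by omega⟩)

theorem Flow.strength_next (hx : Flow w x 0 0) (h : IsTangle w 0 0) (hp : Inside w p) :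
    strength x (next w p) = strength x p := by
  obtain ⟨t, i, d⟩ := p
  cases d with
  | true =>
      obtain ⟨s, hs⟩ := hp.exists_below h
      have hslice := hx.sliceFlow hs
      rcases lt_or_exists_eq_add s.pos s.inputs i with hi | ⟨j, hj, rfl⟩ | ⟨j, rfl⟩
      · simp [next_down_left hs hi, strength, hslice.left i hi]
      · have hjoins := hslice.joins
        cases s <;> simp only [Slice.pos, Slice.inputs, Slice.Joins] at hj hjoins hs ⊢ <;>
          interval_cases j <;> simp [next, hs, strength] <;> simp at hjoins <;> omega
      · simp [next_down_right hs, strength, hslice.right]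
  | false =>
      obtain ⟨t, s, rfl, hs⟩ := hp.exists_above h
      have hslice := hx.sliceFlow hs
      rcases lt_or_exists_eq_add s.pos s.outputs i with hi | ⟨j, hj, rfl⟩ | ⟨j, rfl⟩
      · simp [next_up_left hs hi, strength, hslice.left i hi]
      · have hjoins := hslice.joins
        cases s <;> simp only [Slice.pos, Slice.outputs, Slice.Joins] at hj hjoins hs ⊢ <;>
          interval_cases j <;> simp [next, hs, strength] <;> simp at hjoins <;> omega
      · simp [next_up_right hs, strength, hslice.right]

theorem Flow.strength_iterate (hx : Flow w x 0 0) (h : IsTangle w 0 0) (hp : Inside w p) (k : ℕ) :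
    strength x ((next w)^[k] p) = strength x p := by
  induction k with
  | zero => rfl
  | succ k ih =>
      rw [Function.iterate_succ_apply', hx.strength_next h (inside_iterate h hp k), ih]

end Strength

/-- A set of directed points that is a union of components of the link diagram `w`. -/
structure IsClosedUnion (w : Diagram) (O : DirectedPoint → Prop) : Prop where
  inside : ∀ p, O p → Inside w p
  next_iff : ∀ p, Inside w p → (O (next w p) ↔ O p)

open scoped Classical in
/-- The strengths of the flow of strength `1` along a union of components. -/
noncomputable def unitFlow (O : DirectedPoint → Prop) (t i : ℕ) : ℤ :=
  (if O ⟨t, i, true⟩ then 1 else 0) - (if O ⟨t, i, false⟩ then 1 else 0)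

section Components

variable {w : Diagram} {O : DirectedPoint → Prop} {p : DirectedPoint} {c c' : Label}
  {t i j : ℕ} {d : Bool} {x : List (ℕ → ℤ)} {z : ℤ}

theorem isClosedUnion_orbit (h : IsTangle w 0 0) (hp : Inside w p) :
    IsClosedUnion w fun q => ∃ k, (next w)^[k] p = q where
  inside := by
    rintro _ ⟨k, rfl⟩
    exact inside_iterate h hp k
  next_iff q hq := by
    constructor
    · rintro ⟨k, hk⟩
      obtain ⟨_ | n, hn, hperiod⟩ := mem_periodicPts_next h hq
      · exact absurd hn (lt_irrefl 0)
      · exact ⟨n + k, by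
          rw [Function.iterate_add_apply, hk, ← Function.iterate_succ_apply, hperiod.eq]⟩
    · rintro ⟨k, rfl⟩
      exact ⟨k + 1, Function.iterate_succ_apply' _ _ _⟩

theorem inside_of_mark (h : IsTangle w 0 0) {d' : Bool} (ht : w[t]? = some (mark c d i)) :
    Inside w ⟨t, i, d'⟩ :=
  (strands_of_getElem? h ht).1

theorem isClosedUnion_onComponent (h : IsTangle w 0 0) (c : Label) :
    IsClosedUnion w (OnComponent w c) where
  inside := by
    rintro p ⟨t, i, d, ht, hk⟩
    exact (isClosedUnion_orbit h (inside_of_mark h ht)).inside p hk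
  next_iff p hp := by
    have orbit_iff {t i d} (ht : w[t]? = some (mark c d i)) :=
      (isClosedUnion_orbit h (inside_of_mark (d' := d) h ht)).next_iff p hp
    exact ⟨fun ⟨t, i, d, ht, hk⟩ => ⟨t, i, d, ht, (orbit_iff ht).1 hk⟩,
      fun ⟨t, i, d, ht, hk⟩ => ⟨t, i, d, ht, (orbit_iff ht).2 hk⟩⟩

theorem IsClosedUnion.unitFlow_eq_zero (hO : IsClosedUnion w O) (hi : strands w 0 t ≤ i) :
    unitFlow O t i = 0 := by
  have hout (d : Bool) : ¬ O ⟨t, i, d⟩ := fun ho => absurd (hO.inside _ ho) (not_lt.2 hi)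
  simp [unitFlow, hout]

theorem IsClosedUnion.unitFlow_eq {t' i' : ℕ} (hO : IsClosedUnion w O) (hi : i < strands w 0 t)
    (hi' : i' < strands w 0 t') (hdown : next w ⟨t, i, true⟩ = ⟨t', i', true⟩)
    (hup : next w ⟨t', i', false⟩ = ⟨t, i, false⟩) : unitFlow O t i = unitFlow O t' i' := by
  rw [unitFlow, unitFlow, ← hdown, ← hup, propext (hO.next_iff ⟨t, i, true⟩ hi),
    propext (hO.next_iff ⟨t', i', false⟩ hi')]

theorem IsClosedUnion.unitFlow_add_eq_zero {i' : ℕ} (hO : IsClosedUnion w O)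
    (hi : i < strands w 0 t) (hi' : i' < strands w 0 t) (hturn : next w ⟨t, i, d⟩ = ⟨t, i', !d⟩)
    (hturn' : next w ⟨t, i', d⟩ = ⟨t, i, !d⟩) : unitFlow O t i + unitFlow O t i' = 0 := by
  have h := hO.next_iff ⟨t, i, d⟩ hi
  have h' := hO.next_iff ⟨t, i', d⟩ hi'
  rw [hturn] at h
  rw [hturn'] at h'
  cases d <;> simp only [Bool.not_true, Bool.not_false] at h h' <;>
    rw [unitFlow, unitFlow, propext h, propext h'] <;> ring

theorem IsClosedUnion.sliceFlow (hO : IsClosedUnion w O) (h : IsTangle w 0 0) {s : Slice}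
    (hs : w[t]? = some s) : SliceFlow s (unitFlow O t) (unitFlow O (t + 1)) := by
  obtain ⟨hpos, hstrands⟩ := strands_of_getElem? h hs
  refine ⟨fun j hj => ?_, ?_, fun j => ?_⟩
  · exact hO.unitFlow_eq (by omega) (by omega) (next_down_left hs hj) (next_up_left hs hj)
  · cases s <;>
      simp only [Slice.pos, Slice.inputs, Slice.outputs, Slice.Joins, add_zero] at hpos hstrands ⊢
    case cap j =>
      exact hO.unitFlow_add_eq_zero (d := false) (by omega) (by omega) (by simp [next, hs])
        (by simp [next, hs])
    case cup j =>
      exact hO.unitFlow_add_eq_zero (d := true) (by omega) (by omega) (by simp [next, hs])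
        (by simp [next, hs])
    case cross b j =>
      exact ⟨(hO.unitFlow_eq (by omega) (by omega) (by simp [next, hs]) (by simp [next, hs])).symm,
        (hO.unitFlow_eq (by omega) (by omega) (by simp [next, hs]) (by simp [next, hs])).symm⟩
    case mark c d j =>
      exact (hO.unitFlow_eq (by omega) (by omega) (by simp [next, hs]) (by simp [next, hs])).symm
  · by_cases hj : s.pos + s.inputs + j < strands w 0 t
    · exact hO.unitFlow_eq hj (by omega) (next_down_right hs j) (next_up_right hs j)
    · rw [hO.unitFlow_eq_zero (by omega), hO.unitFlow_eq_zero (by omega)]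

theorem IsClosedUnion.flow (hO : IsClosedUnion w O) (h : IsTangle w 0 0) :
    Flow w ((List.range w.length).map (unitFlow O)) 0 0 := by
  have hflow := flow_map_range (φ := unitFlow O) fun t s hs => hO.sliceFlow h hs
  have htop : unitFlow O 0 = 0 := funext fun i =>
    hO.unitFlow_eq_zero (by cases w <;> simp [strands])
  have hbottom : unitFlow O w.length = 0 := funext fun i =>
    hO.unitFlow_eq_zero (by simp [strands_of_length_le h le_rfl])
  rwa [htop, hbottom] at hflow

/-- The flow of strength `1` along the component marked by `c`. -/
noncomputable def directions (w : Diagram) (c : Label) : List (ℕ → ℤ) :=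
  (List.range w.length).map (direction w c)

theorem length_directions : (directions w c).length = w.length := by simp [directions]

theorem flow_directions (h : IsTangle w 0 0) (c : Label) : Flow w (directions w c) 0 0 :=
  (isClosedUnion_onComponent h c).flow h

theorem direction_eq_zero_of_length_le (h : IsTangle w 0 0) (ht : w.length ≤ t) :
    direction w c t i = 0 :=
  (isClosedUnion_onComponent h c).unitFlow_eq_zero (by simp [strands_of_length_le h ht])

theorem directions_getD (h : IsTangle w 0 0) (t i : ℕ) :
    (directions w c).getD t 0 i = direction w c t i := by
  rcases lt_or_ge t w.length with ht | ht
  · simp [directions, ht]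
  · simp [directions, ht, direction_eq_zero_of_length_le h ht]

theorem Flow.strength_of_onComponent (hx : Flow w x 0 0) (h : IsTangle w 0 0)
    (hz : HasMarkStrength w x c z) (hp : OnComponent w c p) : strength x p = z := by
  obtain ⟨t, i, d, ht, k, rfl⟩ := hp
  rw [hx.strength_iterate h (inside_of_mark h ht), (hasMarkStrength_iff hx.length_eq).1 hz t i d ht]

theorem Flow.not_onComponent (hx : Flow w x 0 0) (h : IsTangle w 0 0)
    (hc : HasMarkStrength w x c 1) (hc' : HasMarkStrength w x c' 0) {d' : Bool}
    (hp : OnComponent w c ⟨t, i, d⟩) : ¬ OnComponent w c' ⟨t, i, d'⟩ := by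
  intro hp'
  have e := hx.strength_of_onComponent h hc hp
  have e' := hx.strength_of_onComponent h hc' hp'
  cases d <;> cases d' <;> simp [strength] at e e' <;> omega

theorem Flow.hasMarkStrength_directions (hx : Flow w x 0 0) (h : IsTangle w 0 0)
    (hc : HasMarkStrength w x c 1) : HasMarkStrength w (directions w c) c 1 := by
  refine (hasMarkStrength_iff length_directions.symm).2 fun t i d ht => ?_
  have hon : OnComponent w c ⟨t, i, d⟩ := ⟨t, i, d, ht, 0, rfl⟩
  have hoff : ¬ OnComponent w c ⟨t, i, !d⟩ := fun hp => by
    have e := hx.strength_of_onComponent h hc hon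
    have e' := hx.strength_of_onComponent h hc hp
    cases d <;> simp [strength] at e e' <;> omega
  rw [strength, directions_getD h]
  cases d <;> simp_all [direction]

theorem flowForm_map_range (φ ψ : ℕ → ℕ → ℤ) :
    flowForm w ((List.range w.length).map φ) ((List.range w.length).map ψ) =
      ∑ t ∈ Finset.range w.length, w[t]?.elim 0 fun s => sliceForm s (φ t) (ψ t) := by
  induction w generalizing φ ψ with
  | nil => rfl
  | cons s w ih =>
      rw [List.length_cons, Finset.sum_range_succ', List.range_succ_eq_map, List.map_cons,
        List.map_map, List.map_cons, List.map_map, add_comm]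
      exact congrArg (sliceForm s (φ 0) (ψ 0) + ·) (ih (φ ∘ Nat.succ) (ψ ∘ Nat.succ))

theorem linkingNumber_eq_flowForm (w : Diagram) (c c' : Label) :
    linkingNumber w c c' = (flowForm w (directions w c) (directions w c') : ℚ) / 2 := by
  rw [linkingNumber, directions, directions, flowForm_map_range]
  congr! 3 with t
  rw [crossingSign]
  rcases w[t]? with _ | _ | _ | _ | _ <;> rfl

end Components

/-! ### Invariance of linking numbers -/

/-- The diagram contains a mark `c`. -/
def IsMarked (w : Diagram) (c : Label) : Prop := ∃ d i, mark c d i ∈ w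

/-- The flow of strength `1` along the components marked by `c`. It is characterized by flows only,
so that the moves can be checked locally: off these components it vanishes, because it is disjoint
from every flow that vanishes at the marks `c`. -/
structure IsComponentFlow (w : Diagram) (c : Label) (x : List (ℕ → ℤ)) : Prop where
  flow : Flow w x 0 0
  hasMarkStrength : HasMarkStrength w x c 1
  flowDisjoint : ∀ y, Flow w y 0 0 → HasMarkStrength w y c 0 → FlowDisjoint x y

/-- The components marked by `c` and `c'` exist and are separated by a flow, and the crossing form
of their unit flows, that is twice their linking number, is `q`. -/
structure HasCrossingForm (w : Diagram) (c c' : Label) (q : ℤ) : Prop where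
  isMarked_left : IsMarked w c
  isMarked_right : IsMarked w c'
  exists_flows : ∃ x x', IsComponentFlow w c x ∧ IsComponentFlow w c' x' ∧
    HasMarkStrength w x c' 0 ∧ flowForm w x x' = q

/-- The flow `y` on `p ++ b ++ s` coincides outside `b` with the flow `x` on `p ++ a ++ s`. -/
inductive IsReplacement (p a b s : Diagram) : List (ℕ → ℤ) → List (ℕ → ℤ) → Prop
  | intro {xp xa xb xs : List (ℕ → ℤ)} {v u : ℕ → ℤ} (hp : Flow p xp 0 v) (ha : Flow a xa v u)
      (hb : Flow b xb v u) (hs : Flow s xs u 0) :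
      IsReplacement p a b s (xp ++ xa ++ xs) (xp ++ xb ++ xs)

section Invariance

variable {p a b s w w' : Diagram} {c c' : Label} {x x' y y' : List (ℕ → ℤ)} {q z : ℤ}

theorem isMarked_append_iff : IsMarked (a ++ b) c ↔ IsMarked a c ∨ IsMarked b c := by
  simp only [IsMarked, List.mem_append, exists_or]

theorem Slice.exists_eq_mark_at'_iff {s : Slice} {i : ℕ} :
    (∃ d j, mark c d j = s.at' i) ↔ ∃ d j, mark c d j = s := by
  cases s <;> simp [Slice.at']

theorem Move.isMarked_iff (h : Move a b) : IsMarked a c ↔ IsMarked b c := by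
  cases h
  case exchange a b i d =>
    simp only [IsMarked, List.mem_pair, exists_or, Slice.exists_eq_mark_at'_iff, or_comm]
  all_goals simp [IsMarked]

theorem FlowDisjoint.symm (h : FlowDisjoint x y) (hl : x.length = y.length) : FlowDisjoint y x :=
  (flowDisjoint_iff hl.symm).2 fun t i => by rw [mul_comm]; exact (flowDisjoint_iff hl).1 h t i

theorem IsReplacement.symm (h : IsReplacement p a b s x y) : IsReplacement p b a s y x := by
  obtain ⟨hp, ha, hb, hs⟩ := h
  exact .intro hp hb ha hs

theorem IsReplacement.flow (h : IsReplacement p a b s x y) : Flow (p ++ b ++ s) y 0 0 := by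
  obtain ⟨hp, -, hb, hs⟩ := h
  exact (hp.append hb).append hs

theorem FlowEquivalent.exists_isReplacement (h : FlowEquivalent a b)
    (hx : Flow (p ++ a ++ s) x 0 0) : ∃ y, IsReplacement p a b s x y := by
  obtain ⟨u, _, xs, rfl, hpa, hs⟩ := flow_append_iff.1 hx
  obtain ⟨v, xp, xa, rfl, hp, ha⟩ := flow_append_iff.1 hpa
  obtain ⟨xb, hb⟩ := (h.exists_flow_iff v u).1 ⟨xa, ha⟩
  exact ⟨_, .intro hp ha hb hs⟩

theorem FlowEquivalent.hasMarkStrength_replacement (h : FlowEquivalent a b)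
    (hx : IsReplacement p a b s x y) (hz : HasMarkStrength (p ++ a ++ s) x c z) :
    HasMarkStrength (p ++ b ++ s) y c z := by
  obtain ⟨hp, ha, hb, hs⟩ := hx
  rw [hasMarkStrength_append_iff (hp.append ha).length_eq,
    hasMarkStrength_append_iff hp.length_eq, h.hasMarkStrength_iff ha hb] at hz
  rwa [hasMarkStrength_append_iff (hp.append hb).length_eq,
    hasMarkStrength_append_iff hp.length_eq]

theorem FlowEquivalent.replacement (h : FlowEquivalent a b) (hx : IsReplacement p a b s x y)
    (hx' : IsReplacement p a b s x' y') (hd : FlowDisjoint x x') :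
    FlowDisjoint y y' ∧ flowForm (p ++ b ++ s) y y' = flowForm (p ++ a ++ s) x x' := by
  obtain ⟨hp, ha, hb, hs⟩ := hx
  obtain ⟨hp', ha', hb', hs'⟩ := hx'
  have lp := hp.length_eq.symm.trans hp'.length_eq
  have la := (hp.append ha).length_eq.symm.trans (hp'.append ha').length_eq
  have lb := (hp.append hb).length_eq.symm.trans (hp'.append hb').length_eq
  obtain ⟨hd, hds⟩ := (flowDisjoint_append_iff la).1 hd
  obtain ⟨hdp, hda⟩ := (flowDisjoint_append_iff lp).1 hd
  have hu := hs.mul_eq_zero_of_flowDisjoint hs' hds (mul_zero 0)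
  have hv := ha.mul_eq_zero_of_flowDisjoint ha' hda hu
  constructor
  · exact (flowDisjoint_append_iff lb).2
      ⟨(flowDisjoint_append_iff lp).2 ⟨hdp, h.flowDisjoint_right hb hb' hv hu⟩, hds⟩
  · rw [flowForm_append (hp.append hb).length_eq lb, flowForm_append hp.length_eq lp,
      flowForm_append (hp.append ha).length_eq la, flowForm_append hp.length_eq lp,
      h.flowForm_eq ha ha' hb hb' hv hu]

theorem IsComponentFlow.replacement (hx : IsComponentFlow (p ++ a ++ s) c x)
    (h : FlowEquivalent a b) (hxy : IsReplacement p a b s x y) :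
    IsComponentFlow (p ++ b ++ s) c y where
  flow := hxy.flow
  hasMarkStrength := h.hasMarkStrength_replacement hxy hx.hasMarkStrength
  flowDisjoint y' hy' hz := by
    obtain ⟨x', hyx'⟩ := h.symm.exists_isReplacement hy'
    exact (h.replacement hxy hyx'.symm <| hx.flowDisjoint x' hyx'.flow <|
      h.symm.hasMarkStrength_replacement hyx' hz).1

theorem HasCrossingForm.replacement (hw : HasCrossingForm (p ++ a ++ s) c c' q)
    (h : FlowEquivalent a b) (hmark : ∀ c, IsMarked a c ↔ IsMarked b c) :
    HasCrossingForm (p ++ b ++ s) c c' q := by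
  obtain ⟨hc, hc', x, x', hx, hx', hz, rfl⟩ := hw
  simp only [isMarked_append_iff, hmark] at hc hc'
  obtain ⟨y, hxy⟩ := h.exists_isReplacement hx.flow
  obtain ⟨y', hxy'⟩ := h.exists_isReplacement hx'.flow
  have hd := (hx'.flowDisjoint x hx.flow hz).symm
    (hx'.flow.length_eq.symm.trans hx.flow.length_eq)
  refine ⟨by simpa only [isMarked_append_iff], by simpa only [isMarked_append_iff], y, y',
    hx.replacement h hxy, hx'.replacement h hxy', h.hasMarkStrength_replacement hxy hz, ?_⟩
  exact (h.replacement hxy hxy' hd).2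

theorem Step.hasCrossingForm_iff {k m : ℕ} (h : Step k m w w') :
    HasCrossingForm w c c' q ↔ HasCrossingForm w' c c' q := by
  obtain ⟨-, -, p, a, b, s, rfl, rfl, hab⟩ := h
  exact ⟨fun hw => hw.replacement hab.flowEquivalent fun _ => hab.isMarked_iff,
    fun hw => hw.replacement hab.flowEquivalent.symm fun _ => hab.isMarked_iff.symm⟩

theorem LinkIsotopic.hasCrossingForm_iff (h : LinkIsotopic w w') :
    HasCrossingForm w c c' q ↔ HasCrossingForm w' c c' q := by
  obtain ⟨-, -, h⟩ := h
  induction h with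
  | rel _ _ h => exact h.hasCrossingForm_iff
  | refl _ => exact Iff.rfl
  | symm _ _ _ ih => exact ih.symm
  | trans _ _ _ _ _ ih ih' => exact ih.trans ih'

/-! ### Crossing forms and linking numbers -/

theorem Slice.Joins.sub {s : Slice} {v v' u u' : ℕ → ℤ} (h : s.Joins v u) (h' : s.Joins v' u') :
    s.Joins (v - v') (u - u') := by
  cases s <;> simp only [Slice.Joins, Pi.sub_apply] at * <;> grind

theorem Flow.sub {v v' u u' : ℕ → ℤ} (h : Flow w x v u) (h' : Flow w x' v' u') :
    Flow w (List.zipWith (· - ·) x x') (v - v') (u - u') := by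
  induction h generalizing x' v' with
  | nil => cases h'; exact .nil _
  | cons hs _ ih =>
      obtain _ | ⟨hs', hw'⟩ := h'
      refine .cons ⟨fun j hj => ?_, hs.joins.sub hs'.joins, fun j => ?_⟩ (ih hw')
      · exact congrArg₂ (· - ·) (hs.left j hj) (hs'.left j hj)
      · exact congrArg₂ (· - ·) (hs.right j) (hs'.right j)

theorem strength_sub (h : x.length = y.length) (p : DirectedPoint) :
    strength (List.zipWith (· - ·) x y) p = strength x p - strength y p := by
  have hget : (List.zipWith (· - ·) x y).getD p.level 0 = x.getD p.level 0 - y.getD p.level 0 := by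
    rcases lt_or_ge p.level x.length with ht | ht
    · simp [ht, h ▸ ht]
    · simp [ht, h ▸ ht]
  rw [strength, hget, Pi.sub_apply, mul_sub, strength, strength]

theorem HasMarkStrength.sub {z z' : ℤ} (hx : HasMarkStrength w x c z)
    (hy : HasMarkStrength w y c z') (h : w.length = x.length) (h' : w.length = y.length) :
    HasMarkStrength w (List.zipWith (· - ·) x y) c (z - z') :=
  (hasMarkStrength_iff (by simp [← h, ← h'])).2 fun t i d ht => by
    rw [strength_sub (h.symm.trans h'), (hasMarkStrength_iff h).1 hx t i d ht,
      (hasMarkStrength_iff h').1 hy t i d ht]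

theorem IsComponentFlow.unique (hx : IsComponentFlow w c x) (hy : IsComponentFlow w c y) :
    x = y := by
  have hl := hx.flow.length_eq.symm.trans hy.flow.length_eq
  have hsub := hx.flow.sub hy.flow
  rw [sub_zero] at hsub
  have hz : HasMarkStrength w (List.zipWith (· - ·) x y) c 0 :=
    sub_self (1 : ℤ) ▸ hx.hasMarkStrength.sub hy.hasMarkStrength hx.flow.length_eq hy.flow.length_eq
  refine List.ext_getElem hl fun t ht ht' => funext fun i => ?_
  have ex := (flowDisjoint_iff (hx.flow.length_eq.symm.trans hsub.length_eq)).1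
    (hx.flowDisjoint _ hsub hz) t i
  have ey := (flowDisjoint_iff (hy.flow.length_eq.symm.trans hsub.length_eq)).1
    (hy.flowDisjoint _ hsub hz) t i
  simp only [List.getD_eq_getElem?_getD, ht, ht', getElem?_pos, Option.getD_some,
    List.length_zipWith, lt_inf_iff, and_self, List.getElem_zipWith, Pi.sub_apply,
    mul_eq_zero] at ex ey
  omega

theorem Flow.isComponentFlow_directions (hx : Flow w x 0 0) (h : IsTangle w 0 0)
    (hc : HasMarkStrength w x c 1) : IsComponentFlow w c (directions w c) where
  flow := flow_directions h c
  hasMarkStrength := hx.hasMarkStrength_directions h hc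
  flowDisjoint y hy hz := by
    refine (flowDisjoint_iff (length_directions.trans hy.length_eq)).2 fun t i => ?_
    rw [directions_getD h]
    by_cases hon : ∃ d, OnComponent w c ⟨t, i, d⟩
    · obtain ⟨d, hon⟩ := hon
      have e := hy.strength_of_onComponent h hz hon
      cases d <;> simp_all [strength]
    · rw [not_exists] at hon
      simp [direction, hon]

theorem HasCrossingForm.linkingNumber_eq (hw : HasCrossingForm w c c' q) (h : IsTangle w 0 0) :
    linkingNumber w c c' = (q : ℚ) / 2 := by
  obtain ⟨-, -, x, x', hx, hx', -, rfl⟩ := hw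
  rw [linkingNumber_eq_flowForm,
    ← hx.unique (hx.flow.isComponentFlow_directions h hx.hasMarkStrength),
    ← hx'.unique (hx'.flow.isComponentFlow_directions h hx'.hasMarkStrength)]

theorem IsMarked.exists_onComponent (h : IsMarked w c) : ∃ p, OnComponent w c p := by
  obtain ⟨d, i, hm⟩ := h
  obtain ⟨t, ht⟩ := List.mem_iff_getElem?.1 hm
  exact ⟨_, t, i, d, ht, 0, rfl⟩

theorem HasCrossingForm.distinctComponents (hw : HasCrossingForm w c c' q) (h : IsTangle w 0 0) :
    DistinctComponents w c c' := by
  obtain ⟨hc, hc', x, -, hx, -, hz, -⟩ := hw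
  exact ⟨hc.exists_onComponent, hc'.exists_onComponent,
    fun _ _ _ _ => hx.flow.not_onComponent h hx.hasMarkStrength hz⟩

end Invariance

/-! ### Flows on open diagrams and twists -/

section Twisted

variable {w : Diagram} {c c' : Label} {x y : List (ℕ → ℤ)} {v u : ℕ → ℤ} {i j k m n : ℕ} {d : Bool}
  {z : ℤ} {f : F3} {μ : Address → Option Label}

theorem SliceFlow.sum_eq {s : Slice} (h : SliceFlow s v u) (k : ℕ) :
    ∑ i ∈ Finset.range (s.pos + s.inputs + k), v i =
      ∑ i ∈ Finset.range (s.pos + s.outputs + k), u i := by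
  have hjoins := h.joins
  simp only [Finset.sum_range_add, h.right, Finset.sum_congr rfl fun i hi =>
    h.left i (Finset.mem_range.1 hi)]
  cases s <;> simp only [Slice.Joins, pos, inputs, outputs, Finset.sum_range_succ,
    Finset.sum_range_zero, zero_add, add_zero] at hjoins ⊢ <;> linarith

theorem Flow.sum_eq (hx : Flow w x v u) (h : IsTangle w k m) :
    ∑ i ∈ Finset.range k, v i = ∑ i ∈ Finset.range m, u i := by
  induction h generalizing x v with
  | nil => rw [(flow_nil_iff.1 hx).2]
  | cons s w r m hs _ ih =>
      obtain ⟨_, y, -, hslice, hflow⟩ := flow_cons_iff.1 hx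
      obtain ⟨l, rfl⟩ := Nat.exists_eq_add_of_le hs
      rw [Nat.add_right_comm, hslice.sum_eq l, Nat.add_right_comm, ih hflow]

theorem Flow.right_eq (hx : Flow w x v u) (h : IsTangle w k m) (j : ℕ) : v (k + j) = u (m + j) := by
  induction h generalizing x v with
  | nil => rw [(flow_nil_iff.1 hx).2]
  | cons s w r m hs _ ih =>
      obtain ⟨_, y, -, hslice, hflow⟩ := flow_cons_iff.1 hx
      obtain ⟨l, rfl⟩ := Nat.exists_eq_add_of_le hs
      calc v (s.pos + l + s.inputs + j) = v (s.pos + s.inputs + (l + j)) := by congr 1; omega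
        _ = _ := hslice.right (l + j)
        _ = u (m + j) := by rw [← ih hflow]; congr 1; omega

theorem Flow.left_eq (hx : Flow (shift i w) x v u) (hj : j < i) : v j = u j := by
  induction w generalizing x v with
  | nil => rw [(flow_nil_iff.1 hx).2]
  | cons s w ih =>
      obtain ⟨m, y, -, hs, hw⟩ := flow_cons_iff.1 hx
      rw [hs.left j (by rw [Slice.pos_shift]; omega), ih hw]

theorem Flow.eq_of_openDiagram (hx : Flow (openDiagram f μ i) x v u) : v = u := by
  have h := (isTangle_openDiagram f μ).shift i
  have hx' : Flow (shift i (openDiagram f μ 0)) x v u := by rwa [shift_openDiagram, zero_add]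
  have hsum := hx'.sum_eq h
  have hleft : ∑ j ∈ Finset.range i, v j = ∑ j ∈ Finset.range i, u j :=
    Finset.sum_congr rfl fun j hj => hx'.left_eq (Finset.mem_range.1 hj)
  funext j
  rcases lt_or_exists_eq_add i 1 j with hj | ⟨j, hj, rfl⟩ | ⟨j, rfl⟩
  · exact hx'.left_eq hj
  · obtain rfl : j = 0 := by omega
    rwa [add_comm 1, Finset.sum_range_succ, Finset.sum_range_succ, hleft, add_right_inj] at hsum
  · rw [add_comm i 1]
    exact hx'.right_eq h j

theorem flow_shift_replicate (hv : ∀ j, k ≤ j → v j = 0) (w : Diagram) :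
    Flow (shift k w) (List.replicate w.length v) v v := by
  induction w with
  | nil => exact .nil v
  | cons s w ih =>
      refine .cons ⟨fun _ _ => rfl, ?_, fun j => ?_⟩ ih
      · have hzero (i j : ℕ) : v (i + k + j) = 0 := hv _ (by omega)
        cases s <;> simp [Slice.Joins, Slice.pos, hzero]
      · rw [hv _ (by rw [Slice.pos_shift]; omega), hv _ (by rw [Slice.pos_shift]; omega)]

theorem flowForm_comm : flowForm w x y = flowForm w y x := by
  have hslice (s : Slice) (v u : ℕ → ℤ) : sliceForm s v u = sliceForm s u v := by
    cases s <;> simp only [sliceForm]; ring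
  rw [flowForm, ← List.zip_swap y x, List.zip_map_right, List.map_map]
  exact congrArg List.sum (List.map_congr_left fun p _ => hslice _ _ _)

theorem flowForm_shift_eq_zero (hx : ∀ v ∈ x, ∀ j, k ≤ j → v j = 0) :
    flowForm (shift k w) x y = 0 := by
  refine List.sum_eq_zero fun q hq => ?_
  obtain ⟨⟨s, v, u⟩, hp, rfl⟩ := List.mem_map.1 hq
  obtain ⟨s, -, rfl⟩ := List.mem_map.1 (List.of_mem_zip hp).1
  have hv := hx v (List.of_mem_zip (List.of_mem_zip hp).2).1
  have hv' (i : ℕ) : v (i + k + 1) = 0 := hv _ (by omega)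
  cases s <;> simp [sliceForm, hv, hv']

theorem flowForm_openDiagram_eq_zero (hx : ∀ v ∈ x, ∀ j, k ≤ j → v j = 0) :
    flowForm (openDiagram f μ k) x y = 0 := by
  rw [← zero_add k, ← shift_openDiagram]
  exact flowForm_shift_eq_zero hx

theorem hasMarkStrength_of_not_isMarked (h : ¬ IsMarked w c) : HasMarkStrength w x c z := by
  rintro ⟨s, v⟩ hp
  have hs := (List.of_mem_zip hp).1
  cases s with
  | mark c' d i =>
      rintro rfl
      exact absurd ⟨d, i, hs⟩ h
  | _ => trivial

theorem not_isMarked_openDiagram_none : ¬ IsMarked (openDiagram f (fun _ => none) i) c := by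
  have hupper (T : TernaryTree) (i : ℕ) : ¬ IsMarked (upperDiagram T (fun _ => none) i) c := by
    induction T generalizing i <;> simp_all [upperDiagram, IsMarked]
  have hlower (T : TernaryTree) (i : ℕ) : ¬ IsMarked (lowerDiagram T i) c := by
    induction T generalizing i <;> simp_all [lowerDiagram, IsMarked]
  rw [openDiagram, isMarked_append_iff, not_or]
  exact ⟨hupper _ _, hlower _ _⟩

theorem openDiagram_markRoot :
    openDiagram f (markRoot c) i = mark c true i :: openDiagram f (fun _ => none) i := by
  cases hf : f.upper <;> simp [openDiagram, hf, upperDiagram, markRoot]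

theorem Flow.hasMarkStrength_openDiagram_iff (hx : Flow (openDiagram f (markRoot c) i) x v u) :
    HasMarkStrength (openDiagram f (markRoot c) i) x c' z ↔ (c = c' → v i = z) := by
  rw [openDiagram_markRoot] at hx ⊢
  obtain ⟨_, y, rfl, -, -⟩ := flow_cons_iff.1 hx
  rw [← List.singleton_append, ← List.singleton_append (l := y), hasMarkStrength_append_iff rfl,
    and_iff_left (hasMarkStrength_of_not_isMarked not_isMarked_openDiagram_none)]
  simp [HasMarkStrength, Slice.HasMarkStrength]

/-- The strengths of a flow in a two-strand braid with `2 * n` crossings, with the values `v` at the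
top. -/
def twistFlow (n i : ℕ) (v : ℕ → ℤ) : List (ℕ → ℤ) :=
  (List.replicate n [v, v ∘ Equiv.swap i (i + 1)]).flatten

theorem replicate_two_mul_succ (n : ℕ) (s : Slice) :
    List.replicate (2 * (n + 1)) s = [s, s] ++ List.replicate (2 * n) s := rfl

theorem twistFlow_succ (n i : ℕ) (v : ℕ → ℤ) :
    twistFlow (n + 1) i v = [v, v ∘ Equiv.swap i (i + 1)] ++ twistFlow n i v := rfl

theorem flow_even_twist_iff :
    Flow (List.replicate (2 * n) (cross d i)) x v u ↔ x = twistFlow n i v ∧ v = u := by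
  induction n generalizing x with
  | zero => exact flow_nil_iff
  | succ n ih =>
      have hswap : (v ∘ Equiv.swap i (i + 1)) ∘ Equiv.swap i (i + 1) = v := by funext; simp
      simp only [replicate_two_mul_succ, flow_append_iff, flow_pair_iff, sliceFlow_cross_iff,
        twistFlow_succ]
      constructor
      · rintro ⟨_, _, y, rfl, ⟨_, rfl, rfl, rfl⟩, hy⟩
        rw [hswap, ih] at hy
        exact ⟨by rw [hy.1], hy.2⟩
      · rintro ⟨rfl, rfl⟩
        exact ⟨v, _, _, rfl, ⟨_, rfl, rfl, hswap.symm⟩, ih.2 ⟨rfl, rfl⟩⟩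

theorem length_twistFlow : (twistFlow n i v).length = 2 * n := by
  simp [twistFlow, mul_comm]

theorem flowForm_even_twist : flowForm (List.replicate (2 * n) (cross d i)) (twistFlow n i v)
    (twistFlow n i u) = 2 * n * ((if d then 1 else -1) * (v i * u (i + 1) + u i * v (i + 1))) := by
  induction n with
  | zero => simp [twistFlow, flowForm]
  | succ n ih =>
      rw [replicate_two_mul_succ, twistFlow_succ, twistFlow_succ, flowForm_append (by rfl) (by rfl),
        ih]
      simp only [flowForm, sliceForm, List.zip_cons_cons, List.zip_nil_right, List.map_cons,
        List.map_nil, List.sum_cons, List.sum_nil, Function.comp_apply, Equiv.swap_apply_left,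
        Equiv.swap_apply_right, Nat.cast_succ]
      ring

end Twisted

/-! ### The crossing form of the twisted diagram -/

section TwistedDiagram

variable {w : Diagram} {c c' : Label} {x y xf xg : List (ℕ → ℤ)} {v v' u : ℕ → ℤ} {i j n : ℕ}
  {d : Bool} {z : ℤ} {f g : F3}

theorem mul_sub_eq_zero_of_flowDisjoint (h : x.length = y.length)
    (hd : FlowDisjoint x (List.zipWith (· - ·) x y)) : ∀ p ∈ x.zip y, p.1 * (p.1 - p.2) = 0 := by
  induction x generalizing y with
  | nil => simp
  | cons v x ih =>
      obtain ⟨u, y, rfl⟩ := List.exists_cons_of_length_eq_add_one h.symm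
      rw [FlowDisjoint, List.zipWith_cons_cons, List.zip_cons_cons, List.forall_mem_cons] at hd
      rw [List.zip_cons_cons, List.forall_mem_cons]
      exact ⟨hd.1, ih (Nat.succ.inj h) hd.2⟩

theorem IsComponentFlow.mul_sub_eq_zero (hx : IsComponentFlow w c x) (hy : Flow w y 0 0)
    (hc : HasMarkStrength w y c 1) : ∀ p ∈ x.zip y, p.1 * (p.1 - p.2) = 0 := by
  have hl := hx.flow.length_eq.symm.trans hy.length_eq
  have hsub := hx.flow.sub hy
  rw [sub_zero] at hsub
  refine mul_sub_eq_zero_of_flowDisjoint hl (hx.flowDisjoint _ hsub ?_)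
  exact sub_self (1 : ℤ) ▸ hx.hasMarkStrength.sub hc hx.flow.length_eq hy.length_eq

/-- The strengths of a flow on the twisted diagram: `xf` and `xg` are those on the inserted
diagrams, `v` and `v'` those on the strands between the pieces, before and after the second local
maximum. -/
def twistedFlow (n : ℕ) (xf xg : List (ℕ → ℤ)) (v v' : ℕ → ℤ) : List (ℕ → ℤ) :=
  [0] ++ xf ++ [v] ++ xg ++ twistFlow n 1 v' ++ [v', v]

/-- The conditions under which `twistedFlow n xf xg v v'` is a flow on `twistedDiagram j n f g`; the
twists impose none, since they consist of an even number of crossings. -/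
structure IsTwistedFlow (j : ℕ) (f g : F3) (xf xg : List (ℕ → ℤ)) (v v' : ℕ → ℤ) : Prop where
  cap_left : SliceFlow (cap 0) 0 v
  flow_left : Flow (openDiagram f (markRoot Label.Kf) 1) xf v v
  cap_right : SliceFlow (cap 2) v v'
  flow_right : Flow (openDiagram g (markRoot Label.Kg) j) xg v' v'

theorem sliceFlow_cup_comm : SliceFlow (cup i) v u ↔ SliceFlow (cap i) u v := by
  rw [sliceFlow_cap_iff, sliceFlow_cup_iff]

theorem flow_twistedDiagram_iff : Flow (twistedDiagram j n f g) x 0 0 ↔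
    ∃ xf xg v v', x = twistedFlow n xf xg v v' ∧ IsTwistedFlow j f g xf xg v v' := by
  simp only [twistedDiagram, flow_append_iff, flow_singleton_iff, flow_pair_iff,
    flow_even_twist_iff]
  constructor
  · rintro ⟨v', _, _, rfl, ⟨_, _, _, rfl, ⟨_, _, xg, rfl, ⟨_, _, _, rfl, ⟨v₀, _, xf, rfl,
      ⟨rfl, hcap⟩, hf⟩, rfl, hcap'⟩, hg⟩, rfl, rfl⟩, m, rfl, hcup, -⟩
    obtain rfl := hf.eq_of_openDiagram
    obtain rfl := hg.eq_of_openDiagram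
    obtain rfl : m = v₀ := by
      rw [(sliceFlow_cup_iff.1 hcup).2, (sliceFlow_cap_iff.1 hcap').2]
    exact ⟨xf, xg, _, _, by simp [twistedFlow], hcap, hf, hcap', hg⟩
  · rintro ⟨xf, xg, v, v', rfl, hcap, hf, hcap', hg⟩
    exact ⟨v', _, _, rfl, ⟨v', _, _, rfl, ⟨v', _, _, rfl, ⟨v, _, _, rfl, ⟨v, _, _, rfl,
      ⟨rfl, hcap⟩, hf⟩, rfl, hcap'⟩, hg⟩, rfl, rfl⟩, v, rfl, sliceFlow_cup_comm.2 hcap',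
      sliceFlow_cup_comm.2 hcap⟩

theorem IsTwistedFlow.eq_zero (h : IsTwistedFlow j f g xf xg v v') (hi : 2 ≤ i) : v i = 0 := by
  obtain ⟨i, rfl⟩ := Nat.exists_eq_add_of_le' hi
  exact (congrFun (sliceFlow_cap_iff.1 h.cap_left).2 i).symm

theorem IsTwistedFlow.truncate (h : IsTwistedFlow j f g xf xg v v') (hj : 2 ≤ j) :
    IsTwistedFlow j f g xf (List.replicate xg.length v) v v where
  cap_left := h.cap_left
  flow_left := h.flow_left
  cap_right := by
    refine sliceFlow_cap_iff.2 ⟨by simp [h.eq_zero], funext fun i => ?_⟩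
    rcases lt_or_ge i 2 with hi | hi
    · simp [skipTwo, hi]
    · rw [h.eq_zero hi, Function.comp_apply, h.eq_zero (by simp [skipTwo, hi.not_gt])]
  flow_right := by
    rw [← h.flow_right.length_eq, ← zero_add j, ← shift_openDiagram, shift, List.length_map]
    exact flow_shift_replicate (fun i hi => h.eq_zero (hj.trans hi)) _

theorem IsTwistedFlow.hasMarkStrength_iff (h : IsTwistedFlow j f g xf xg v v') :
    HasMarkStrength (twistedDiagram j n f g) (twistedFlow n xf xg v v') c z ↔
      (Label.Kf = c → v 1 = z) ∧ (Label.Kg = c → v' j = z) := by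
  have lf := h.flow_left.length_eq
  have lg := h.flow_right.length_eq
  have hunmarked (w : Diagram) (x : List (ℕ → ℤ)) (hw : ∀ c d i, mark c d i ∉ w) :
      HasMarkStrength w x c z := hasMarkStrength_of_not_isMarked fun ⟨d, i, hi⟩ => hw c d i hi
  rw [twistedDiagram, twistedFlow, hasMarkStrength_append_iff (by simp [lf, lg, length_twistFlow]),
    hasMarkStrength_append_iff (by simp [lf, lg]), hasMarkStrength_append_iff (by simp [lf]),
    hasMarkStrength_append_iff (by simp [lf]), hasMarkStrength_append_iff (by simp),
    h.flow_left.hasMarkStrength_openDiagram_iff, h.flow_right.hasMarkStrength_openDiagram_iff]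
  simp [hunmarked]

theorem flowForm_twistedDiagram {yf yg : List (ℕ → ℤ)} {u u' : ℕ → ℤ}
    (hx : IsTwistedFlow j f g xf xg v v') (hy : IsTwistedFlow j f g yf yg u u') :
    flowForm (twistedDiagram j n f g) (twistedFlow n xf xg v v') (twistedFlow n yf yg u u') =
      flowForm (openDiagram f (markRoot Label.Kf) 1) xf yf +
        flowForm (openDiagram g (markRoot Label.Kg) j) xg yg +
        2 * n * (v' 1 * u' 2 + u' 1 * v' 2) := by
  have lf := hx.flow_left.length_eq
  have lg := hx.flow_right.length_eq
  have lf' := hy.flow_left.length_eq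
  have lg' := hy.flow_right.length_eq
  rw [twistedDiagram, twistedFlow, twistedFlow,
    flowForm_append (by simp [lf, lg, length_twistFlow])
      (by simp [← lf, ← lg, ← lf', ← lg', length_twistFlow]),
    flowForm_append (by simp [lf, lg]) (by simp [← lf, ← lg, ← lf', ← lg']),
    flowForm_append (by simp [lf]) (by simp [← lf, ← lf']),
    flowForm_append (by simp [lf]) (by simp [← lf, ← lf']),
    flowForm_append (by simp) (by simp), flowForm_even_twist]
  simp [flowForm, sliceForm]

theorem isComponentFlow_directions {l r : Diagram} (h : IsTangle w 0 0)
    (hw : w = l ++ mark c d i :: r) (hl : ¬ IsMarked l c) (hr : ¬ IsMarked r c) :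
    IsComponentFlow w c (directions w c) := by
  have level_eq {t i' d'} (ht : w[t]? = some (mark c d' i')) : t = l.length := by
    rcases lt_trichotomy t l.length with hlt | rfl | hlt
    · rw [hw, List.getElem?_append_left hlt] at ht
      exact absurd ⟨d', i', List.mem_of_getElem? ht⟩ hl
    · rfl
    · obtain ⟨k, rfl⟩ := Nat.exists_eq_add_of_lt hlt
      rw [hw, List.getElem?_append_right (by omega), Nat.add_assoc, Nat.add_sub_cancel_left,
        List.getElem?_cons_succ] at ht
      exact absurd ⟨d', i', List.mem_of_getElem? ht⟩ hr
  refine (flow_directions h c).isComponentFlow_directions h <|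
    (hasMarkStrength_iff length_directions.symm).2 fun t i d ht => ?_
  have hon : OnComponent w c ⟨t, i, d⟩ := ⟨t, i, d, ht, 0, rfl⟩
  have hoff : ¬ OnComponent w c ⟨t, i, !d⟩ := by
    rintro ⟨t', i', d', ht', k, hk⟩
    obtain rfl : t' = t := (level_eq ht').trans (level_eq ht).symm
    obtain ⟨rfl, rfl⟩ : d' = d ∧ i' = i := by simpa [ht] using ht'.symm
    exact iterate_ne_rev h (inside_of_mark h ht) k hk
  rw [strength, directions_getD h]
  cases d <;> simp_all [direction]

theorem isTangle_twistedDiagram (hj : j = 2 ∨ j = 3) : IsTangle (twistedDiagram j n f g) 0 0 := by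
  have hcap : IsTangle [cap 0] 0 2 := .cons (cap 0) [] 0 2 le_rfl (.nil 2)
  have hcap' : IsTangle [cap 2] 2 4 := .cons (cap 2) [] 2 4 le_rfl (.nil 4)
  have hcups : IsTangle [cup 2, cup 0] 4 0 :=
    .cons (cup 2) _ 2 0 le_rfl (.cons (cup 0) [] 0 0 le_rfl (.nil 0))
  have hf := (isTangle_openDiagram f (markRoot Label.Kf)).shift 1
  have hg : IsTangle (openDiagram g (markRoot Label.Kg) j) 4 4 := by
    have h := (isTangle_openDiagram g (markRoot Label.Kg)).shift j
    rw [shift_openDiagram, zero_add] at h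
    rcases hj with rfl | rfl
    · exact h.widen 1
    · exact h
  have htwist (m : ℕ) : IsTangle (List.replicate m (cross true 1)) 4 4 := by
    induction m with
    | zero => exact .nil 4
    | succ m ih => exact .cons (cross true 1) _ 2 4 one_le_two ih
  rw [shift_openDiagram] at hf
  exact ((((hcap.append hf).append hcap').append hg).append (htwist _)).append hcups

theorem zip_twistedFlow {yf yg : List (ℕ → ℤ)} {u u' : ℕ → ℤ}
    (hx : IsTwistedFlow j f g xf xg v v') (hy : IsTwistedFlow j f g yf yg u u') :
    (twistedFlow n xf xg v v').zip (twistedFlow n yf yg u u') =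
      [(0, 0)] ++ xf.zip yf ++ [(v, u)] ++ xg.zip yg ++ (twistFlow n 1 v').zip (twistFlow n 1 u') ++
        [(v', u'), (v, u)] := by
  have lf := hx.flow_left.length_eq.symm.trans hy.flow_left.length_eq
  have lg := hx.flow_right.length_eq.symm.trans hy.flow_right.length_eq
  simp [twistedFlow, List.zip_append, lf, lg, length_twistFlow]

theorem IsTwistedFlow.eq_zero_of_isComponentFlow_left (h : IsTwistedFlow j f g xf xg v v')
    (hj : 2 ≤ j)
    (hx : IsComponentFlow (twistedDiagram j n f g) Label.Kf (twistedFlow n xf xg v v')) :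
    ∀ u ∈ v' :: xg, ∀ i, 2 ≤ i → u i = 0 := by
  have hmark := (h.hasMarkStrength_iff.1 hx.hasMarkStrength).1 rfl
  have htrunc := h.truncate hj
  have hsupp := hx.mul_sub_eq_zero (flow_twistedDiagram_iff.2 ⟨_, _, _, _, rfl, htrunc⟩)
    (htrunc.hasMarkStrength_iff.2 ⟨fun _ => hmark, by rintro ⟨⟩⟩)
  rw [zip_twistedFlow h htrunc] at hsupp
  intro u hu i hi
  have hp : (u, v) ∈ (v', v) :: xg.zip (List.replicate xg.length v) := by
    obtain rfl | hu := List.mem_cons.1 hu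
    · exact List.mem_cons_self
    · obtain ⟨t, ht, rfl⟩ := List.mem_iff_getElem.1 hu
      exact List.mem_cons_of_mem _ (List.mem_iff_getElem.2 ⟨t, by simpa using ht, by simp⟩)
  have e := congrFun (hsupp (u, v) (by simp at hp ⊢; tauto)) i
  simpa [h.eq_zero hi] using e

theorem IsTwistedFlow.eq_zero_of_isComponentFlow_right (h : IsTwistedFlow j f g xf xg v v')
    (hj : 2 ≤ j)
    (hx : IsComponentFlow (twistedDiagram j n f g) Label.Kg (twistedFlow n xf xg v v')) :
    ∀ u ∈ v :: xf, u = 0 := by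
  have htrunc := h.truncate hj
  have hd := hx.flowDisjoint _ (flow_twistedDiagram_iff.2 ⟨_, _, _, _, rfl, htrunc⟩)
    (htrunc.hasMarkStrength_iff.2 ⟨by rintro ⟨⟩, fun _ => h.eq_zero hj⟩)
  rw [FlowDisjoint, zip_twistedFlow h htrunc] at hd
  intro u hu
  have hp : (u, u) ∈ (v, v) :: xf.zip xf := by
    rw [← List.zip_cons_cons]
    obtain ⟨t, ht, rfl⟩ := List.mem_iff_getElem.1 hu
    exact List.mem_iff_getElem.2 ⟨t, by simpa using ht, List.getElem_zip⟩
  have e := hd (u, u) (by simp at hp ⊢; tauto)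
  exact funext fun i => mul_self_eq_zero.1 (congrFun e i)

theorem not_isMarked_openDiagram_markRoot (h : c ≠ c') :
    ¬ IsMarked (openDiagram f (markRoot c) i) c' := by
  rw [openDiagram_markRoot, ← List.singleton_append, isMarked_append_iff, not_or]
  exact ⟨by simp [IsMarked, h.symm], not_isMarked_openDiagram_none⟩

theorem isMarked_openDiagram_markRoot : IsMarked (openDiagram f (markRoot c) i) c := by
  rw [openDiagram_markRoot]
  exact ⟨true, i, List.mem_cons_self⟩

theorem isMarked_twistedDiagram : IsMarked (twistedDiagram j n f g) c := by
  simp only [twistedDiagram, isMarked_append_iff]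
  cases c <;> simp [isMarked_openDiagram_markRoot]

theorem isComponentFlow_twistedDiagram (hj : j = 2 ∨ j = 3) :
    IsComponentFlow (twistedDiagram j n f g) c (directions (twistedDiagram j n f g) c) := by
  have h := isTangle_twistedDiagram (n := n) (f := f) (g := g) hj
  have htail : ¬ IsMarked (List.replicate (2 * n) (cross true 1) ++ [cup 2, cup 0]) c := by
    simp [IsMarked]
  have hcap (k : ℕ) : ¬ IsMarked [cap k] c := by simp [IsMarked]
  cases c
  · refine isComponentFlow_directions h (l := [cap 0]) (d := true) (i := 1)
      (r := openDiagram f (fun _ => none) 1 ++ ([cap 2] ++ (openDiagram g (markRoot Label.Kg) j ++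
        (List.replicate (2 * n) (cross true 1) ++ [cup 2, cup 0]))))
      (by simp [twistedDiagram, openDiagram_markRoot]) (hcap 0) ?_
    simp only [isMarked_append_iff, not_or]
    exact ⟨not_isMarked_openDiagram_none, hcap 2, not_isMarked_openDiagram_markRoot (by simp),
      by simpa only [isMarked_append_iff, not_or] using htail⟩
  · refine isComponentFlow_directions h
      (l := [cap 0] ++ openDiagram f (markRoot Label.Kf) 1 ++ [cap 2]) (d := true) (i := j)
      (r := openDiagram g (fun _ => none) j ++
        (List.replicate (2 * n) (cross true 1) ++ [cup 2, cup 0]))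
      (by simp [twistedDiagram, openDiagram_markRoot]) ?_ ?_
    · simp only [isMarked_append_iff, not_or]
      exact ⟨⟨hcap 0, not_isMarked_openDiagram_markRoot (by simp)⟩, hcap 2⟩
    · rw [isMarked_append_iff, not_or]
      exact ⟨not_isMarked_openDiagram_none, htail⟩

theorem hasCrossingForm_twistedDiagram (n : ℕ) (f g : F3) (hj : j = 2 ∨ j = 3) :
    HasCrossingForm (twistedDiagram j n f g) Label.Kf Label.Kg
      (2 * n * if j = 2 then 1 else -1) := by
  have hj' : 2 ≤ j := by omega
  have hf := isComponentFlow_twistedDiagram (n := n) (f := f) (g := g) (c := Label.Kf) hj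
  have hg := isComponentFlow_twistedDiagram (n := n) (f := f) (g := g) (c := Label.Kg) hj
  obtain ⟨xf, xg, v, v', ex, hx⟩ := flow_twistedDiagram_iff.1 hf.flow
  obtain ⟨yf, yg, u, u', ey, hy⟩ := flow_twistedDiagram_iff.1 hg.flow
  rw [ex] at hf
  rw [ey] at hg
  have hzf := hx.eq_zero_of_isComponentFlow_left hj' hf
  have hzg := hy.eq_zero_of_isComponentFlow_right hj' hg
  rw [List.forall_mem_cons] at hzf hzg
  obtain ⟨hv', hxg⟩ := hzf
  obtain ⟨rfl, hyf⟩ := hzg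
  refine ⟨isMarked_twistedDiagram, isMarked_twistedDiagram, _, _, hf, hg,
    hx.hasMarkStrength_iff.2 ⟨by rintro ⟨⟩, fun _ => hv' j hj'⟩, ?_⟩
  have hform_f : flowForm (openDiagram f (markRoot Label.Kf) 1) xf yf = 0 := by
    rw [flowForm_comm]
    exact flowForm_openDiagram_eq_zero fun w hw j _ => by rw [hyf w hw, Pi.zero_apply]
  have hform_g : flowForm (openDiagram g (markRoot Label.Kg) j) xg yg = 0 :=
    flowForm_openDiagram_eq_zero fun w hw i hi => hxg w hw i (hj'.trans hi)
  have hv : v' 1 = 1 := by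
    rw [← (hx.hasMarkStrength_iff.1 hf.hasMarkStrength).1 rfl, (sliceFlow_cap_iff.1 hx.cap_right).2]
    simp [skipTwo]
  have hu : u' 1 = 0 := by
    have e := congrFun (sliceFlow_cap_iff.1 hy.cap_right).2 1
    simpa [skipTwo] using e.symm
  have hu' : u' 2 = if j = 2 then 1 else -1 := by
    have hmark := (hy.hasMarkStrength_iff.1 hg.hasMarkStrength).2 rfl
    have hcap := (sliceFlow_cap_iff.1 hy.cap_right).1
    rcases hj with rfl | rfl
    · simpa using hmark
    · simp at hcap ⊢; linarith
  rw [flowForm_twistedDiagram hx hy, hform_f, hform_g, hv, hu, hu']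
  ring

end TwistedDiagram

end ThompsonLink

theorem mainTheorem6 (f g : F3) (n : ℕ) (hn : 1 ≤ n) :
    (DistinctComponents (linkPosDiagram n f g) Label.Kf Label.Kg ∧
      linkingNumber (linkPosDiagram n f g) Label.Kf Label.Kg = n ∧
      LinkIsotopic (linkPosDiagram n f g) (twistedDiagram 2 n f g)) ∧
    (DistinctComponents (linkNegDiagram n f g) Label.Kf Label.Kg ∧
      linkingNumber (linkNegDiagram n f g) Label.Kf Label.Kg = -n ∧
      LinkIsotopic (linkNegDiagram n f g) (twistedDiagram 3 n f g)) := by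
  have isotopicPos := linkIsotopic_pos hn f g
  have isotopicNeg := linkIsotopic_neg hn f g
  have formPos : HasCrossingForm (linkPosDiagram n f g) Label.Kf Label.Kg (2 * n) :=
    isotopicPos.hasCrossingForm_iff.2 <| by
      simpa using hasCrossingForm_twistedDiagram n f g (.inl rfl)
  have formNeg : HasCrossingForm (linkNegDiagram n f g) Label.Kf Label.Kg (2 * -n) :=
    isotopicNeg.hasCrossingForm_iff.2 <| by
      simpa using hasCrossingForm_twistedDiagram n f g (.inr rfl)
  refine ⟨⟨formPos.distinctComponents isotopicPos.1, ?_, isotopicPos⟩,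
    formNeg.distinctComponents isotopicNeg.1, ?_, isotopicNeg⟩
  · rw [formPos.linkingNumber_eq isotopicPos.1]; push_cast; ring
  · rw [formNeg.linkingNumber_eq isotopicNeg.1]; push_cast; ring
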